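/- Notation. For $s\in\mathbb R$ let $H_+^s[0,1]$ (resp. $H_-^s[0,1]$) be the space of Fourier series $f=\sum_k \widehat f(k)e^{i\pi kx}$, the sum over even (resp. odd) integers $k$, with $\|f\|_{H_\pm^s}:=\big(\sum_k (1+|k|)^{2s}|\widehat f(k)|^2\big)^{1/2}<\infty$ (1-periodic, resp. semi-periodic, distributions). For $m\in\mathbb N=\{1,2,\dots\}$ and $V\in H_+^{-m}[0,1]$ let $L_m(V)=D^{2m}+V$, $D=-i\,d/dx$, be the unbounded operator in $H_-^{-m}[0,1]$ with domain $H_-^m[0,1]$, the product being defined by $\widehat{Vu}(k)=\sum_j\widehat V(k-j)\widehat u(j)$. Let $T_{M,n_0}=\{\lambda\in\mathbb C: |\mathrm{Im}\,\lambda|-M\le \mathrm{Re}\,\lambda\le((2n_0)^{2m}-(2n_0)^m)\pi^{2m}\}$. Below, "the eigenvalues of $L_m(W)$ are localized by $(M,n_0,(r_n))$" means: the spectrum of $L_m(W)$ consists of a sequence of eigenvalues $\lambda_k(m,W)$, $k\ge1$, repeated according to their finite algebraic multiplicities and ordered lexicographically (by real part, then by imaginary part), with $\mathrm{Re}\,\lambda_k\to+\infty$;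 exactly $2n_0$ of them (counted with multiplicity) lie in $T_{M,n_0}$; and for all $n>n_0$ both $|\lambda_{2n-1}(m,W)-(2n-1)^{2m}\pi^{2m}|<r_n$ and $|\lambda_{2n}(m,W)-(2n-1)^{2m}\pi^{2m}|<r_n$. Theorem. Let $m\in\mathbb N$. (1) Let $V\in H_+^{-m}[0,1]$ (the case $\alpha=1$). There exist $\varepsilon>0$, $M\ge1$ and $n_0\in\mathbb N$ such that for every $W\in H_+^{-m}[0,1]$ with $\|W-V\|_{H_+^{-m}}\le\varepsilon$ the eigenvalues of $L_m(W)$ are localized by $(M,n_0,((2n-1)^m))$. (2) Let $\alpha\in[0,1)$, $R>0$ and $C>1$. There exist $M=M(R)\ge1$ and $n_0=n_0(R,C)\in\mathbb N$ (for given $m$ and $\alpha$; $M$ does not depend on $C$) such that for every $V\in H_+^{-m\alpha}[0,1]$ with $\|V\|_{H_+^{-m\alpha}}\le R$ the eigenvalues of $L_m(V)$ are localized by $(M,n_0,(3^m\sqrt2\,CR\,(2n-1)^{m\alpha}))$. The constant $n_0$ is effective: there is a computable function $N$ of four natural numbers such that $n_0=N(m,p,q,l)$ is admissible for any $p,q,l\in\{0,1,2,\dots\}$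 with $\alpha\le1-\frac1{p+1}$, $R\le q$ and $C\ge1+\frac1{l+1}$. -/

import Mathlib

open Filter Topology

noncomputable section

/-! A periodic or semi-periodic distribution on `[0,1]` is given by its Fourier series
`f = ∑ a(k) e^{iπkx}`, `k ∈ ℤ`, i.e. by the sequence `a : ℤ → ℂ` of its Fourier coefficients
`a(k) = ⟨f, e^{iπkx}⟩`; it is 1-periodic if only even frequencies occur and semi-periodic
(`f(x+1) = -f(x)`) if only odd frequencies occur. -/

/-- `⟨k⟩ = 1 + |k|`. -/
def bracket (k : ℤ) : ℝ := 1 + |(k : ℝ)|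

lemma one_le_bracket (k : ℤ) : 1 ≤ bracket k := by
  unfold bracket; linarith [abs_nonneg (k : ℝ)]

lemma bracket_pos (k : ℤ) : 0 < bracket k := lt_of_lt_of_le one_pos (one_le_bracket k)

/-- The norm `(∑ₖ ⟨k⟩^{2s} |a(k)|²)^{1/2}` of order `s`. -/
def sobolevNorm (s : ℝ) (a : ℤ → ℂ) : ℝ :=
  Real.sqrt (∑' k : ℤ, bracket k ^ (2 * s) * ‖a k‖ ^ 2)

/-- Fourier series of finite norm of order `s`. -/
def sobolevSeq (s : ℝ) : Submodule ℂ (ℤ → ℂ) where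
  carrier := {a | Summable fun k : ℤ => bracket k ^ (2 * s) * ‖a k‖ ^ 2}
  zero_mem' := by simp
  add_mem' := by
    intro a b ha hb
    refine Summable.of_nonneg_of_le (fun k => ?_) (fun k => ?_) ((ha.add hb).mul_left 2)
    · exact mul_nonneg (Real.rpow_nonneg (bracket_pos k).le _) (sq_nonneg _)
    · have h1 : ‖(a + b) k‖ ^ 2 ≤ 2 * (‖a k‖ ^ 2 + ‖b k‖ ^ 2) := by
        have h2 : ‖(a + b) k‖ ≤ ‖a k‖ + ‖b k‖ := norm_add_le _ _
        nlinarith [norm_nonneg ((a + b) k), sq_nonneg (‖a k‖ - ‖b k‖)]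
      have h3 := mul_le_mul_of_nonneg_left h1
        (Real.rpow_nonneg (bracket_pos k).le (2 * s))
      linarith
  smul_mem' := by
    intro c a ha
    have h : (fun k : ℤ => bracket k ^ (2 * s) * ‖(c • a) k‖ ^ 2)
        = fun k : ℤ => ‖c‖ ^ 2 * (bracket k ^ (2 * s) * ‖a k‖ ^ 2) := by
      funext k
      simp only [Pi.smul_apply, smul_eq_mul, norm_mul]
      ring
    change Summable _
    rw [h]
    exact Summable.mul_left (‖c‖ ^ 2) ha

/-- `H_+^s[0,1]`: the 1-periodic distributions of order `s`. -/
def HPlus (s : ℝ) : Submodule ℂ (ℤ → ℂ) :=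
  sobolevSeq s ⊓
    { carrier := {a | ∀ k, Odd k → a k = 0}
      zero_mem' := by simp
      add_mem' := by
        intro a b ha hb k hk
        simp [ha k hk, hb k hk]
      smul_mem' := by
        intro c a ha k hk
        simp [ha k hk] }

/-- `H_-^s[0,1]`: the semi-periodic distributions of order `s`. -/
def HMinus (s : ℝ) : Submodule ℂ (ℤ → ℂ) :=
  sobolevSeq s ⊓
    { carrier := {a | ∀ k, Even k → a k = 0}
      zero_mem' := by simp
      add_mem' := by
        intro a b ha hb k hk
        simp [ha k hk, hb k hk]
      smul_mem' := by
        intro c a ha k hk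
        simp [ha k hk] }

lemma sobolevSeq_anti {s t : ℝ} (hst : s ≤ t) : sobolevSeq t ≤ sobolevSeq s := by
  intro a ha
  refine Summable.of_nonneg_of_le (fun k => ?_) (fun k => ?_) ha
  · exact mul_nonneg (Real.rpow_nonneg (bracket_pos k).le _) (sq_nonneg _)
  · exact mul_le_mul_of_nonneg_right
      (Real.rpow_le_rpow_of_exponent_le (one_le_bracket k) (by linarith)) (sq_nonneg _)

lemma HPlus_anti {s t : ℝ} (hst : s ≤ t) : HPlus t ≤ HPlus s :=
  inf_le_inf_right _ (sobolevSeq_anti hst)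

/-- The inclusion `H_+^{-mα} ⊆ H_+^{-m}` for `α ≤ 1`. -/
def HPlus.incl (m : ℕ) {α : ℝ} (hα : α ≤ 1) (V : HPlus (-(m * α))) : HPlus (-(m : ℝ)) :=
  ⟨V.1, HPlus_anti (by
    have := mul_le_mul_of_nonneg_left hα (Nat.cast_nonneg (α := ℝ) m)
    linarith) V.2⟩

/-- The product of two Fourier series: `(a * b)(k) = ∑ⱼ a(k - j) b(j)`. -/
def fourierMul (a b : ℤ → ℂ) (k : ℤ) : ℂ := ∑' j : ℤ, a (k - j) * b j

lemma mem_sobolevSeq_neg {m : ℕ} {a : ℤ → ℂ} :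
    a ∈ sobolevSeq (-(m : ℝ)) ↔ Summable fun k : ℤ => (bracket k ^ (2 * m))⁻¹ * ‖a k‖ ^ 2 := by
  have h : ∀ k : ℤ, bracket k ^ (2 * (-(m : ℝ))) = (bracket k ^ (2 * m))⁻¹ := by
    intro k
    rw [mul_neg, Real.rpow_neg (bracket_pos k).le, ← Real.rpow_natCast]
    push_cast
    rfl
  change Summable _ ↔ _
  simp only [h]

lemma mem_sobolevSeq_nat {m : ℕ} {a : ℤ → ℂ} :
    a ∈ sobolevSeq (m : ℝ) ↔ Summable fun k : ℤ => bracket k ^ (2 * m) * ‖a k‖ ^ 2 := by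
  have h : ∀ k : ℤ, bracket k ^ (2 * (m : ℝ)) = bracket k ^ (2 * m) := by
    intro k
    rw [← Real.rpow_natCast]
    push_cast
    rfl
  change Summable _ ↔ _
  simp only [h]

lemma bracket_weight (m : ℕ) (k j : ℤ) :
    (bracket k ^ (2 * m))⁻¹ * (bracket (k - j) ^ (2 * m) * (bracket j ^ (2 * m))⁻¹)
      ≤ 2 ^ (2 * m - 1) * ((bracket j ^ (2 * m))⁻¹ + (bracket k ^ (2 * m))⁻¹) := by
  have hk := bracket_pos k
  have hj := bracket_pos j
  have hkj := bracket_pos (k - j)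
  have h1 : bracket (k - j) ≤ bracket j + bracket k := by
    unfold bracket
    push_cast
    have := abs_sub (k : ℝ) (j : ℝ)
    linarith
  have h2 : (bracket k)⁻¹ * (bracket (k - j) * (bracket j)⁻¹)
      ≤ (bracket j)⁻¹ + (bracket k)⁻¹ := by
    have : (bracket j)⁻¹ + (bracket k)⁻¹
        = (bracket k)⁻¹ * ((bracket j + bracket k) * (bracket j)⁻¹) := by
      field_simp
      ring
    rw [this]
    gcongr
  calc (bracket k ^ (2 * m))⁻¹ * (bracket (k - j) ^ (2 * m) * (bracket j ^ (2 * m))⁻¹)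
      = ((bracket k)⁻¹ * (bracket (k - j) * (bracket j)⁻¹)) ^ (2 * m) := by
        rw [mul_pow, mul_pow, inv_pow, inv_pow]
    _ ≤ ((bracket j)⁻¹ + (bracket k)⁻¹) ^ (2 * m) := by gcongr
    _ ≤ 2 ^ (2 * m - 1) * ((bracket j)⁻¹ ^ (2 * m) + (bracket k)⁻¹ ^ (2 * m)) :=
        add_pow_le (by positivity) (by positivity) _
    _ = _ := by rw [inv_pow, inv_pow]

lemma summable_bracket_inv {m : ℕ} (hm : 1 ≤ m) :
    Summable fun k : ℤ => (bracket k ^ (2 * m))⁻¹ := by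
  have h : Summable fun k : ℤ => 1 / |(k : ℝ)| ^ (2 : ℝ) :=
    Real.summable_abs_int_rpow (b := 2) one_lt_two |>.congr fun k => by
      rw [Real.rpow_neg (abs_nonneg _), one_div]
  refine Summable.of_norm_bounded_eventually h ?_
  have : ∀ᶠ k : ℤ in cofinite, k ≠ 0 := (Set.finite_singleton (0 : ℤ)).compl_mem_cofinite
  filter_upwards [this] with k hk
  have hk' : 0 < |(k : ℝ)| := abs_pos.mpr (by exact_mod_cast hk)
  have hb := bracket_pos k
  rw [Real.norm_of_nonneg (by positivity), one_div]
  apply inv_anti₀ (by positivity)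
  calc |(k : ℝ)| ^ (2 : ℝ) = |(k : ℝ)| ^ 2 := by norm_cast
    _ ≤ bracket k ^ 2 := by
      apply pow_le_pow_left₀ hk'.le
      unfold bracket; linarith
    _ ≤ bracket k ^ (2 * m) := pow_le_pow_right₀ (one_le_bracket k) (by omega)

/-- The series defining the product `V · u` converge absolutely. -/
lemma summable_fourierMul {m : ℕ} {v u : ℤ → ℂ} (hv : v ∈ sobolevSeq (-(m : ℝ)))
    (hu : u ∈ sobolevSeq (m : ℝ)) (k : ℤ) : Summable fun j : ℤ => v (k - j) * u j := by
  rw [mem_sobolevSeq_neg] at hv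
  rw [mem_sobolevSeq_nat] at hu
  have hv' : Summable fun j : ℤ => (bracket (k - j) ^ (2 * m))⁻¹ * ‖v (k - j)‖ ^ 2 :=
    (Equiv.subLeft k).summable_iff.mpr hv
  refine Summable.of_norm_bounded (hv'.add (hu.mul_left (bracket k ^ (2 * m)))) fun j => ?_
  have hb := bracket_pos (k - j)
  have hj := bracket_pos j
  have hk := bracket_pos k
  have h1 : bracket (k - j) ≤ bracket k * bracket j := by
    unfold bracket
    push_cast
    nlinarith [abs_sub (k : ℝ) (j : ℝ), abs_nonneg (k : ℝ), abs_nonneg (j : ℝ),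
      mul_nonneg (abs_nonneg (k : ℝ)) (abs_nonneg (j : ℝ))]
  have h2 : bracket (k - j) ^ (2 * m) ≤ bracket k ^ (2 * m) * bracket j ^ (2 * m) := by
    rw [← mul_pow]; gcongr
  have h3 : bracket (k - j) ^ (2 * m) * ‖u j‖ ^ 2
      ≤ bracket k ^ (2 * m) * (bracket j ^ (2 * m) * ‖u j‖ ^ 2) := by
    rw [← mul_assoc]; gcongr
  rw [norm_mul]
  have hP : bracket (k - j) ^ (2 * m) = (bracket (k - j) ^ m) ^ 2 := by rw [← pow_mul, mul_comm]
  have h4 : ‖v (k - j)‖ * ‖u j‖ ≤ (bracket (k - j) ^ (2 * m))⁻¹ * ‖v (k - j)‖ ^ 2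
      + bracket (k - j) ^ (2 * m) * ‖u j‖ ^ 2 := by
    rw [hP]
    set p := bracket (k - j) ^ m with hp
    have hp0 : 0 < p := by positivity
    have e1 : ‖v (k - j)‖ * ‖u j‖ = (p⁻¹ * ‖v (k - j)‖) * (p * ‖u j‖) := by
      field_simp
    have e2 : (p ^ 2)⁻¹ * ‖v (k - j)‖ ^ 2 + p ^ 2 * ‖u j‖ ^ 2
        = (p⁻¹ * ‖v (k - j)‖) ^ 2 + (p * ‖u j‖) ^ 2 := by
      rw [mul_pow, mul_pow, inv_pow]
    rw [e1, e2]
    nlinarith [sq_nonneg (p⁻¹ * ‖v (k - j)‖ - p * ‖u j‖),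
      sq_nonneg (p⁻¹ * ‖v (k - j)‖), sq_nonneg (p * ‖u j‖)]
  linarith

/-- Multiplication by `V ∈ H_+^{-m}` maps order `m` to order `-m`. -/
lemma fourierMul_mem_sobolevSeq {m : ℕ} (hm : 1 ≤ m) {v u : ℤ → ℂ}
    (hv : v ∈ sobolevSeq (-(m : ℝ))) (hu : u ∈ sobolevSeq (m : ℝ)) :
    fourierMul v u ∈ sobolevSeq (-(m : ℝ)) := by
  have hconv := summable_fourierMul hv hu
  rw [mem_sobolevSeq_neg] at hv ⊢
  rw [mem_sobolevSeq_nat] at hu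
  set x : ℤ → ℝ := fun k => (bracket k ^ (2 * m))⁻¹ * ‖v k‖ ^ 2 with hx
  have hx0 : ∀ k, 0 ≤ x k := fun k => by have := bracket_pos k; positivity
  have hw := summable_bracket_inv hm
  have hw0 : ∀ k : ℤ, 0 ≤ (bracket k ^ (2 * m))⁻¹ := fun k => by
    have := bracket_pos k; positivity
  have hprod : Summable fun p : ℤ × ℤ => x p.1 * (bracket p.2 ^ (2 * m))⁻¹ :=
    hv.mul_of_nonneg hw hx0 hw0
  have hA : Summable fun p : ℤ × ℤ => x (p.1 - p.2) * (bracket p.2 ^ (2 * m))⁻¹ := by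
    let e : ℤ × ℤ ≃ ℤ × ℤ :=
      { toFun := fun p => (p.1 - p.2, p.2)
        invFun := fun p => (p.1 + p.2, p.2)
        left_inv := fun p => by simp
        right_inv := fun p => by simp }
    exact e.summable_iff.mpr hprod
  have hB : Summable fun p : ℤ × ℤ => x (p.1 - p.2) * (bracket p.1 ^ (2 * m))⁻¹ := by
    let e : ℤ × ℤ ≃ ℤ × ℤ :=
      { toFun := fun p => (p.1 - p.2, p.1)
        invFun := fun p => (p.2, p.2 - p.1)
        left_inv := fun p => by simp
        right_inv := fun p => by simp }
    exact e.summable_iff.mpr hprod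
  have hS := (hA.add hB).mul_left (2 ^ (2 * m - 1) : ℝ)
  have hS1 := hS.prod
  have hS2 := hS.prod_factor
  set U : ℝ := ∑' j : ℤ, bracket j ^ (2 * m) * ‖u j‖ ^ 2 with hU
  refine Summable.of_nonneg_of_le
    (fun k => mul_nonneg (hw0 k) (sq_nonneg _)) (fun k => ?_) (hS1.mul_right U)
  have hk := bracket_pos k
  -- Cauchy-Schwarz in `j`
  let f : ℤ → ℝ := fun j => ‖v (k - j)‖ * (bracket j ^ m)⁻¹
  let g : ℤ → ℝ := fun j => bracket j ^ m * ‖u j‖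
  have hf0 : ∀ j, 0 ≤ f j := fun j => by have := bracket_pos j; positivity
  have hg0 : ∀ j, 0 ≤ g j := fun j => by have := bracket_pos j; positivity
  have hf2 : ∀ j, (bracket k ^ (2 * m))⁻¹ * f j ^ 2
      ≤ 2 ^ (2 * m - 1) * (x (k - j) * (bracket j ^ (2 * m))⁻¹
        + x (k - j) * (bracket k ^ (2 * m))⁻¹) := by
    intro j
    have hb := bracket_pos (k - j)
    have hj := bracket_pos j
    have e : (bracket k ^ (2 * m))⁻¹ * f j ^ 2 = x (k - j) * ((bracket k ^ (2 * m))⁻¹ *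
        (bracket (k - j) ^ (2 * m) * (bracket j ^ (2 * m))⁻¹)) := by
      simp only [f, hx]
      rw [mul_pow, inv_pow, ← pow_mul, mul_comm m 2]
      field_simp
    rw [e]
    calc _ ≤ x (k - j) * (2 ^ (2 * m - 1) *
          ((bracket j ^ (2 * m))⁻¹ + (bracket k ^ (2 * m))⁻¹)) :=
          mul_le_mul_of_nonneg_left (bracket_weight m k j) (hx0 _)
      _ = _ := by ring
  have hg2 : ∀ j, g j ^ 2 = bracket j ^ (2 * m) * ‖u j‖ ^ 2 := by
    intro j
    simp only [g]
    rw [mul_pow, ← pow_mul, mul_comm m 2]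
  have hfs : Summable fun j => (bracket k ^ (2 * m))⁻¹ * f j ^ 2 :=
    Summable.of_nonneg_of_le (fun j => mul_nonneg (hw0 k) (sq_nonneg _)) hf2 (hS2 k)
  have hfs' : Summable fun j => f j ^ 2 := by
    have := hfs.mul_left (bracket k ^ (2 * m))
    refine this.congr fun j => ?_
    field_simp
  have hgs : Summable fun j => g j ^ 2 := by simpa only [hg2] using hu
  have hCS := Real.summable_and_inner_le_Lp_mul_Lq_tsum_of_nonneg
    (Real.HolderConjugate.two_two) hf0 hg0 (by simpa using hfs') (by simpa using hgs)
  obtain ⟨hfg, hle⟩ := hCS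
  have hfg_eq : ∀ j, f j * g j = ‖v (k - j) * u j‖ := by
    intro j
    have hj := bracket_pos j
    simp only [f, g, norm_mul]
    field_simp
  have hn : ‖fourierMul v u k‖ ≤ ∑' j, f j * g j := by
    simp only [hfg_eq]
    exact norm_tsum_le_tsum_norm (by simpa only [hfg_eq] using hfg)
  have hF0 : 0 ≤ ∑' j, f j ^ 2 := tsum_nonneg fun j => sq_nonneg _
  have hG0 : 0 ≤ ∑' j, g j ^ 2 := tsum_nonneg fun j => sq_nonneg _
  have hsq : ‖fourierMul v u k‖ ^ 2 ≤ (∑' j, f j ^ 2) * ∑' j, g j ^ 2 := by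
    have h1 : ‖fourierMul v u k‖
        ≤ Real.sqrt (∑' j, f j ^ 2) * Real.sqrt (∑' j, g j ^ 2) := by
      rw [Real.sqrt_eq_rpow, Real.sqrt_eq_rpow]
      exact hn.trans (by simpa using hle)
    calc ‖fourierMul v u k‖ ^ 2
        ≤ (Real.sqrt (∑' j, f j ^ 2) * Real.sqrt (∑' j, g j ^ 2)) ^ 2 := by gcongr
      _ = _ := by rw [mul_pow, Real.sq_sqrt hF0, Real.sq_sqrt hG0]
  have hGU : ∑' j, g j ^ 2 = U := by simp only [hg2, hU]
  have hU0 : 0 ≤ U := hGU ▸ hG0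
  calc (bracket k ^ (2 * m))⁻¹ * ‖fourierMul v u k‖ ^ 2
      ≤ (bracket k ^ (2 * m))⁻¹ * ((∑' j, f j ^ 2) * U) := by
        rw [← hGU]; exact mul_le_mul_of_nonneg_left hsq (hw0 k)
    _ = (∑' j, (bracket k ^ (2 * m))⁻¹ * f j ^ 2) * U := by rw [tsum_mul_left]; ring
    _ ≤ _ := mul_le_mul_of_nonneg_right (hfs.tsum_le_tsum hf2 (hS2 k)) hU0

lemma HMinus_diff_mem {m : ℕ} {u : ℤ → ℂ} (hu : u ∈ HMinus (m : ℝ)) :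
    (fun k : ℤ => (((k : ℝ) * Real.pi : ℝ) : ℂ) ^ (2 * m) * u k) ∈ HMinus (-(m : ℝ)) := by
  obtain ⟨hs, hp⟩ := hu
  refine ⟨?_, fun k hk => by simp [hp k hk]⟩
  replace hs := mem_sobolevSeq_nat.mp hs
  refine mem_sobolevSeq_neg.mpr ?_
  refine Summable.of_nonneg_of_le (fun k => by have := bracket_pos k; positivity)
    (fun k => ?_) (hs.mul_left ((Real.pi ^ (2 * m)) ^ 2))
  have hk := bracket_pos k
  have h1 : |(k : ℝ)| ^ (2 * m) ≤ bracket k ^ (2 * m) := by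
    gcongr; unfold bracket; linarith
  rw [norm_mul, norm_pow, Complex.norm_real, Real.norm_eq_abs, abs_mul,
    abs_of_pos Real.pi_pos, mul_pow |(k : ℝ)|]
  have h2 : (bracket k ^ (2 * m))⁻¹ * (|(k : ℝ)| ^ (2 * m)) ^ 2 ≤ bracket k ^ (2 * m) := by
    rw [inv_mul_le_iff₀ (by positivity), ← sq]
    gcongr
  calc _ = ((bracket k ^ (2 * m))⁻¹ * (|(k : ℝ)| ^ (2 * m)) ^ 2) *
        ((Real.pi ^ (2 * m)) ^ 2 * ‖u k‖ ^ 2) := by ring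
    _ ≤ bracket k ^ (2 * m) * ((Real.pi ^ (2 * m)) ^ 2 * ‖u k‖ ^ 2) := by gcongr
    _ = _ := by ring

lemma HMinus_fourierMul_mem {m : ℕ} (hm : 1 ≤ m) {v u : ℤ → ℂ}
    (hv : v ∈ HPlus (-(m : ℝ))) (hu : u ∈ HMinus (m : ℝ)) :
    fourierMul v u ∈ HMinus (-(m : ℝ)) := by
  refine ⟨fourierMul_mem_sobolevSeq hm hv.1 hu.1, fun k hk => ?_⟩
  have : ∀ j : ℤ, v (k - j) * u j = 0 := by
    intro j
    rcases Int.even_or_odd j with hj | hj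
    · rw [hu.2 j hj, mul_zero]
    · rw [hv.2 (k - j) (hk.sub_odd hj), zero_mul]
  simp [fourierMul, this]

/-- The operator `L_m(V) = D^{2m} + V`, `D = -i d/dx`, in the space `H_-^{-m}[0,1]` with domain
`H_-^m[0,1]`. In Fourier coefficients `D^{2m}` is multiplication by `(kπ)^{2m}`. -/
def opL (m : ℕ) (hm : 1 ≤ m) (V : HPlus (-(m : ℝ))) :
    HMinus (-(m : ℝ)) →ₗ.[ℂ] HMinus (-(m : ℝ)) where
  domain := (HMinus (m : ℝ)).comap (HMinus (-(m : ℝ))).subtype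
  toFun :=
    { toFun := fun u =>
        ⟨fun k => (((k : ℝ) * Real.pi : ℝ) : ℂ) ^ (2 * m) * u.1.1 k + fourierMul V.1 u.1.1 k,
          add_mem (HMinus_diff_mem u.2) (HMinus_fourierMul_mem hm V.2 u.2)⟩
      map_add' := by
        rintro ⟨⟨u, hu'⟩, hu⟩ ⟨⟨w, hw'⟩, hw⟩
        apply Subtype.ext
        funext k
        have h1 := summable_fourierMul V.2.1 (show u ∈ sobolevSeq (m : ℝ) from hu.1) k
        have h2 := summable_fourierMul V.2.1 (show w ∈ sobolevSeq (m : ℝ) from hw.1) k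
        have h3 : fourierMul V.1 (u + w) k = fourierMul V.1 u k + fourierMul V.1 w k := by
          unfold fourierMul
          rw [← h1.tsum_add h2]
          simp only [Pi.add_apply, mul_add]
        change _ * (u k + w k) + fourierMul V.1 (u + w) k
          = (_ * u k + fourierMul V.1 u k) + (_ * w k + fourierMul V.1 w k)
        rw [h3]
        ring
      map_smul' := by
        rintro c ⟨⟨u, hu'⟩, hu⟩
        apply Subtype.ext
        funext k
        have h3 : fourierMul V.1 (c • u) k = c * fourierMul V.1 u k := by
          unfold fourierMul
          rw [← tsum_mul_left]
          refine tsum_congr fun j => ?_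
          simp only [Pi.smul_apply, smul_eq_mul]
          ring
        change _ * (c * u k) + fourierMul V.1 (c • u) k = c * (_ * u k + fourierMul V.1 u k)
        rw [h3]
        ring }

/-- `T - z` on the domain of `T`. -/
def shifted {E : Type*} [AddCommGroup E] [Module ℂ E] (T : E →ₗ.[ℂ] E) (z : ℂ) :
    T.domain →ₗ[ℂ] E :=
  T.toFun - z • T.domain.subtype

/-- The kernel of `(T - z)^r` on its natural domain. -/
def kerPow {E : Type*} [AddCommGroup E] [Module ℂ E] (T : E →ₗ.[ℂ] E) (z : ℂ) :
    ℕ → Submodule ℂ E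
  | 0 => ⊥
  | r + 1 => ((kerPow T z r).comap (shifted T z)).map T.domain.subtype

/-- The root subspace of `T` at `z`; its dimension is the algebraic multiplicity of `z`. -/
def rootSubspace {E : Type*} [AddCommGroup E] [Module ℂ E] (T : E →ₗ.[ℂ] E) (z : ℂ) :
    Submodule ℂ E :=
  ⨆ r : ℕ, kerPow T z r

/-- The resolvent set of an operator in `H_-^s[0,1]`: `T - z` is a bijection of the domain onto
the space, with a bounded inverse. -/
def resolventSetOf {s : ℝ} (T : HMinus s →ₗ.[ℂ] HMinus s) : Set ℂ :=
  {z | Function.Bijective (shifted T z) ∧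
    ∃ K : ℝ, ∀ u : T.domain,
      sobolevNorm s (u : HMinus s) ≤ K * sobolevNorm s (shifted T z u)}

/-- The spectrum. -/
def spectrumOf {s : ℝ} (T : HMinus s →ₗ.[ℂ] HMinus s) : Set ℂ := (resolventSetOf T)ᶜ

/-- `lam 1, lam 2, …` (the value `lam 0` plays no role) lists the whole spectrum of `T`, which
consists of eigenvalues of finite algebraic multiplicity, each repeated according to its algebraic
multiplicity, in lexicographic order, and the real parts tend to `+∞`. -/
structure IsEigenvalueSequence {s : ℝ} (T : HMinus s →ₗ.[ℂ] HMinus s) (lam : ℕ → ℂ) : Prop where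
  spectrum_eq : spectrumOf T = lam '' {k | 1 ≤ k}
  finite : ∀ z, FiniteDimensional ℂ (rootSubspace T z)
  multiplicity : ∀ z, Module.finrank ℂ (rootSubspace T z) = {k | 1 ≤ k ∧ lam k = z}.ncard
  lex : ∀ k, 1 ≤ k → (lam k).re < (lam (k + 1)).re ∨
    ((lam k).re = (lam (k + 1)).re ∧ (lam k).im ≤ (lam (k + 1)).im)
  tendsto_re : Tendsto (fun k => (lam k).re) atTop atTop

/-- The bounded cone
`{λ : |Im λ| - M ≤ Re λ ≤ ((2n₀)^{2m} - (2n₀)^m) π^{2m}}`. -/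
def boundedCone (m : ℕ) (M : ℝ) (n₀ : ℕ) : Set ℂ :=
  {z | |z.im| - M ≤ z.re ∧
    z.re ≤ ((2 * (n₀ : ℝ)) ^ (2 * m) - (2 * (n₀ : ℝ)) ^ m) * Real.pi ^ (2 * m)}

/-- The spectrum of `L_m(V)` is a sequence `λ₁, λ₂, …` of eigenvalues, exactly `2 n₀` of which
(with multiplicity) lie in the bounded cone, and for all `n > n₀` both `λ_{2n-1}` and `λ_{2n}` lie
in the open disc of radius `r n` around `(2n-1)^{2m} π^{2m}`. -/
def Localized (m : ℕ) (hm : 1 ≤ m) (V : HPlus (-(m : ℝ))) (M : ℝ) (n₀ : ℕ) (r : ℕ → ℝ) : Prop :=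
  ∃ lam : ℕ → ℂ, IsEigenvalueSequence (opL m hm V) lam ∧
    {k | 1 ≤ k ∧ lam k ∈ boundedCone m M n₀}.ncard = 2 * n₀ ∧
    ∀ n : ℕ, n₀ < n →
      ‖lam (2 * n - 1) - (((2 * (n : ℝ) - 1) ^ (2 * m) * Real.pi ^ (2 * m) : ℝ) : ℂ)‖ < r n ∧
      ‖lam (2 * n) - (((2 * (n : ℝ) - 1) ^ (2 * m) * Real.pi ^ (2 * m) : ℝ) : ℂ)‖ < r n

end

/-! In Fourier coefficients `L_m(V)` is the diagonal operator with entries (kπ)^{2m}, k odd, each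
value taken at k and -k, plus the matrix V(k-j). One quantity controls everything: for positive
weights g, the squared Hilbert–Schmidt norm `hsSum` of the matrix V(k-j)/√(g_k g_j). With g_k =
|z-(kπ)^{2m}|, a value below 1 prevents z from being an eigenvalue (`eq_zero_of_shifted_eq_zero`).
At the real point z = c_n = `cutPoint m n`, which separates the frequencies |k| ≤ 2n-1 from the
rest, a value of at most 1/64 splits the operator along the line Re z = c_n.

Splitting. Instead of Riesz projections, an invariant subspace S of dimension 2n is built such that
the quotient has no spectrum in Re z ≤ c_n and the restriction no eigenvalue in Re z ≥ c_n
(`SpectralCut`). With δ_k = |c_n-(kπ)^{2m}| one has L_m(V)-c_n = δ^{1/2}(J+K)δ^{1/2}, where J is -1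
on the 2n low frequencies and +1 on the others, and K is small. S comes from a graph over the low
coordinates. Its invariance is a Riccati equation whose linear part is inverted by multipliers
bounded by 1, so a contraction solves it (`Ell.exists_riccati`, `Ell.exists_pencilCut`).

Counting. The eigenvalues on S are roots of a characteristic polynomial, with the algebraic
multiplicities of L_m(V). The multisets for different n ≥ n₀ agree on half planes and have 2n
elements, so their sorted lists extend each other: the first 2n eigenvalues lie left of c_n and all
later ones right of it. Thus λ_{2n-1} and λ_{2n} lie in the strip between c_{n-1} and c_n, and
excluding eigenvalues of the strip outside the disc localizes them (`localized_of_spectralCut`).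

Estimates. Summed along the diagonals l = k-j, `hsSum` is at most B‖V‖_s² as soon as Σ_k 1/(g_k
g_{k-l}) ≤ B⟨l⟩^{2s} for all l. For z in the n-th strip at distance at least ρ from the double
eigenvalue of frequency N = 2n-1, one may take B = 9^m N^{-2s-2m}(N^{2m}/ρ² + 8N/ρ + 24)
(`GapBound.hsSum_le`). If s = -mα with α < 1, the prefactor decays and a radius ρ of order N^{mα}
balances the first term. If α = 1 there is no decay; then V is replaced by a finite Fourier series,
to which the bound with s = 0 applies, the two remainders are small in norm, and ρ = N^m. Outside
the cone, |z-(kπ)^{2m}| ≥ ((kπ)^{2m}+M)/2, so a large M works uniformly on balls (`exists_cone`). -/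

/-! ### Spectral cuts -/

/-- `S` is an invariant subspace of `T` which carries the part of `T` with spectrum in
`{Re z < c}`, the quotient operator having no spectrum in `{Re z ≤ c}`. -/
structure SpectralCut {E : Type*} [AddCommGroup E] [Module ℂ E] (T : E →ₗ.[ℂ] E)
    (S : Submodule ℂ E) (c : ℝ) : Prop where
  le_domain : S ≤ T.domain
  invariant : ∀ u : T.domain, (u : E) ∈ S → T u ∈ S
  injective_mod : ∀ z : ℂ, z.re ≤ c → ∀ u : T.domain, shifted T z u ∈ S → (u : E) ∈ S
  surjective_mod : ∀ z : ℂ, z.re ≤ c → ∀ f : E, ∃ u : T.domain, f - shifted T z u ∈ S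
  no_eigenvector : ∀ z : ℂ, c ≤ z.re → ∀ u : T.domain, (u : E) ∈ S → shifted T z u = 0 → u = 0

namespace SpectralCut

variable {E : Type*} [AddCommGroup E] [Module ℂ E] {T : E →ₗ.[ℂ] E} {S : Submodule ℂ E} {c : ℝ}

lemma shifted_apply (z : ℂ) (u : T.domain) : shifted T z u = T u - z • (u : E) := rfl

/-- The restriction of `T` to the invariant subspace. -/
noncomputable def restrict (h : SpectralCut T S c) : Module.End ℂ S :=
  LinearMap.codRestrict S (T.toFun ∘ₗ Submodule.inclusion h.le_domain)
    (fun u => h.invariant _ u.2)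

lemma coe_restrict (h : SpectralCut T S c) (u : S) :
    (h.restrict u : E) = T ⟨u, h.le_domain u.2⟩ := rfl

lemma coe_restrict_sub (h : SpectralCut T S c) (z : ℂ) (u : S) :
    (((h.restrict - z • (1 : Module.End ℂ S)) u : S) : E)
      = shifted T z ⟨u, h.le_domain u.2⟩ := rfl

/-- `injective_mod` pulls a Jordan chain into `S` one vector at a time: once (T-z)u is in `S`, so is
u. Chains of the unbounded operator are therefore chains of its finite-dimensional restriction. -/
lemma kerPow_eq (h : SpectralCut T S c) {z : ℂ} (hz : z.re ≤ c) (r : ℕ) :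
    kerPow T z r = (h.restrict.genEigenspace z r).map S.subtype := by
  induction r with
  | zero => simp [kerPow]
  | succ r ih =>
    ext u
    simp only [kerPow, ih, Submodule.mem_map, Submodule.mem_comap, Submodule.subtype_apply,
      Module.End.mem_genEigenspace_nat, LinearMap.mem_ker]
    constructor
    · rintro ⟨u, ⟨w, hw, hwu⟩, rfl⟩
      have huS : (u : E) ∈ S := h.injective_mod z hz u (hwu ▸ w.2)
      refine ⟨⟨u, huS⟩, ?_, rfl⟩
      have : (h.restrict - z • (1 : Module.End ℂ S)) ⟨u, huS⟩ = w :=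
        Subtype.ext (by rw [coe_restrict_sub, hwu])
      rw [pow_succ, Module.End.mul_apply, this, hw]
    · rintro ⟨w, hw, rfl⟩
      refine ⟨⟨w, h.le_domain w.2⟩, ⟨(h.restrict - z • (1 : Module.End ℂ S)) w, ?_, rfl⟩, rfl⟩
      rw [← Module.End.mul_apply, ← pow_succ, hw]

lemma rootSubspace_eq (h : SpectralCut T S c) {z : ℂ} (hz : z.re ≤ c) :
    rootSubspace T z = (h.restrict.maxGenEigenspace z).map S.subtype := by
  have : h.restrict.maxGenEigenspace z = ⨆ r : ℕ, h.restrict.genEigenspace z r := by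
    rw [Module.End.iSup_genEigenspace_eq]
  rw [this, Submodule.map_iSup]
  simp only [rootSubspace, h.kerPow_eq hz]

variable [FiniteDimensional ℂ S]

/-- The eigenvalues of the restriction, repeated according to algebraic multiplicity. -/
noncomputable def eigenvalues (h : SpectralCut T S c) : Multiset ℂ := h.restrict.charpoly.roots

lemma card_eigenvalues (h : SpectralCut T S c) :
    Multiset.card h.eigenvalues = Module.finrank ℂ S := by
  rw [eigenvalues, IsAlgClosed.card_roots_eq_natDegree, LinearMap.charpoly_natDegree]

lemma finiteDimensional_rootSubspace (h : SpectralCut T S c) {z : ℂ} (hz : z.re ≤ c) :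
    FiniteDimensional ℂ (rootSubspace T z) := by
  rw [h.rootSubspace_eq hz]; infer_instance

/-- The multiplicity of a root of the characteristic polynomial is the dimension of the maximal
generalized eigenspace. The right side does not involve `S`, which is what makes different cuts
compatible. -/
lemma count_eigenvalues [DecidableEq ℂ] (h : SpectralCut T S c) {z : ℂ} (hz : z.re ≤ c) :
    Multiset.count z h.eigenvalues = Module.finrank ℂ (rootSubspace T z) := by
  rw [h.rootSubspace_eq hz, LinearEquiv.finrank_eq
    (Submodule.equivMapOfInjective S.subtype S.injective_subtype _).symm,
    LinearMap.finrank_maxGenEigenspace_eq, eigenvalues, Polynomial.count_roots]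

lemma exists_of_mem_eigenvalues (h : SpectralCut T S c) {z : ℂ} (hz : z ∈ h.eigenvalues) :
    ∃ u : T.domain, (u : E) ∈ S ∧ u ≠ 0 ∧ shifted T z u = 0 := by
  have h1 : h.restrict.HasEigenvalue z := by
    rw [Module.End.hasEigenvalue_iff_isRoot_charpoly]
    exact Polynomial.isRoot_of_mem_roots hz
  obtain ⟨w, hw⟩ := h1.exists_hasEigenvector
  refine ⟨⟨w, h.le_domain w.2⟩, w.2, fun h0 => hw.2 (Subtype.ext congr(($h0 : E))), ?_⟩
  rw [shifted_apply, ← h.coe_restrict, hw.apply_eq_smul]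
  simp

lemma re_lt_of_mem_eigenvalues (h : SpectralCut T S c) {z : ℂ} (hz : z ∈ h.eigenvalues) :
    z.re < c := by
  obtain ⟨u, huS, hu0, hu⟩ := h.exists_of_mem_eigenvalues hz
  by_contra! hc
  exact hu0 (h.no_eigenvector z hc u huS hu)

lemma mem_eigenvalues (h : SpectralCut T S c) {z : ℂ} (hz : z.re ≤ c) {u : T.domain}
    (hu0 : u ≠ 0) (hu : shifted T z u = 0) : z ∈ h.eigenvalues := by
  have huS : (u : E) ∈ S := h.injective_mod z hz u (hu ▸ S.zero_mem)
  have h1 : h.restrict.HasEigenvector z ⟨u, huS⟩ := by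
    refine Module.End.hasEigenvector_iff.2 ⟨Module.End.mem_eigenspace_iff.2 ?_, ?_⟩
    · exact Subtype.ext (by rw [coe_restrict]; exact sub_eq_zero.1 hu)
    · exact fun h0 => hu0 (Subtype.ext congr(($h0 : E)))
  have h2 := Module.End.hasEigenvalue_of_hasEigenvector h1
  rw [Module.End.hasEigenvalue_iff_isRoot_charpoly] at h2
  exact (Polynomial.mem_roots (LinearMap.charpoly_monic _).ne_zero).2 h2

/-- T - z is block triangular with respect to `S` and its quotient block is bijective, so only the
finite-dimensional block decides; there injectivity already gives surjectivity. -/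
lemma bijective_iff (h : SpectralCut T S c) {z : ℂ} (hz : z.re ≤ c) :
    Function.Bijective (shifted T z) ↔ z ∉ h.eigenvalues := by
  constructor
  · intro hb hm
    obtain ⟨u, -, hu0, hu⟩ := h.exists_of_mem_eigenvalues hm
    exact hu0 (hb.1 (hu.trans (map_zero _).symm))
  · intro hm
    have hinj : Function.Injective (shifted T z) := by
      rw [← LinearMap.ker_eq_bot, LinearMap.ker_eq_bot']
      intro u hu
      by_contra hu0
      exact hm (h.mem_eigenvalues hz hu0 hu)
    refine ⟨hinj, fun f => ?_⟩
    obtain ⟨u, hu⟩ := h.surjective_mod z hz f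
    have hi : Function.Injective (h.restrict - z • (1 : Module.End ℂ S)) := by
      intro v w hvw
      have := congrArg (Subtype.val) hvw
      rw [coe_restrict_sub, coe_restrict_sub] at this
      exact Subtype.ext congr(($(hinj this) : E))
    obtain ⟨w, hw⟩ := LinearMap.surjective_of_injective hi ⟨_, hu⟩
    refine ⟨u + ⟨w, h.le_domain w.2⟩, ?_⟩
    have := congrArg Subtype.val hw
    rw [coe_restrict_sub] at this
    rw [map_add, this]
    simp

end SpectralCut

/-! ### Lexicographic enumeration -/

/-- The lexicographic order of the complex plane. -/
def LexLE (z w : ℂ) : Prop := z.re < w.re ∨ (z.re = w.re ∧ z.im ≤ w.im)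

instance : IsTrans ℂ LexLE := ⟨by
  rintro a b c (h | ⟨h, h'⟩) (k | ⟨k, k'⟩)
  · exact Or.inl (h.trans k)
  · exact Or.inl (k ▸ h)
  · exact Or.inl (h ▸ k)
  · exact Or.inr ⟨h.trans k, h'.trans k'⟩⟩

instance : Std.Antisymm LexLE := ⟨by
  rintro a b (h | ⟨h, h'⟩) (k | ⟨k, k'⟩)
  · exact absurd h k.asymm
  · exact absurd k h.ne'
  · exact absurd h k.ne'
  · exact Complex.ext h (le_antisymm h' k')⟩

instance : Std.Total LexLE := ⟨by
  intro a b
  rcases lt_trichotomy a.re b.re with h | h | h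
  · exact Or.inl (Or.inl h)
  · rcases le_total a.im b.im with k | k
    · exact Or.inl (Or.inr ⟨h, k⟩)
    · exact Or.inr (Or.inr ⟨h.symm, k⟩)
  · exact Or.inr (Or.inl h)⟩

open scoped Classical in
lemma sort_add_of_lexLE {s t : Multiset ℂ} (h : ∀ z ∈ s, ∀ w ∈ t, LexLE z w) :
    (s + t).sort LexLE = s.sort LexLE ++ t.sort LexLE := by
  refine List.Perm.eq_of_pairwise' (r := LexLE) (Multiset.pairwise_sort _ _) ?_ ?_
  · refine List.pairwise_append.2 ⟨Multiset.pairwise_sort _ _, Multiset.pairwise_sort _ _, ?_⟩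
    intro z hz w hw
    exact h z ((Multiset.mem_sort _).1 hz) w ((Multiset.mem_sort _).1 hw)
  · rw [← Multiset.coe_eq_coe, Multiset.sort_eq, ← Multiset.coe_add, Multiset.sort_eq,
      Multiset.sort_eq]

open scoped Classical in
/-- Multisets which agree on increasing half planes have a joint lexicographic enumeration. -/
lemma exists_lex_enumeration {c : ℕ → ℝ} (hc : Monotone c) {n₀ : ℕ} {M : ℕ → Multiset ℂ}
    (hcard : ∀ n, n₀ ≤ n → Multiset.card (M n) = 2 * n)
    (hlt : ∀ n, n₀ ≤ n → ∀ z ∈ M n, z.re < c n)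
    {mult : ℂ → ℕ} (hcount : ∀ n, n₀ ≤ n → ∀ z : ℂ, z.re ≤ c n → (M n).count z = mult z) :
    ∃ lam : ℕ → ℂ, (∀ n, n₀ ≤ n → M n = (Multiset.range (2 * n)).map fun i => lam (i + 1)) ∧
      (∀ k, 1 ≤ k → LexLE (lam k) (lam (k + 1))) ∧
      ∀ n, n₀ ≤ n → ∀ k, 2 * n < k → c n < (lam k).re := by
  let l : ℕ → List ℂ := fun n => (M n).sort LexLE
  have hlen : ∀ n, n₀ ≤ n → (l n).length = 2 * n := fun n hn => by
    rw [Multiset.length_sort, hcard n hn]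
  have hsplit : ∀ n n', n₀ ≤ n → n ≤ n' → ∃ t : List ℂ, l n' = l n ++ t ∧ ∀ z ∈ t, c n < z.re := by
    intro n n' hn hnn'
    -- The multisets are nested, and what `M n'` adds lies strictly to the right of `c n`; hence the
    -- sorted list of `M n` is an initial segment of that of `M n'`.
    have hle : M n ≤ M n' := Multiset.le_iff_count.2 fun z => by
      by_cases hz : z ∈ M n
      · have := hlt n hn z hz
        rw [hcount n hn z this.le, hcount n' (hn.trans hnn') z (this.le.trans (hc hnn'))]
      · rw [Multiset.count_eq_zero_of_notMem hz]; exact Nat.zero_le _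
    have hP : ∀ z ∈ M n' - M n, c n < z.re := by
      intro z hz
      by_contra! hzc
      have : (M n' - M n).count z = 0 := by
        rw [Multiset.count_sub, hcount n hn z hzc,
          hcount n' (hn.trans hnn') z (hzc.trans (hc hnn')), Nat.sub_self]
      exact (Multiset.count_eq_zero.1 this) hz
    refine ⟨(M n' - M n).sort LexLE, ?_, fun z hz => hP z ((Multiset.mem_sort _).1 hz)⟩
    rw [← sort_add_of_lexLE, add_tsub_cancel_of_le hle]
    exact fun z hz w hw => Or.inl ((hlt n hn z hz).trans (hP w hw))
  -- The list of index `max k n₀` has at least 2k entries, so for k ≥ 1 the default value 0 is never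
  -- read. Indices start at 1, list positions at 0.
  let lam : ℕ → ℂ := fun k => (l (max k n₀)).getD (k - 1) 0
  have hlam : ∀ n, n₀ ≤ n → ∀ i, i < 2 * n → lam (i + 1) = (l n).getD i 0 := by
    intro n hn i hi
    have key : ∀ a b, n₀ ≤ a → a ≤ b → i < 2 * a → (l b).getD i 0 = (l a).getD i 0 := by
      intro a b ha hab hia
      obtain ⟨t, ht, -⟩ := hsplit a b ha hab
      rw [ht, List.getD_append _ _ _ _ (by rw [hlen a ha]; exact hia)]
    change (l (max (i + 1) n₀)).getD (i + 1 - 1) 0 = _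
    rw [Nat.add_sub_cancel]
    rcases le_total n (max (i + 1) n₀) with h | h
    · exact key n _ hn h hi
    · refine (key _ n (le_max_right _ _) h ?_).symm
      have := le_max_left (i + 1) n₀
      omega
  refine ⟨lam, fun n hn => ?_, fun k hk => ?_, fun n hn k hk => ?_⟩
  · have : l n = (List.range (2 * n)).map fun i => lam (i + 1) := by
      refine List.ext_getElem (by simp [hlen n hn]) fun i h1 h2 => ?_
      rw [List.getElem_map, List.getElem_range, hlam n hn i (by rwa [hlen n hn] at h1),
        List.getD_eq_getElem _ _ h1]
    calc M n = (l n : Multiset ℂ) := (Multiset.sort_eq _ _).symm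
      _ = _ := by rw [this]; rfl
  · obtain ⟨i, rfl⟩ : ∃ i, k = i + 1 := ⟨k - 1, by omega⟩
    have hn : n₀ ≤ max (i + 2) n₀ := le_max_right _ _
    have hi : i + 2 ≤ max (i + 2) n₀ := le_max_left _ _
    have hl := hlen _ hn
    rw [hlam _ hn i (by omega), hlam _ hn (i + 1) (by omega),
      List.getD_eq_getElem _ _ (by omega), List.getD_eq_getElem _ _ (by omega)]
    exact List.pairwise_iff_getElem.1 (Multiset.pairwise_sort _ _) _ _ _ _ (Nat.lt_succ_self i)
  · obtain ⟨i, rfl⟩ : ∃ i, k = i + 1 := ⟨k - 1, by omega⟩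
    have hn' : n₀ ≤ max (i + 1) n := hn.trans (le_max_right _ _)
    have hi : i + 1 ≤ max (i + 1) n := le_max_left _ _
    obtain ⟨t, ht, htc⟩ := hsplit n _ hn (le_max_right (i + 1) n)
    have hl := hlen _ hn'
    have hln := hlen _ hn
    have hlt : (l n).length + t.length = 2 * max (i + 1) n := by
      rw [← hl, ht, List.length_append]
    rw [hlam _ hn' i (by omega), ht, List.getD_append_right _ _ _ _ (by omega),
      List.getD_eq_getElem _ _ (by omega)]
    exact htc _ (List.getElem_mem _)

/-- The data of `exists_lex_enumeration` determine multiplicities. -/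
lemma ncard_eq_count [DecidableEq ℂ] {lam : ℕ → ℂ} {n : ℕ} {s : Multiset ℂ}
    (hs : s = (Multiset.range (2 * n)).map fun i => lam (i + 1)) {z : ℂ}
    (hz : ∀ k, 2 * n < k → lam k ≠ z) :
    {k | 1 ≤ k ∧ lam k = z}.ncard = s.count z := by
  have h1 : {k | 1 ≤ k ∧ lam k = z}
      = (((Finset.range (2 * n)).filter fun i => z = lam (i + 1)).image (· + 1) : Finset ℕ) := by
    ext k
    simp only [Set.mem_ofPred_eq, Finset.coe_image, Finset.coe_filter, Finset.mem_range,
      Set.mem_image]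
    constructor
    · rintro ⟨hk, rfl⟩
      refine ⟨k - 1, ⟨?_, ?_⟩, by omega⟩
      · by_contra hlt
        exact hz k (by omega) rfl
      · congr 1; omega
    · rintro ⟨i, ⟨-, rfl⟩, rfl⟩
      exact ⟨by omega, rfl⟩
  rw [h1, Set.ncard_coe_finset, Finset.card_image_of_injective _ (add_left_injective 1), hs,
    Multiset.count_map]
  rfl

/-! ### Localization from spectral cuts -/

/-- The right end of the bounded cone. -/
noncomputable def cutPoint (m n : ℕ) : ℝ :=
  ((2 * (n : ℝ)) ^ (2 * m) - (2 * (n : ℝ)) ^ m) * Real.pi ^ (2 * m)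

lemma cutPoint_eq (m n : ℕ) :
    cutPoint m n = (2 * (n : ℝ)) ^ m * ((2 * (n : ℝ)) ^ m - 1) * Real.pi ^ (2 * m) := by
  rw [cutPoint]; ring

lemma cutPoint_monotone {m : ℕ} (hm : 1 ≤ m) : Monotone (cutPoint m) := by
  refine monotone_nat_of_le_succ fun n => ?_
  rw [cutPoint_eq, cutPoint_eq]
  refine mul_le_mul_of_nonneg_right ?_ (by positivity)
  have h1 : (2 * (n : ℝ)) ^ m ≤ (2 * ((n + 1 : ℕ) : ℝ)) ^ m := by gcongr; simp
  have h2 : (1 : ℝ) ≤ (2 * ((n + 1 : ℕ) : ℝ)) ^ m := by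
    apply one_le_pow₀; push_cast; linarith [n.cast_nonneg (α := ℝ)]
  rcases Nat.eq_zero_or_pos n with rfl | hn
  · rw [Nat.cast_zero, mul_zero, zero_pow (by omega), zero_mul]
    exact mul_nonneg (by positivity) (by linarith)
  · have h3 : (1 : ℝ) ≤ (2 * (n : ℝ)) ^ m := by
      apply one_le_pow₀
      have : (1 : ℝ) ≤ n := by exact_mod_cast hn
      linarith
    nlinarith

lemma tendsto_cutPoint {m : ℕ} (hm : 1 ≤ m) : Tendsto (cutPoint m) atTop atTop := by
  refine tendsto_atTop_mono' atTop (f₁ := fun n : ℕ => (n : ℝ)) ?_ tendsto_natCast_atTop_atTop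
  filter_upwards [eventually_ge_atTop 1] with n hn
  have hn' : (1 : ℝ) ≤ n := by exact_mod_cast hn
  have h1 : 2 * (n : ℝ) ≤ (2 * (n : ℝ)) ^ m := le_self_pow₀ (by linarith) (by omega)
  have h2 : (1 : ℝ) ≤ Real.pi ^ (2 * m) := one_le_pow₀ (by linarith [Real.pi_gt_three])
  rw [cutPoint_eq]
  calc (n : ℝ) ≤ (2 * (n : ℝ)) ^ m * ((2 * (n : ℝ)) ^ m - 1) := by nlinarith
    _ ≤ _ := le_mul_of_one_le_right (mul_nonneg (by positivity) (by linarith)) h2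

/-- The cuts give existence, multiplicities and numbering of the eigenvalues. Their position is then
read off from eigenvectors alone: none outside the cone, and none in a strip outside its disc. -/
lemma localized_of_spectralCut {m : ℕ} {hm : 1 ≤ m} {V : HPlus (-(m : ℝ))} {M : ℝ} {n₀ : ℕ}
    {r : ℕ → ℝ}
    (hcut : ∀ n, n₀ ≤ n → ∃ S : Submodule ℂ (HMinus (-(m : ℝ))), FiniteDimensional ℂ S ∧
      Module.finrank ℂ S = 2 * n ∧ SpectralCut (opL m hm V) S (cutPoint m n))
    (hbdd : ∀ z, Function.Bijective (shifted (opL m hm V) z) →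
      ∃ K : ℝ, ∀ u : (opL m hm V).domain,
        sobolevNorm (-(m : ℝ)) (u : HMinus (-(m : ℝ)))
          ≤ K * sobolevNorm (-(m : ℝ)) (shifted (opL m hm V) z u))
    (hcone : ∀ (z : ℂ) (u : (opL m hm V).domain), u ≠ 0 → shifted (opL m hm V) z u = 0 →
      |z.im| - M ≤ z.re)
    (hdisc : ∀ n, n₀ < n → ∀ (z : ℂ) (u : (opL m hm V).domain), u ≠ 0 →
      shifted (opL m hm V) z u = 0 → cutPoint m (n - 1) ≤ z.re → z.re ≤ cutPoint m n →
      ‖z - (((2 * (n : ℝ) - 1) ^ (2 * m) * Real.pi ^ (2 * m) : ℝ) : ℂ)‖ < r n) :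
    Localized m hm V M n₀ r := by
  classical
  set T := opL m hm V with hT
  choose! S hfin hrank hS using hcut
  let ev : ℕ → Multiset ℂ := fun n =>
    if h : n₀ ≤ n then haveI := hfin n h; (hS n h).eigenvalues else 0
  have hev : ∀ n (h : n₀ ≤ n), ev n = (haveI := hfin n h; (hS n h).eigenvalues) :=
    fun n h => dif_pos h
  have hlt : ∀ n, n₀ ≤ n → ∀ z ∈ ev n, z.re < cutPoint m n := by
    intro n hn z hz
    have := hfin n hn
    rw [hev n hn] at hz
    exact (hS n hn).re_lt_of_mem_eigenvalues hz
  have hcount : ∀ n, n₀ ≤ n → ∀ z : ℂ, z.re ≤ cutPoint m n →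
      (ev n).count z = Module.finrank ℂ (rootSubspace T z) := by
    intro n hn z hz
    have := hfin n hn
    rw [hev n hn]
    exact (hS n hn).count_eigenvalues hz
  have hcof : ∀ x : ℝ, ∃ n, n₀ ≤ n ∧ x ≤ cutPoint m n := fun x =>
    ((eventually_ge_atTop n₀).and ((tendsto_cutPoint hm).eventually_ge_atTop x)).exists
  obtain ⟨lam, hlam, hlex, hgt⟩ := exists_lex_enumeration (cutPoint_monotone hm)
    (n₀ := n₀) (M := ev) (fun n hn => by
      have := hfin n hn
      rw [hev n hn, (hS n hn).card_eigenvalues, hrank n hn]) hlt hcount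
  have hmem : ∀ n, n₀ ≤ n → ∀ k, 1 ≤ k → k ≤ 2 * n → lam k ∈ ev n := by
    intro n hn k hk hkn
    rw [hlam n hn, Multiset.mem_map]
    exact ⟨k - 1, Multiset.mem_range.2 (by omega), by congr 1; omega⟩
  have heig : ∀ k, 1 ≤ k → ∃ u : T.domain, u ≠ 0 ∧ shifted T (lam k) u = 0 := by
    intro k hk
    have hn : n₀ ≤ max n₀ k := le_max_left _ _
    have h1 := hmem _ hn k hk ((le_max_right n₀ k).trans (by omega))
    have := hfin _ hn
    rw [hev _ hn] at h1
    obtain ⟨u, -, hu0, hu⟩ := (hS _ hn).exists_of_mem_eigenvalues h1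
    exact ⟨u, hu0, hu⟩
  refine ⟨lam, ⟨?_, fun z => ?_, fun z => ?_, hlex, ?_⟩, ?_, fun n hn => ?_⟩
  · ext z
    obtain ⟨n, hn, hz⟩ := hcof z.re
    have := hfin n hn
    -- By `hbdd` the bound on the inverse is automatic, so spectrum means failure of bijectivity.
    have h1 : z ∈ spectrumOf T ↔ z ∈ ev n := by
      rw [hev n hn, ← not_iff_not, ← (hS n hn).bijective_iff hz, spectrumOf, Set.notMem_compl_iff]
      exact ⟨fun h => h.1, fun h => ⟨h, hbdd z h⟩⟩
    rw [h1]
    constructor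
    · intro h
      rw [hlam n hn, Multiset.mem_map] at h
      obtain ⟨i, -, rfl⟩ := h
      exact ⟨i + 1, Nat.le_add_left 1 i, rfl⟩
    · rintro ⟨k, hk, rfl⟩
      refine hmem n hn k hk ?_
      by_contra! hlt'
      exact (hgt n hn k hlt').not_ge hz
  · obtain ⟨n, hn, hz⟩ := hcof z.re
    have := hfin n hn
    exact (hS n hn).finiteDimensional_rootSubspace hz
  · obtain ⟨n, hn, hz⟩ := hcof z.re
    rw [← hcount n hn z hz]
    refine (ncard_eq_count (hlam n hn) fun k hk h => ?_).symm
    exact (hgt n hn k hk).not_ge (h ▸ hz)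
  · rw [tendsto_atTop]
    intro x
    obtain ⟨n, hn, hx⟩ := hcof x
    filter_upwards [eventually_gt_atTop (2 * n)] with k hk
    exact hx.trans (hgt n hn k hk).le
  · have : {k | 1 ≤ k ∧ lam k ∈ boundedCone m M n₀} = (Finset.Icc 1 (2 * n₀) : Set ℕ) := by
      ext k
      simp only [Set.mem_ofPred_eq, Finset.coe_Icc, Set.mem_Icc]
      refine and_congr_right fun hk => ⟨fun h => ?_, fun h => ?_⟩
      · by_contra! hlt'
        exact (hgt n₀ le_rfl k hlt').not_ge h.2
      · obtain ⟨u, hu0, hu⟩ := heig k hk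
        exact ⟨hcone _ u hu0 hu, (hlt n₀ le_rfl _ (hmem n₀ le_rfl k hk h)).le⟩
    rw [this, Set.ncard_coe_finset, Nat.card_Icc, Nat.add_sub_cancel]
  -- Since n > n₀, both n-1 and n are admissible cuts; between them lie exactly the indices 2n-1 and
  -- 2n.
  · have key : ∀ k, 2 * (n - 1) < k → k ≤ 2 * n →
        ‖lam k - (((2 * (n : ℝ) - 1) ^ (2 * m) * Real.pi ^ (2 * m) : ℝ) : ℂ)‖ < r n := by
      intro k h1 h2
      obtain ⟨u, hu0, hu⟩ := heig k (by omega)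
      exact hdisc n hn _ u hu0 hu (hgt (n - 1) (by omega) k h1).le
        (hlt n hn.le _ (hmem n hn.le k (by omega) h2)).le
    exact ⟨key _ (by omega) (by omega), key _ (by omega) le_rfl⟩

/-! ### Square summable sequences -/

/-- Square summable complex families. -/
noncomputable abbrev Ell (ι : Type*) := lp (fun _ : ι => ℂ) 2

namespace Ell

variable {ι : Type*}

lemma memℓp_iff {f : ι → ℂ} : Memℓp f 2 ↔ Summable fun i => ‖f i‖ ^ 2 := by
  rw [memℓp_gen_iff (by norm_num)]
  simp

lemma norm_sq_eq (f : Ell ι) : ‖f‖ ^ 2 = ∑' i, ‖f i‖ ^ 2 := by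
  have := lp.norm_rpow_eq_tsum (p := 2) (by norm_num) f
  simpa using this

lemma summable_sq (f : Ell ι) : Summable fun i => ‖f i‖ ^ 2 := memℓp_iff.1 (lp.memℓp f)

lemma sum_sq_le (f : Ell ι) (s : Finset ι) : ∑ i ∈ s, ‖f i‖ ^ 2 ≤ ‖f‖ ^ 2 := by
  rw [norm_sq_eq]
  exact (summable_sq f).sum_le_tsum s fun _ _ => sq_nonneg _

lemma norm_le_of_forall_le {f g : Ell ι} (h : ∀ i, ‖f i‖ ≤ ‖g i‖) : ‖f‖ ≤ ‖g‖ := by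
  refine (sq_le_sq₀ (norm_nonneg _) (norm_nonneg _)).1 ?_
  rw [norm_sq_eq, norm_sq_eq]
  exact (summable_sq f).tsum_le_tsum (fun i => by gcongr; exact h i) (summable_sq g)

lemma ext_apply {f g : Ell ι} (h : ∀ i, f i = g i) : f = g := lp.ext (funext h)

@[simp] lemma add_apply (f g : Ell ι) (i : ι) : (f + g) i = f i + g i := rfl
@[simp] lemma sub_apply (f g : Ell ι) (i : ι) : (f - g) i = f i - g i := rfl
@[simp] lemma smul_apply (a : ℂ) (f : Ell ι) (i : ι) : (a • f) i = a * f i := rfl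
@[simp] lemma zero_apply (i : ι) : (0 : Ell ι) i = 0 := rfl
@[simp] lemma sum_apply {α : Type*} (s : Finset α) (f : α → Ell ι) (i : ι) :
    (∑ a ∈ s, f a) i = ∑ a ∈ s, f a i := by
  rw [lp.coeFn_sum, Finset.sum_apply]

lemma summable_mul_sq {d : ι → ℂ} {C : ℝ} (h : ∀ i, ‖d i‖ ≤ C) (f : Ell ι) :
    Summable fun i => ‖d i * f i‖ ^ 2 := by
  refine Summable.of_nonneg_of_le (fun _ => sq_nonneg _) (fun i => ?_)
    ((summable_sq f).mul_left (C ^ 2))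
  rw [norm_mul, mul_pow]
  gcongr
  exact h i

/-- Multiplication by a bounded sequence, as a linear map. -/
noncomputable def diagAux (d : ι → ℂ) (C : ℝ) (h : ∀ i, ‖d i‖ ≤ C) : Ell ι →ₗ[ℂ] Ell ι where
  toFun f := ⟨fun i => d i * f i, memℓp_iff.2 (summable_mul_sq h f)⟩
  map_add' f g := ext_apply fun i => mul_add (d i) (f i) (g i)
  map_smul' a f := ext_apply fun i => mul_left_comm (d i) a (f i)

lemma norm_diagAux_le (d : ι → ℂ) (C : ℝ) (h : ∀ i, ‖d i‖ ≤ C) (f : Ell ι) :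
    ‖diagAux d C h f‖ ≤ |C| * ‖f‖ := by
  refine (sq_le_sq₀ (norm_nonneg _) (by positivity)).1 ?_
  rw [norm_sq_eq, mul_pow, norm_sq_eq, ← tsum_mul_left, sq_abs]
  refine (summable_mul_sq h f).tsum_le_tsum (fun i => ?_) ((summable_sq f).mul_left _)
  change ‖d i * f i‖ ^ 2 ≤ _
  rw [norm_mul, mul_pow]
  gcongr
  exact h i

/-- Multiplication by a bounded sequence. -/
noncomputable def diag (d : ι → ℂ) (C : ℝ) (h : ∀ i, ‖d i‖ ≤ C) : Ell ι →L[ℂ] Ell ι :=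
  (diagAux d C h).mkContinuous |C| (norm_diagAux_le d C h)

@[simp] lemma diag_apply (d : ι → ℂ) (C : ℝ) (h : ∀ i, ‖d i‖ ≤ C) (f : Ell ι) (i : ι) :
    diag d C h f i = d i * f i := rfl

lemma norm_diag_le (d : ι → ℂ) (C : ℝ) (h : ∀ i, ‖d i‖ ≤ C) : ‖diag d C h‖ ≤ |C| :=
  LinearMap.mkContinuous_norm_le _ (abs_nonneg _) _

lemma norm_diag_one_le (d : ι → ℂ) (h : ∀ i, ‖d i‖ ≤ 1) (f : Ell ι) : ‖diag d 1 h f‖ ≤ ‖f‖ := by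
  simpa using ContinuousLinearMap.le_of_opNorm_le _ (norm_diag_le d 1 h) f

open scoped Classical in
/-- The coordinate vectors. -/
noncomputable def basisVec (i : ι) : Ell ι := lp.single 2 i 1

@[simp] lemma basisVec_self (i : ι) : basisVec i i = 1 := by
  simp [basisVec]

lemma basisVec_ne {i j : ι} (h : j ≠ i) : basisVec i j = 0 := by
  simp [basisVec, h]

lemma norm_sum_smul_sq_le {α F : Type*} [Fintype α] [NormedAddCommGroup F] [NormedSpace ℂ F]
    (a : α → ℂ) (v : α → F) :
    ‖∑ p, a p • v p‖ ^ 2 ≤ (∑ p, ‖a p‖ ^ 2) * ∑ p, ‖v p‖ ^ 2 := by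
  calc ‖∑ p, a p • v p‖ ^ 2 ≤ (∑ p, ‖a p‖ * ‖v p‖) ^ 2 := by
        gcongr
        exact (norm_sum_le _ _).trans (Finset.sum_le_sum fun p _ => norm_smul_le _ _)
    _ ≤ _ := Finset.sum_mul_sq_le_sq_mul_sq _ _ _

end Ell

/-! ### A Riccati equation -/

namespace Ell

variable {ι : Type*} {L : Finset ι}

/-- Families of vectors indexed by a finite set, with the Hilbert–Schmidt norm. -/
noncomputable abbrev Columns (L : Finset ι) := PiLp 2 fun _ : L => Ell ι

lemma columns_norm_sq (F : Columns L) : ‖F‖ ^ 2 = ∑ j, ‖F j‖ ^ 2 := PiLp.norm_sq_eq_of_L2 _ F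

lemma columns_norm_le {F F' : Columns L} {C : ℝ} (hC : 0 ≤ C) (h : ∀ j, ‖F j‖ ≤ C * ‖F' j‖) :
    ‖F‖ ≤ C * ‖F'‖ := by
  refine (sq_le_sq₀ (norm_nonneg _) (by positivity)).1 ?_
  rw [columns_norm_sq, mul_pow, columns_norm_sq, Finset.mul_sum]
  refine Finset.sum_le_sum fun j _ => ?_
  rw [← mul_pow]
  gcongr
  exact h j

/-- Apply an operator to every column. -/
noncomputable def mapColumns (D : L → Ell ι →L[ℂ] Ell ι) (F : Columns L) : Columns L :=
  WithLp.toLp 2 fun j => D j (F j)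

@[simp] lemma mapColumns_apply (D : L → Ell ι →L[ℂ] Ell ι) (F : Columns L) (j : L) :
    mapColumns D F j = D j (F j) := rfl

lemma mapColumns_sub (D : L → Ell ι →L[ℂ] Ell ι) (F F' : Columns L) :
    mapColumns D (F - F') = mapColumns D F - mapColumns D F' := by
  exact PiLp.ext fun j => map_sub (D j) (F j) (F' j)

lemma norm_mapColumns_le {D : L → Ell ι →L[ℂ] Ell ι} {C : ℝ} (hC : 0 ≤ C)
    (h : ∀ j f, ‖D j f‖ ≤ C * ‖f‖) (F : Columns L) : ‖mapColumns D F‖ ≤ C * ‖F‖ :=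
  columns_norm_le hC fun j => h j (F j)

/-- The product `Z ∘ A` of column families: the coordinates in `L` of the columns of `A`
are the coefficients. -/
noncomputable def comb (A Z : Columns L) : Columns L :=
  WithLp.toLp 2 fun j => ∑ p : L, A j p • Z p

@[simp] lemma comb_apply (A Z : Columns L) (j : L) : comb A Z j = ∑ p : L, A j p • Z p := rfl

lemma norm_sum_coord_smul_sq_le (f : Ell ι) (Z : L → Ell ι) :
    ‖∑ p : L, f p • Z p‖ ^ 2 ≤ ‖f‖ ^ 2 * ∑ p, ‖Z p‖ ^ 2 := by
  refine (norm_sum_smul_sq_le _ _).trans ?_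
  gcongr
  rw [Finset.sum_coe_sort L fun i => ‖f i‖ ^ 2]
  exact sum_sq_le f L

/-- Submultiplicativity of the Hilbert–Schmidt norm: by Cauchy–Schwarz in the inner index, after
discarding the coordinates of `A` outside `L`. The bound does not depend on the size of `L`. -/
lemma norm_comb_le (A Z : Columns L) : ‖comb A Z‖ ≤ ‖A‖ * ‖Z‖ := by
  refine (sq_le_sq₀ (norm_nonneg _) (by positivity)).1 ?_
  rw [columns_norm_sq, mul_pow, columns_norm_sq A, columns_norm_sq Z, Finset.sum_mul]
  exact Finset.sum_le_sum fun j _ => norm_sum_coord_smul_sq_le (A j) fun p => Z p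

lemma comb_sub_left (A A' Z : Columns L) : comb (A - A') Z = comb A Z - comb A' Z := by
  refine PiLp.ext fun j => ?_
  rw [PiLp.sub_apply, comb_apply, comb_apply, comb_apply, ← Finset.sum_sub_distrib]
  exact Finset.sum_congr rfl fun p _ => sub_smul (A j p) (A' j p) (Z p)

lemma comb_sub_right (A Z Z' : Columns L) : comb A (Z - Z') = comb A Z - comb A Z' := by
  refine PiLp.ext fun j => ?_
  rw [PiLp.sub_apply, comb_apply, comb_apply, comb_apply, ← Finset.sum_sub_distrib]
  exact Finset.sum_congr rfl fun p _ => smul_sub (A j p) (Z p) (Z' p)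

/-- A contraction whose fixed point solves the Riccati equation. -/
lemma exists_riccati_fixedPoint {B Y Z : Columns L → Columns L} {b : Columns L}
    (hB : ∀ F F', B (F - F') = B F - B F') (hY : ∀ F F', Y (F - F') = Y F - Y F')
    (hZ : ∀ F F', Z (F - F') = Z F - Z F')
    (nB : ∀ F, ‖B F‖ ≤ 1 / 8 * ‖F‖) (nY : ∀ F, ‖Y F‖ ≤ 1 * ‖F‖) (nZ : ∀ F, ‖Z F‖ ≤ 1 * ‖F‖)
    (nb : ‖b‖ ≤ 1 / 8) :
    ∃ F : Columns L, ‖F‖ ≤ 1 ∧ F = b + B (Y F) - comb (b + B (Y F)) (Z F) := by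
  set Φ : Columns L → Columns L := fun F => b + B (Y F) - comb (b + B (Y F)) (Z F) with hΦ
  have ha : ∀ F, ‖F‖ ≤ 1 → ‖b + B (Y F)‖ ≤ 1 / 4 := by
    intro F hF
    have h1 := norm_add_le b (B (Y F))
    have h2 := nB (Y F)
    have h3 := nY F
    linarith
  have hd : ∀ F F', ‖F'‖ ≤ 1 → ‖F‖ ≤ 1 → ‖Φ F - Φ F'‖ ≤ 1 / 2 * ‖F - F'‖ := by
    intro F F' hF' hF
    -- The three differences contribute 1/8, 1/4 and 1/8, whence the contraction constant 1/2.
    have e : Φ F - Φ F' = B (Y (F - F')) - comb (b + B (Y F)) (Z (F - F'))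
        - comb (B (Y (F - F'))) (Z F') := by
      have e1 : B (Y (F - F')) = (b + B (Y F)) - (b + B (Y F')) := by rw [hY, hB]; abel
      rw [e1, hZ, comb_sub_right, comb_sub_left]
      simp only [hΦ]
      abel
    have n1 : ‖B (Y (F - F'))‖ ≤ 1 / 8 * ‖F - F'‖ := by
      have h2 := nB (Y (F - F'))
      have h3 := nY (F - F')
      linarith
    have n2 : ‖comb (b + B (Y F)) (Z (F - F'))‖ ≤ 1 / 4 * ‖F - F'‖ := by
      refine (norm_comb_le _ _).trans ?_
      have h3 := nZ (F - F')
      rw [one_mul] at h3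
      exact mul_le_mul (ha F hF) h3 (norm_nonneg _) (by norm_num)
    have n3 : ‖comb (B (Y (F - F'))) (Z F')‖ ≤ 1 / 8 * ‖F - F'‖ := by
      refine (norm_comb_le _ _).trans ?_
      have h3 : ‖Z F'‖ ≤ 1 := (nZ F').trans (by linarith)
      calc _ ≤ 1 / 8 * ‖F - F'‖ * 1 :=
            mul_le_mul n1 h3 (norm_nonneg _) (by positivity)
        _ = _ := mul_one _
    rw [e]
    have h1 := norm_sub_le (B (Y (F - F')) - comb (b + B (Y F)) (Z (F - F')))
      (comb (B (Y (F - F'))) (Z F'))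
    have h2 := norm_sub_le (B (Y (F - F'))) (comb (b + B (Y F)) (Z (F - F')))
    linarith
  have hmaps : Set.MapsTo Φ (Metric.closedBall 0 1) (Metric.closedBall 0 1) := by
    intro F hF
    rw [mem_closedBall_zero_iff] at hF ⊢
    have h1 := norm_sub_le (b + B (Y F)) (comb (b + B (Y F)) (Z F))
    have h2 := norm_comb_le (b + B (Y F)) (Z F)
    have h3 : ‖Z F‖ ≤ 1 := (nZ F).trans (by linarith)
    have h4 := ha F hF
    have h5 : ‖b + B (Y F)‖ * ‖Z F‖ ≤ 1 / 4 * 1 :=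
      mul_le_mul h4 h3 (norm_nonneg _) (by norm_num)
    simp only [hΦ]
    linarith
  have hcon : ContractingWith (1 / 2) (hmaps.restrict Φ _ _) := by
    refine ⟨by rw [← NNReal.coe_lt_coe]; norm_num, LipschitzWith.of_dist_le_mul ?_⟩
    rintro ⟨F, hF⟩ ⟨F', hF'⟩
    rw [mem_closedBall_zero_iff] at hF hF'
    rw [Subtype.dist_eq, Subtype.dist_eq, dist_eq_norm, dist_eq_norm]
    simpa using hd F F' hF' hF
  obtain ⟨F, hF, hfix, -⟩ := hcon.exists_fixedPoint' Metric.isClosed_closedBall.isComplete hmaps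
    (x := 0) (by simp) (edist_ne_top _ _)
  exact ⟨F, by simpa using hF, hfix.symm⟩

/-- The last identity is the off-`L` part of invariance for the span of the vectors e_j + y_j; z_j
is the off-`L` part of δ_j δ^{-1}(e_j + y_j). Put F = -(y+z). The relation z = δ_j δ_i^{-1} y then
forces y = -δ_i/(δ_i+δ_j) F and z = -δ_j/(δ_i+δ_j) F, both multipliers being at most 1 in modulus,
and the identity becomes a fixed point equation for F. -/
lemma exists_riccati (L : Finset ι) {δ : ι → ℝ} (hδ : ∀ i, 0 < δ i) {K : Ell ι →L[ℂ] Ell ι}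
    (hK : ‖K‖ ≤ 1 / 8) (hKL : ∑ j ∈ L, ‖K (basisVec j)‖ ^ 2 ≤ (1 / 8) ^ 2) :
    ∃ y z : L → Ell ι, (∀ j, ∀ i ∈ L, y j i = 0) ∧ (∀ j, ∀ i ∈ L, z j i = 0) ∧
      (∀ j i, z j i = δ j * ((δ i : ℂ)⁻¹ * y j i)) ∧
      ∑ j, ‖y j‖ ^ 2 ≤ 1 ∧ ∑ j, ‖z j‖ ^ 2 ≤ 1 ∧
      ∀ j, ∀ i ∉ L, y j i + K (basisVec (j : ι) + y j) i
        = -z j i + ∑ p : L, K (basisVec (j : ι) + y j) p * z p i := by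
  classical
  have hdy : ∀ (j : L) i, ‖(if i ∈ L then 0 else -((δ i / (δ i + δ j) : ℝ) : ℂ))‖ ≤ 1 := by
    intro j i
    have h1 := hδ i
    have h2 := hδ j
    split_ifs
    · simp
    · rw [norm_neg, Complex.norm_real, Real.norm_of_nonneg (by positivity), div_le_one (by positivity)]
      linarith
  have hdz : ∀ (j : L) i, ‖(if i ∈ L then 0 else -((δ j / (δ i + δ j) : ℝ) : ℂ))‖ ≤ 1 := by
    intro j i
    have h1 := hδ i
    have h2 := hδ j
    split_ifs
    · simp
    · rw [norm_neg, Complex.norm_real, Real.norm_of_nonneg (by positivity), div_le_one (by positivity)]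
      linarith
  let Yo : L → Ell ι →L[ℂ] Ell ι := fun j => diag _ 1 (hdy j)
  let Zo : L → Ell ι →L[ℂ] Ell ι := fun j => diag _ 1 (hdz j)
  let b : Columns L := WithLp.toLp 2 fun j => K (basisVec (j : ι))
  have nY : ∀ F, ‖mapColumns Yo F‖ ≤ 1 * ‖F‖ := norm_mapColumns_le zero_le_one fun j f => by
    rw [one_mul]; exact norm_diag_one_le _ (hdy j) f
  have nZ : ∀ F, ‖mapColumns Zo F‖ ≤ 1 * ‖F‖ := norm_mapColumns_le zero_le_one fun j f => by
    rw [one_mul]; exact norm_diag_one_le _ (hdz j) f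
  have nb : ‖b‖ ≤ 1 / 8 := by
    refine (sq_le_sq₀ (norm_nonneg _) (by norm_num)).1 ?_
    rw [columns_norm_sq]
    refine le_trans (le_of_eq ?_) hKL
    exact Finset.sum_coe_sort L fun i => ‖K (basisVec i)‖ ^ 2
  obtain ⟨F, hF1, hF⟩ := exists_riccati_fixedPoint (L := L) (B := mapColumns fun _ => K)
    (Y := mapColumns Yo) (Z := mapColumns Zo) (b := b) (mapColumns_sub _) (mapColumns_sub _)
    (mapColumns_sub _) (norm_mapColumns_le (by norm_num) fun j f =>
      K.le_of_opNorm_le hK f) nY nZ nb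
  have hFj : ∀ j : L, F j = K (basisVec (j : ι) + Yo j (F j))
      - ∑ p : L, K (basisVec (j : ι) + Yo j (F j)) p • Zo p (F p) := by
    intro j
    have h := congrArg (fun F : Columns L => F j) hF
    simp only [PiLp.sub_apply, PiLp.add_apply, comb_apply, mapColumns_apply] at h
    rw [map_add]
    exact h
  have bound : ∀ D : L → Ell ι →L[ℂ] Ell ι, ‖mapColumns D F‖ ≤ 1 * ‖F‖ →
      ∑ j, ‖D j (F j)‖ ^ 2 ≤ 1 := by
    intro D hD
    have h1 : ∑ j, ‖D j (F j)‖ ^ 2 = ‖mapColumns D F‖ ^ 2 := by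
      rw [columns_norm_sq]; rfl
    rw [h1]
    exact pow_le_one₀ (norm_nonneg _) (by linarith)
  refine ⟨fun j => Yo j (F j), fun j => Zo j (F j), fun j i hi => ?_, fun j i hi => ?_,
    fun j i => ?_, bound Yo (nY F), bound Zo (nZ F), fun j i hi => ?_⟩
  · simp [Yo, hi]
  · simp [Zo, hi]
  · have h1 : (δ i : ℂ) ≠ 0 := by exact_mod_cast (hδ i).ne'
    by_cases hi : i ∈ L
    · simp [Yo, Zo, hi]
    · simp only [Yo, Zo, diag_apply, hi, if_false]
      push_cast
      field_simp
  · have h := congrArg (fun f : Ell ι => f i) (hFj j)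
    simp only [sub_apply, sum_apply, smul_apply] at h
    -- The two multipliers add up to -1, which turns the fixed point equation into the Riccati
    -- equation.
    have hyz : Yo j (F j) i + Zo j (F j) i = -F j i := by
      have h1 := hδ i
      have h2 := hδ j
      have h3 : (δ i : ℂ) + δ j ≠ 0 := by exact_mod_cast (by positivity : δ i + δ j ≠ 0)
      simp only [Yo, Zo, diag_apply, hi, if_false]
      push_cast
      field_simp
      ring
    linear_combination hyz - h

end Ell

/-! ### Cutting a linear pencil -/

/-- The analogue of `SpectralCut` for a pencil `A - ζ G`. -/
structure PencilCut {H : Type*} [AddCommGroup H] [Module ℂ H] (A G : H →ₗ[ℂ] H)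
    (W : Submodule ℂ H) : Prop where
  invariant : ∀ w ∈ W, A w ∈ W.map G
  injective_mod : ∀ ζ : ℂ, ζ.re ≤ 0 → ∀ w, A w - ζ • G w ∈ W.map G → w ∈ W
  surjective_mod : ∀ ζ : ℂ, ζ.re ≤ 0 → ∀ g, ∃ w, g - (A w - ζ • G w) ∈ W.map G
  no_eigenvector : ∀ ζ : ℂ, 0 ≤ ζ.re → ∀ w ∈ W, A w - ζ • G w = 0 → w = 0

namespace Ell

variable {ι : Type*}

open scoped Classical in
/-- The sign operator: `-1` on coordinates in `L`, `+1` on the others. -/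
noncomputable def signOp (L : Finset ι) : Ell ι →L[ℂ] Ell ι :=
  diag (fun i => if i ∈ L then -1 else 1) 1 (fun i => by split_ifs <;> simp)

lemma signOp_apply_of_mem {L : Finset ι} {i : ι} (hi : i ∈ L) (f : Ell ι) :
    signOp L f i = -f i := by simp [signOp, hi]

lemma signOp_apply_of_notMem {L : Finset ι} {i : ι} (hi : i ∉ L) (f : Ell ι) :
    signOp L f i = f i := by simp [signOp, hi]

lemma sum_mul_basisVec {L : Finset ι} (a : L → ℂ) (i : L) :
    ∑ p : L, a p * basisVec (p : ι) (i : ι) = a i := by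
  rw [Finset.sum_eq_single i]
  · simp
  · intro p _ hp
    rw [basisVec_ne (fun h => hp (Subtype.ext h.symm)), mul_zero]
  · simp

lemma sum_mul_basisVec_of_notMem {L : Finset ι} (a : L → ℂ) {i : ι} (hi : i ∉ L) :
    ∑ p : L, a p * basisVec (p : ι) i = 0 :=
  Finset.sum_eq_zero fun p _ => by
    rw [basisVec_ne (fun h => hi (by rw [h]; exact p.2)), mul_zero]

/-- The real part is already at least 1. This makes all later bounds uniform in ζ on a closed half
plane. -/
lemma one_le_norm_one_sub_div {ζ : ℂ} (hζ : ζ.re ≤ 0) {d : ℝ} (hd : 0 < d) :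
    1 ≤ ‖1 - ζ * (d : ℂ)⁻¹‖ := by
  refine le_trans ?_ (Complex.re_le_norm _)
  rw [← Complex.ofReal_inv, mul_comm, Complex.sub_re, Complex.re_ofReal_mul, Complex.one_re]
  have : 0 ≤ d⁻¹ := by positivity
  nlinarith

-- W is spanned by w_j = e_j + y_j with y from the Riccati equation, so it is a graph over the
-- coordinates in `L`, and its image under G is the graph of the family z. Modulo these graphs the
-- pencil is diagonal with entries 1-ζ/δ_i, of modulus at least 1 if Re ζ ≤ 0, up to a perturbation
-- of norm at most 1/4. On the coordinates in `L` the diagonal entries are -(1+ζ/δ_p), of modulus at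
-- least 1 if Re ζ ≥ 0.
set_option maxHeartbeats 400000 in
theorem exists_pencilCut (L : Finset ι) {δ : ι → ℝ} (hδ : ∀ i, 0 < δ i) {C : ℝ}
    (hC : ∀ i, ‖(δ i : ℂ)⁻¹‖ ≤ C) {K : Ell ι →L[ℂ] Ell ι}
    (hK : ‖K‖ ≤ 1 / 8) (hKL : ∑ j ∈ L, ‖K (basisVec j)‖ ^ 2 ≤ (1 / 8) ^ 2) :
    ∃ W : Submodule ℂ (Ell ι), FiniteDimensional ℂ W ∧ Module.finrank ℂ W = L.card ∧
      PencilCut ((signOp L + K : Ell ι →L[ℂ] Ell ι) : Ell ι →ₗ[ℂ] Ell ι)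
        (diag (fun i => (δ i : ℂ)⁻¹) C hC : Ell ι →L[ℂ] Ell ι) W := by
  classical
  obtain ⟨y, z, hyL, hzL, hzy, hy1, hz1, hric⟩ := exists_riccati L hδ hK hKL
  set G : Ell ι →L[ℂ] Ell ι := diag (fun i => (δ i : ℂ)⁻¹) C hC with hG
  set A : Ell ι →L[ℂ] Ell ι := signOp L + K with hA
  have hδ0 : ∀ i, (δ i : ℂ) ≠ 0 := fun i => by exact_mod_cast (hδ i).ne'
  have hKle : ∀ f, ‖K f‖ ≤ 1 / 8 * ‖f‖ := K.le_of_opNorm_le hK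
  let w : L → Ell ι := fun j => basisVec (j : ι) + y j
  have hGw : ∀ j : L, (δ j : ℂ) • G (w j) = basisVec (j : ι) + z j := by
    intro j
    refine ext_apply fun i => ?_
    simp only [smul_apply, hG, diag_apply, w, add_apply, hzy j i, mul_add]
    congr 1
    by_cases hij : i = j
    · rw [hij, basisVec_self, mul_one, mul_inv_cancel₀ (hδ0 _)]
    · rw [basisVec_ne hij, mul_zero, mul_zero]
  have hAw : ∀ j : L, A (w j) = (∑ p : L, K (w j) p • ((δ p : ℂ) • G (w p)))
      - (δ j : ℂ) • G (w j) := by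
    intro j
    refine ext_apply fun i => ?_
    simp only [hGw]
    simp only [hA, _root_.add_apply, add_apply, sub_apply, sum_apply, smul_apply,
      mul_add, Finset.sum_add_distrib]
    by_cases hi : i ∈ L
    · rw [signOp_apply_of_mem hi]
      have h1 := sum_mul_basisVec (fun p : L => K (w j) p) ⟨i, hi⟩
      rw [h1]
      simp only [w, add_apply, hyL j i hi, hzL _ i hi, mul_zero, Finset.sum_const_zero]
      ring
    · rw [signOp_apply_of_notMem hi, sum_mul_basisVec_of_notMem _ hi]
      have h1 := hric j i hi
      have h2 : basisVec (j : ι) i = 0 := basisVec_ne (fun h => hi (h ▸ j.2))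
      simp only [w, add_apply] at h1 ⊢
      rw [h2]
      linear_combination h1
  let W : Submodule ℂ (Ell ι) := Submodule.span ℂ (Set.range w)
  have hwW : ∀ j, w j ∈ W := fun j => Submodule.subset_span ⟨j, rfl⟩
  have hGW : ∀ j : L, (δ j : ℂ) • G (w j) ∈ W.map (G : Ell ι →ₗ[ℂ] Ell ι) := fun j =>
    Submodule.smul_mem _ _ ⟨w j, hwW j, rfl⟩
  have hwp : ∀ j p : L, w j p = if p = j then 1 else 0 := by
    intro j p
    simp only [w, add_apply, hyL j p p.2, add_zero]
    split_ifs with h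
    · rw [h, basisVec_self]
    · exact basisVec_ne fun h' => h (Subtype.ext h')
  have hcoord : ∀ (a : L → ℂ) (p : L), (∑ j, a j • w j) p = a p := by
    intro a p
    rw [sum_apply, Finset.sum_eq_single p]
    · rw [smul_apply, hwp, if_pos rfl, mul_one]
    · intro j _ hj
      rw [smul_apply, hwp, if_neg hj.symm, mul_zero]
    · simp
  have hWrep : ∀ v ∈ W, v = ∑ j : L, v j • w j := by
    intro v hv
    obtain ⟨a, rfl⟩ := (Submodule.mem_span_range_iff_exists_fun ℂ).1 hv
    exact Finset.sum_congr rfl fun j _ => by rw [hcoord]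
  have hindep : LinearIndependent ℂ w := by
    rw [Fintype.linearIndependent_iff]
    intro a ha p
    rw [← hcoord a p, ha, zero_apply]
  have hinv : ∀ v ∈ W, A v ∈ W.map (G : Ell ι →ₗ[ℂ] Ell ι) := by
    intro v hv
    rw [hWrep v hv, map_sum]
    refine Submodule.sum_mem _ fun j _ => ?_
    rw [map_smul, hAw]
    exact Submodule.smul_mem _ _ (Submodule.sub_mem _
      (Submodule.sum_mem _ fun p _ => Submodule.smul_mem _ _ (hGW p)) (hGW j))
  -- the projection along the image of `W`
  let H : Ell ι → Ell ι := fun g => g - ∑ p : L, g p • z p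
  have hHadd : ∀ f g, H (f - g) = H f - H g := by
    intro f g
    simp only [H, sub_apply, sub_smul, Finset.sum_sub_distrib]
    abel
  have hHK : ∀ v, ‖H (K v)‖ ≤ 1 / 4 * ‖v‖ := by
    intro v
    have h1 := norm_sum_coord_smul_sq_le (K v) z
    have h2 : ‖∑ p : L, K v p • z p‖ ≤ ‖K v‖ := by
      refine (sq_le_sq₀ (norm_nonneg _) (norm_nonneg _)).1 (h1.trans ?_)
      exact mul_le_of_le_one_right (sq_nonneg _) hz1
    have h3 := norm_sub_le (K v) (∑ p : L, K v p • z p)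
    have h4 := hKle v
    simp only [H]
    linarith
  -- G W consists of the vectors whose off-`L` part is the combination of the z_p with their own
  -- `L`-coordinates as coefficients; `H` measures the deviation from this.
  have hmemGW : ∀ g, (∀ i ∉ L, H g i = 0) ↔ g ∈ W.map (G : Ell ι →ₗ[ℂ] Ell ι) := by
    intro g
    constructor
    · intro hg
      have : g = ∑ p : L, g p • ((δ p : ℂ) • G (w p)) := by
        refine ext_apply fun i => ?_
        simp only [hGw, sum_apply, smul_apply, add_apply, mul_add, Finset.sum_add_distrib]
        by_cases hi : i ∈ L
        · have h1 := sum_mul_basisVec (fun p : L => g p) ⟨i, hi⟩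
          rw [h1]
          simp [hzL _ i hi]
        · rw [sum_mul_basisVec_of_notMem _ hi, zero_add]
          have := hg i hi
          simp only [H, sub_apply, sum_apply, smul_apply] at this
          exact sub_eq_zero.1 this
      rw [this]
      exact Submodule.sum_mem _ fun p _ => Submodule.smul_mem _ _ (hGW p)
    · rintro ⟨v, hv, rfl⟩ i hi
      have h0 : ∀ j : L, H (G (w j)) i = 0 := by
        intro j
        have h1 : G (w j) = (δ j : ℂ)⁻¹ • (basisVec (j : ι) + z j) := by
          rw [← hGw, smul_smul, inv_mul_cancel₀ (hδ0 _), one_smul]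
        have h2 : ∑ p : L, G (w j) p * z p i = (δ j : ℂ)⁻¹ * z j i := by
          rw [Finset.sum_eq_single j]
          · rw [h1, smul_apply, add_apply, basisVec_self, hzL j j j.2, add_zero, mul_one]
          · intro p _ hp
            rw [h1, smul_apply, add_apply, basisVec_ne (fun h => hp (Subtype.ext h)),
              hzL j p p.2, add_zero, mul_zero, zero_mul]
          · simp
        simp only [H, sub_apply, sum_apply, smul_apply, h2]
        rw [h1, smul_apply, add_apply, basisVec_ne (fun h => hi (by rw [h]; exact j.2)), zero_add, sub_self]
      rw [hWrep v hv]
      simp only [ContinuousLinearMap.coe_coe, map_sum, map_smul]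
      have h3 : H (∑ j : L, v j • G (w j)) = ∑ j : L, v j • H (G (w j)) := by
        simp only [H, smul_sub, Finset.sum_sub_distrib, sum_apply, smul_apply, Finset.sum_smul,
          Finset.smul_sum, smul_smul]
        rw [Finset.sum_comm]
      rw [h3, sum_apply]
      exact Finset.sum_eq_zero fun j _ => by rw [smul_apply, h0 j, mul_zero]
  have hhigh : ∀ (ζ : ℂ) (v : Ell ι), (∀ i ∈ L, v i = 0) → ∀ i ∉ L,
      H (A v - ζ • G v) i = (1 - ζ * (δ i : ℂ)⁻¹) * v i + H (K v) i := by
    intro ζ v hv i hi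
    have h1 : ∀ p : L, (A v - ζ • G v) p = K v p := by
      intro p
      simp only [hA, hG, sub_apply, _root_.add_apply, add_apply, smul_apply,
        diag_apply, signOp_apply_of_mem p.2, hv p p.2]
      ring
    simp only [H, sub_apply, sum_apply, smul_apply]
    simp only [sub_apply, smul_apply] at h1
    simp only [h1]
    simp only [hA, hG, _root_.add_apply, add_apply, signOp_apply_of_notMem hi,
      diag_apply]
    ring
  refine ⟨W, FiniteDimensional.span_of_finite ℂ (Set.finite_range w), ?_,
    ⟨hinv, fun ζ hζ v hv => ?_, fun ζ hζ g => ?_, fun ζ hζ v hv h0 => ?_⟩⟩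
  · rw [finrank_span_eq_card hindep, Fintype.card_coe]
  · -- injectivity modulo `W`
    -- Subtracting the element of W with the same coordinates in `L` leaves a vector to which
    -- `hhigh` applies.
    set v' := v - ∑ p : L, v p • w p with hv'
    have hsW : ∑ p : L, v p • w p ∈ W :=
      Submodule.sum_mem _ fun p _ => Submodule.smul_mem _ _ (hwW p)
    have hv'L : ∀ i ∈ L, v' i = 0 := by
      intro i hi
      have := hcoord (fun p => v p) ⟨i, hi⟩
      simp only at this
      rw [hv', sub_apply, this, sub_self]
    have hv'G : A v' - ζ • G v' ∈ W.map (G : Ell ι →ₗ[ℂ] Ell ι) := by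
      have e : A v' - ζ • G v' = (A v - ζ • G v)
          - (A (∑ p : L, v p • w p) - ζ • G (∑ p : L, v p • w p)) := by
        rw [hv', map_sub, map_sub, smul_sub]; abel
      rw [e]
      exact Submodule.sub_mem _ hv (Submodule.sub_mem _ (hinv _ hsW)
        (Submodule.smul_mem _ _ ⟨_, hsW, rfl⟩))
    have hle : ‖v'‖ ≤ ‖H (K v')‖ := by
      refine norm_le_of_forall_le fun i => ?_
      by_cases hi : i ∈ L
      · rw [hv'L i hi, norm_zero]; exact norm_nonneg _
      · have h1 := (hmemGW _).2 hv'G i hi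
        rw [hhigh ζ v' hv'L i hi] at h1
        have h2 : ‖(1 - ζ * (δ i : ℂ)⁻¹) * v' i‖ = ‖H (K v') i‖ := by
          rw [eq_neg_of_add_eq_zero_left h1, norm_neg]
        rw [← h2, norm_mul]
        exact le_mul_of_one_le_left (norm_nonneg _) (one_le_norm_one_sub_div hζ (hδ i))
    have h0 : v' = 0 := by
      have := hHK v'
      have h3 := norm_nonneg v'
      exact norm_eq_zero.1 (by linarith)
    have h3 : v = ∑ p : L, v p • w p := sub_eq_zero.1 h0
    exact h3 ▸ hsW
  · -- surjectivity modulo `W`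
    have hd : ∀ i, ‖(if i ∈ L then 0 else (1 - ζ * (δ i : ℂ)⁻¹)⁻¹ : ℂ)‖ ≤ 1 := by
      intro i
      split_ifs
      · simp
      · rw [norm_inv]
        exact inv_le_one_of_one_le₀ (one_le_norm_one_sub_div hζ (hδ i))
    set D : Ell ι →L[ℂ] Ell ι := diag _ 1 hd with hD
    -- The off-`L` equation (1-ζ/δ_i)v_i + H(Kv)_i = H(g)_i, solved for the diagonal part, with v
    -- vanishing on `L`.
    have hcon : ContractingWith (1 / 2) fun v : Ell ι => D (H g - H (K v)) := by
      refine ⟨by rw [← NNReal.coe_lt_coe]; norm_num, LipschitzWith.of_dist_le_mul fun v v' => ?_⟩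
      rw [dist_eq_norm, dist_eq_norm, ← map_sub, sub_sub_sub_cancel_left, ← hHadd, ← map_sub]
      refine (norm_diag_one_le _ hd _).trans ((hHK _).trans ?_)
      rw [norm_sub_rev]
      have := norm_nonneg (v - v')
      push_cast
      linarith
    obtain ⟨v, hv, -⟩ := hcon.exists_fixedPoint 0 (edist_ne_top _ _)
    have hvi : ∀ i, D (H g - H (K v)) i = v i :=
      fun i => congrArg (fun f : Ell ι => f i) hv
    have hvL : ∀ i ∈ L, v i = 0 := by
      intro i hi
      rw [← hvi i, hD, diag_apply, if_pos hi, zero_mul]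
    refine ⟨v, (hmemGW _).1 fun i hi => ?_⟩
    have h1 := hhigh ζ v hvL i hi
    have h2 := hvi i
    have h3 : 1 - ζ * (δ i : ℂ)⁻¹ ≠ 0 := by
      intro h
      have := one_le_norm_one_sub_div hζ (hδ i)
      rw [h, norm_zero] at this
      linarith
    rw [hD, diag_apply, if_neg hi, sub_apply] at h2
    simp only [ContinuousLinearMap.coe_coe]
    rw [hHadd, sub_apply, h1, ← h2, mul_inv_cancel_left₀ h3]
    ring
  · -- no eigenvector in the right half plane
    have hle : ∀ p : L, ‖v p‖ ^ 2 ≤ ‖K v p‖ ^ 2 := by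
      intro p
      have h1 : (A v - ζ • G v) p = 0 := by
        have := congrArg (fun f : Ell ι => f p) h0
        simpa using this
      simp only [hA, hG, sub_apply, _root_.add_apply, add_apply, smul_apply,
        diag_apply, signOp_apply_of_mem p.2] at h1
      have h2 : K v p = (1 - (-ζ) * (δ p : ℂ)⁻¹) * v p := by linear_combination h1
      rw [h2, norm_mul]
      gcongr
      exact le_mul_of_one_le_left (norm_nonneg _)
        (one_le_norm_one_sub_div (by simpa using hζ) (hδ p))
    have hs : ∑ p : L, ‖v p‖ ^ 2 ≤ ‖K v‖ ^ 2 := by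
      refine (Finset.sum_le_sum fun p _ => hle p).trans ?_
      rw [Finset.sum_coe_sort L fun i => ‖K v i‖ ^ 2]
      exact sum_sq_le _ L
    have hv2 : v = (∑ p : L, v p • basisVec (p : ι)) + ∑ p : L, v p • y p := by
      conv_lhs => rw [hWrep v hv]
      simp only [w, smul_add, Finset.sum_add_distrib]
    have n1 : ‖∑ p : L, v p • basisVec (p : ι)‖ ≤ ‖K v‖ := by
      refine (sq_le_sq₀ (norm_nonneg _) (norm_nonneg _)).1 (le_trans (le_of_eq ?_) hs)
      rw [norm_sq_eq, tsum_eq_sum (s := L)]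
      · rw [← Finset.sum_coe_sort L]
        refine Finset.sum_congr rfl fun i _ => ?_
        simp only [sum_apply, smul_apply]
        have h1 := sum_mul_basisVec (fun p : L => v p) i
        rw [h1]
      · intro i hi
        simp only [sum_apply, smul_apply]
        rw [sum_mul_basisVec_of_notMem _ hi]
        simp
    have n2 : ‖∑ p : L, v p • y p‖ ≤ ‖K v‖ := by
      refine (sq_le_sq₀ (norm_nonneg _) (norm_nonneg _)).1 ?_
      have h1 := norm_sum_smul_sq_le (fun p : L => v p) y
      have h2 : 0 ≤ ∑ p : L, ‖v p‖ ^ 2 := Finset.sum_nonneg fun _ _ => sq_nonneg _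
      nlinarith
    -- Both parts of v are bounded by ‖Kv‖, so ‖v‖ ≤ 2‖Kv‖ ≤ ‖v‖/4.
    have h4 := norm_add_le (∑ p : L, v p • basisVec (p : ι)) (∑ p : L, v p • y p)
    rw [← hv2] at h4
    have h5 := hKle v
    have h6 := norm_nonneg v
    exact norm_eq_zero.1 (by linarith)

end Ell

namespace Ell

/-! ### Hilbert–Schmidt operators -/

variable {ι : Type*} {a : ι → ι → ℂ}

lemma summable_row (h : Summable fun p : ι × ι => ‖a p.1 p.2‖ ^ 2) (k : ι) :
    Summable fun j => ‖a k j‖ ^ 2 := h.prod_factor k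

/-- The complex conjugate of a row of a square summable matrix. -/
noncomputable def row (h : Summable fun p : ι × ι => ‖a p.1 p.2‖ ^ 2) (k : ι) : Ell ι :=
  ⟨fun j => (starRingEnd ℂ) (a k j), memℓp_iff.2 (by simpa using summable_row h k)⟩

lemma norm_row_sq (h : Summable fun p : ι × ι => ‖a p.1 p.2‖ ^ 2) (k : ι) :
    ‖row h k‖ ^ 2 = ∑' j, ‖a k j‖ ^ 2 := by
  rw [norm_sq_eq]
  exact tsum_congr fun j => by simp [row]

lemma inner_row (h : Summable fun p : ι × ι => ‖a p.1 p.2‖ ^ 2) (k : ι) (w : Ell ι) :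
    inner ℂ (row h k) w = ∑' j, a k j * w j := by
  rw [lp.inner_eq_tsum]
  exact tsum_congr fun j => by simp [row, mul_comm]

lemma norm_inner_row_sq_le (h : Summable fun p : ι × ι => ‖a p.1 p.2‖ ^ 2) (k : ι) (w : Ell ι) :
    ‖(inner ℂ (row h k) w : ℂ)‖ ^ 2 ≤ (∑' j, ‖a k j‖ ^ 2) * ‖w‖ ^ 2 := by
  rw [← norm_row_sq h, ← mul_pow]
  gcongr
  exact norm_inner_le_norm _ _

/-- The linear map with a square summable matrix. -/
noncomputable def hsAux (h : Summable fun p : ι × ι => ‖a p.1 p.2‖ ^ 2) : Ell ι →ₗ[ℂ] Ell ι where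
  toFun w := ⟨fun k => inner ℂ (row h k) w, memℓp_iff.2 <|
    Summable.of_nonneg_of_le (fun _ => sq_nonneg _) (fun k => norm_inner_row_sq_le h k w)
      (h.prod.mul_right _)⟩
  map_add' _ _ := ext_apply fun _ => inner_add_right _ _ _
  map_smul' _ _ := ext_apply fun _ => inner_smul_right _ _ _

lemma norm_hsAux_le (h : Summable fun p : ι × ι => ‖a p.1 p.2‖ ^ 2) (w : Ell ι) :
    ‖hsAux h w‖ ≤ Real.sqrt (∑' p : ι × ι, ‖a p.1 p.2‖ ^ 2) * ‖w‖ := by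
  refine (sq_le_sq₀ (norm_nonneg _) (by positivity)).1 ?_
  rw [norm_sq_eq, mul_pow, Real.sq_sqrt (tsum_nonneg fun _ => sq_nonneg _), h.tsum_prod,
    ← tsum_mul_right]
  exact (summable_sq (hsAux h w)).tsum_le_tsum (fun k => norm_inner_row_sq_le h k w)
    (h.prod.mul_right _)

/-- The operator with a square summable matrix. -/
noncomputable def hsOp (h : Summable fun p : ι × ι => ‖a p.1 p.2‖ ^ 2) : Ell ι →L[ℂ] Ell ι :=
  (hsAux h).mkContinuous _ (norm_hsAux_le h)

lemma hsOp_apply (h : Summable fun p : ι × ι => ‖a p.1 p.2‖ ^ 2) (w : Ell ι) (k : ι) :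
    hsOp h w k = ∑' j, a k j * w j := inner_row h k w

lemma norm_hsOp_le (h : Summable fun p : ι × ι => ‖a p.1 p.2‖ ^ 2) :
    ‖hsOp h‖ ≤ Real.sqrt (∑' p : ι × ι, ‖a p.1 p.2‖ ^ 2) :=
  LinearMap.mkContinuous_norm_le _ (Real.sqrt_nonneg _) _

lemma hsOp_basisVec (h : Summable fun p : ι × ι => ‖a p.1 p.2‖ ^ 2) (j k : ι) :
    hsOp h (basisVec j) k = a k j := by
  rw [hsOp_apply, tsum_eq_single j]
  · simp
  · intro i hi
    rw [basisVec_ne hi, mul_zero]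

/-- The vectors K e_j are the columns of the matrix, so any finite family of them is bounded by the
full double series. An operator norm bound would grow with the size of `L`; this is why
Hilbert–Schmidt norms are used. -/
lemma sum_norm_hsOp_basisVec_sq_le (h : Summable fun p : ι × ι => ‖a p.1 p.2‖ ^ 2)
    (L : Finset ι) :
    ∑ j ∈ L, ‖hsOp h (basisVec j)‖ ^ 2 ≤ ∑' p : ι × ι, ‖a p.1 p.2‖ ^ 2 := by
  have h' : Summable fun p : ι × ι => ‖a p.2 p.1‖ ^ 2 := h.prod_symm
  have e : ∑' p : ι × ι, ‖a p.1 p.2‖ ^ 2 = ∑' j, ∑' k, ‖a k j‖ ^ 2 := by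
    rw [← h'.tsum_prod]
    exact ((Equiv.prodComm ι ι).tsum_eq _).symm
  rw [e]
  simp only [norm_sq_eq, hsOp_basisVec]
  exact h'.prod.sum_le_tsum L fun j _ => tsum_nonneg fun _ => sq_nonneg _

end Ell

/-! ### From pencils to unbounded operators -/

section Transfer

variable {E H : Type*} [AddCommGroup E] [Module ℂ E] [AddCommGroup H] [Module ℂ H]
  {T : E →ₗ.[ℂ] E} {A G : H →ₗ[ℂ] H} {Ψ : H ≃ₗ[ℂ] E} {c : ℝ}

/-- `T - c` is `A G⁻¹` up to the equivalence `Ψ`. -/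
structure IsPencil (T : E →ₗ.[ℂ] E) (A G : H →ₗ[ℂ] H) (Ψ : H ≃ₗ[ℂ] E) (c : ℝ) : Prop where
  injective : Function.Injective G
  mem_domain : ∀ w, Ψ (G w) ∈ T.domain
  exists_of_mem_domain : ∀ u ∈ T.domain, ∃ w, Ψ (G w) = u
  apply_eq : ∀ w, T ⟨Ψ (G w), mem_domain w⟩ = Ψ (A w) + (c : ℂ) • Ψ (G w)

namespace IsPencil

lemma shifted_eq (h : IsPencil T A G Ψ c) (z : ℂ) (w : H) :
    shifted T z ⟨Ψ (G w), h.mem_domain w⟩ = Ψ (A w - (z - c) • G w) := by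
  rw [SpectralCut.shifted_apply, h.apply_eq, map_sub, map_smul, sub_smul]
  abel

lemma exists_eq (h : IsPencil T A G Ψ c) (u : T.domain) :
    ∃ w, u = ⟨Ψ (G w), h.mem_domain w⟩ := by
  obtain ⟨w, hw⟩ := h.exists_of_mem_domain u u.2
  exact ⟨w, Subtype.ext hw.symm⟩

lemma bijective (h : IsPencil T A G Ψ c) {z : ℂ} (hz : Function.Bijective (shifted T z)) :
    Function.Bijective fun w => A w - (z - c) • G w := by
  constructor
  · intro w w' hww
    have h1 := congrArg Ψ hww
    simp only [← h.shifted_eq] at h1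
    exact h.injective (Ψ.injective congr(($(hz.1 h1) : E)))
  · intro g
    obtain ⟨u, hu⟩ := hz.2 (Ψ g)
    obtain ⟨w, rfl⟩ := h.exists_eq u
    rw [h.shifted_eq] at hu
    exact ⟨w, Ψ.injective hu⟩

variable {W : Submodule ℂ H}

/-- Under u = ΨGw the operator T - z becomes the pencil A - ζG with ζ = z - c, so the line Re z = c
corresponds to Re ζ = 0. -/
lemma spectralCut (h : IsPencil T A G Ψ c) (hW : PencilCut A G W) :
    SpectralCut T (W.map (Ψ.toLinearMap ∘ₗ G)) c := by
  have key : ∀ {g : H}, Ψ g ∈ W.map (Ψ.toLinearMap ∘ₗ G) ↔ g ∈ W.map G := by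
    intro g
    rw [Submodule.map_comp]
    exact Ψ.injective.mem_set_image (s := (W.map G : Set H))
  have key' : ∀ {w : H}, Ψ (G w) ∈ W.map (Ψ.toLinearMap ∘ₗ G) ↔ w ∈ W := by
    intro w
    rw [key]
    exact h.injective.mem_set_image (s := (W : Set H))
  refine ⟨?_, fun u hu => ?_, fun z hz u hu => ?_, fun z hz f => ?_, fun z hz u huS hu => ?_⟩
  · rintro _ ⟨w, -, rfl⟩
    exact h.mem_domain w
  · obtain ⟨w, rfl⟩ := h.exists_eq u
    rw [h.apply_eq]
    exact Submodule.add_mem _ (key.2 (hW.invariant w (key'.1 hu))) (Submodule.smul_mem _ _ hu)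
  · obtain ⟨w, rfl⟩ := h.exists_eq u
    rw [h.shifted_eq, key] at hu
    exact key'.2 (hW.injective_mod _ (by simpa using hz) w hu)
  · obtain ⟨w, hw⟩ := hW.surjective_mod (z - c) (by simpa using hz) (Ψ.symm f)
    refine ⟨⟨_, h.mem_domain w⟩, ?_⟩
    rw [h.shifted_eq, ← Ψ.apply_symm_apply f, ← map_sub, key]
    exact hw
  · obtain ⟨w, rfl⟩ := h.exists_eq u
    rw [h.shifted_eq, LinearEquiv.map_eq_zero_iff] at hu
    have := hW.no_eigenvector _ (by simpa using hz) w (key'.1 huS) hu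
    subst this
    exact Subtype.ext (by simp)

lemma finrank_map (h : IsPencil T A G Ψ c) :
    Module.finrank ℂ (W.map (Ψ.toLinearMap ∘ₗ G)) = Module.finrank ℂ W :=
  (LinearEquiv.finrank_eq (Submodule.equivMapOfInjective (Ψ.toLinearMap ∘ₗ G)
    (Ψ.injective.comp h.injective) W)).symm

end IsPencil

end Transfer

/-- By the bounded inverse theorem on ℓ², which later supplies the bounded inverse required in the
resolvent set. -/
lemma exists_norm_le_of_bijective {ι : Type*} {A G : Ell ι →L[ℂ] Ell ι} {ζ : ℂ}
    (h : Function.Bijective fun w => A w - ζ • G w) :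
    ∃ C : ℝ, 0 ≤ C ∧ ∀ w, ‖w‖ ≤ C * ‖A w - ζ • G w‖ := by
  let B : Ell ι →L[ℂ] Ell ι := A - ζ • G
  let e := ContinuousLinearEquiv.ofBijective B (LinearMap.ker_eq_bot.2 h.1)
    (LinearMap.range_eq_top.2 h.2)
  refine ⟨‖(e.symm : Ell ι →L[ℂ] Ell ι)‖, norm_nonneg _, fun w => ?_⟩
  have h1 : e w = A w - ζ • G w := rfl
  rw [← h1]
  conv_lhs => rw [← e.symm_apply_apply w]
  exact (e.symm : Ell ι →L[ℂ] Ell ι).le_opNorm (e w)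

/-! ### Semi-periodic sequences and `ℓ²` over the odd integers -/

/-- The odd integers. -/
abbrev OddInt := {k : ℤ // Odd k}

/-- Extension by zero to the even integers. -/
noncomputable def oddExt (f : OddInt → ℂ) (k : ℤ) : ℂ :=
  if h : Odd k then f ⟨k, h⟩ else 0

@[simp] lemma oddExt_coe (f : OddInt → ℂ) (k : OddInt) : oddExt f k = f k := by
  simp [oddExt, k.2]

lemma oddExt_of_even (f : OddInt → ℂ) {k : ℤ} (hk : Even k) : oddExt f k = 0 :=
  dif_neg (Int.not_odd_iff_even.2 hk)

lemma notMem_range_coe_oddInt {k : ℤ} (hk : k ∉ Set.range ((↑) : OddInt → ℤ)) : Even k := by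
  by_contra h
  exact hk ⟨⟨k, Int.not_even_iff_odd.1 h⟩, rfl⟩

lemma eq_oddExt {s : ℝ} (u : HMinus s) : u.1 = oddExt fun k => u.1 k := by
  funext k
  by_cases hk : Odd k
  · simp [oddExt, hk]
  · rw [oddExt_of_even _ (Int.not_odd_iff_even.1 hk), u.2.2 k (Int.not_odd_iff_even.1 hk)]

lemma oddExt_mem_iff {s : ℝ} {f : OddInt → ℂ} :
    oddExt f ∈ HMinus s ↔ Summable fun k : OddInt => bracket k ^ (2 * s) * ‖f k‖ ^ 2 := by
  have h1 : oddExt f ∈ HMinus s ↔ Summable fun k : ℤ => bracket k ^ (2 * s) * ‖oddExt f k‖ ^ 2 :=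
    ⟨fun h => h.1, fun h => ⟨h, fun k hk => oddExt_of_even f hk⟩⟩
  rw [h1, ← Function.Injective.summable_iff (f := fun k : ℤ => _) Subtype.val_injective]
  · change (Summable fun k : OddInt => bracket k ^ (2 * s) * ‖oddExt f (k : ℤ)‖ ^ 2) ↔ _
    simp only [oddExt_coe]
  · intro k hk
    rw [oddExt_of_even f (notMem_range_coe_oddInt hk)]
    simp

lemma bracket_rpow_nat (m : ℕ) (k : ℤ) : bracket k ^ (2 * (m : ℝ)) = bracket k ^ (2 * m) := by
  rw [← Real.rpow_natCast]
  push_cast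
  rfl

lemma bracket_rpow_neg_nat (m : ℕ) (k : ℤ) :
    bracket k ^ (2 * (-(m : ℝ))) = (bracket k ^ (2 * m))⁻¹ := by
  rw [mul_neg, Real.rpow_neg (bracket_pos k).le, bracket_rpow_nat]

lemma sobolevNorm_nonneg (s : ℝ) (a : ℤ → ℂ) : 0 ≤ sobolevNorm s a := Real.sqrt_nonneg _

lemma sobolevNorm_sq (s : ℝ) (a : ℤ → ℂ) :
    sobolevNorm s a ^ 2 = ∑' k : ℤ, bracket k ^ (2 * s) * ‖a k‖ ^ 2 :=
  Real.sq_sqrt (tsum_nonneg fun k =>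
    mul_nonneg (Real.rpow_nonneg (bracket_pos k).le _) (sq_nonneg _))

lemma sobolevNorm_oddExt_sq (s : ℝ) (f : OddInt → ℂ) :
    sobolevNorm s (oddExt f) ^ 2 = ∑' k : OddInt, bracket k ^ (2 * s) * ‖f k‖ ^ 2 := by
  rw [sobolevNorm_sq, ← Function.Injective.tsum_eq (f := fun k : ℤ =>
    bracket k ^ (2 * s) * ‖oddExt f k‖ ^ 2) (g := ((↑) : OddInt → ℤ)) Subtype.val_injective]
  · simp
  · intro k hk
    by_contra h
    rw [Function.mem_support, oddExt_of_even f (notMem_range_coe_oddInt h)] at hk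
    simp at hk

/-! ### Weighted isomorphisms between ℓ² and H_-^{-m}, and L_m(V) as a pencil. -/

/-- Weights on the odd integers comparable to `⟨k⟩^{2m}`. -/
structure Comparable (m : ℕ) (δ : OddInt → ℝ) (c₁ c₂ : ℝ) : Prop where
  pos : 0 < c₁
  lower : ∀ k : OddInt, c₁ * bracket k ^ (2 * m) ≤ δ k
  upper : ∀ k : OddInt, δ k ≤ c₂ * bracket k ^ (2 * m)

namespace Comparable

variable {m : ℕ} {δ : OddInt → ℝ} {c₁ c₂ : ℝ}

lemma bracket_pow_pos (m : ℕ) (k : ℤ) : 0 < bracket k ^ (2 * m) := pow_pos (bracket_pos k) _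

lemma weight_pos (h : Comparable m δ c₁ c₂) (k : OddInt) : 0 < δ k :=
  lt_of_lt_of_le (mul_pos h.pos (bracket_pow_pos m k)) (h.lower k)

lemma inv_le (h : Comparable m δ c₁ c₂) (k : OddInt) :
    (δ k)⁻¹ ≤ c₁⁻¹ * (bracket k ^ (2 * m))⁻¹ := by
  rw [← mul_inv]
  exact inv_anti₀ (mul_pos h.pos (bracket_pow_pos m k)) (h.lower k)

lemma norm_inv_le (h : Comparable m δ c₁ c₂) (k : OddInt) : ‖(δ k : ℂ)⁻¹‖ ≤ c₁⁻¹ := by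
  rw [norm_inv, Complex.norm_real, Real.norm_of_nonneg (h.weight_pos k).le]
  refine inv_anti₀ h.pos (le_trans ?_ (h.lower k))
  exact le_mul_of_one_le_right h.pos.le (one_le_pow₀ (one_le_bracket k))

lemma norm_sqrt_mul_sq (h : Comparable m δ c₁ c₂) (k : OddInt) (a : ℂ) :
    ‖(Real.sqrt (δ k) : ℂ) * a‖ ^ 2 = δ k * ‖a‖ ^ 2 := by
  rw [norm_mul, mul_pow, Complex.norm_real, Real.norm_of_nonneg (Real.sqrt_nonneg _),
    Real.sq_sqrt (h.weight_pos k).le]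

lemma norm_sqrt_inv_mul_sq (h : Comparable m δ c₁ c₂) (k : OddInt) (a : ℂ) :
    ‖(Real.sqrt (δ k) : ℂ)⁻¹ * a‖ ^ 2 = (δ k)⁻¹ * ‖a‖ ^ 2 := by
  rw [norm_mul, mul_pow, norm_inv, inv_pow, Complex.norm_real,
    Real.norm_of_nonneg (Real.sqrt_nonneg _), Real.sq_sqrt (h.weight_pos k).le]

lemma weighted_le (h : Comparable m δ c₁ c₂) (k : OddInt) (a : ℂ) :
    bracket k ^ (2 * (-(m : ℝ))) * ‖(Real.sqrt (δ k) : ℂ) * a‖ ^ 2 ≤ c₂ * ‖a‖ ^ 2 := by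
  rw [h.norm_sqrt_mul_sq, bracket_rpow_neg_nat, ← mul_assoc]
  gcongr
  rw [inv_mul_le_iff₀ (bracket_pow_pos m k), mul_comm]
  exact h.upper k

lemma le_weighted (h : Comparable m δ c₁ c₂) (k : OddInt) (a : ℂ) :
    ‖(Real.sqrt (δ k) : ℂ)⁻¹ * a‖ ^ 2 ≤ c₁⁻¹ * (bracket k ^ (2 * (-(m : ℝ))) * ‖a‖ ^ 2) := by
  rw [h.norm_sqrt_inv_mul_sq, bracket_rpow_neg_nat, ← mul_assoc]
  gcongr
  exact h.inv_le k

lemma sqrt_ne_zero (h : Comparable m δ c₁ c₂) (k : OddInt) : (Real.sqrt (δ k) : ℂ) ≠ 0 := by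
  exact_mod_cast (Real.sqrt_pos.2 (h.weight_pos k)).ne'

lemma sqrt_mul_self (h : Comparable m δ c₁ c₂) (k : OddInt) :
    (Real.sqrt (δ k) : ℂ) * Real.sqrt (δ k) = δ k := by
  exact_mod_cast Real.mul_self_sqrt (h.weight_pos k).le

/-- The equivalence `ℓ² ≃ H_-^{-m}` given by the weights `δ^{1/2}`. -/
noncomputable def equiv (h : Comparable m δ c₁ c₂) : Ell OddInt ≃ₗ[ℂ] HMinus (-(m : ℝ)) where
  toFun g := ⟨oddExt fun k => Real.sqrt (δ k) * g k, oddExt_mem_iff.2 <|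
    Summable.of_nonneg_of_le
      (fun k => mul_nonneg (Real.rpow_nonneg (bracket_pos k).le _) (sq_nonneg _))
      (fun k => h.weighted_le k (g k)) ((Ell.summable_sq g).mul_left c₂)⟩
  invFun u := ⟨fun k => (Real.sqrt (δ k) : ℂ)⁻¹ * u.1 k, Ell.memℓp_iff.2 <|
    Summable.of_nonneg_of_le (fun _ => sq_nonneg _) (fun k => h.le_weighted k (u.1 k))
      ((oddExt_mem_iff.1 (eq_oddExt u ▸ u.2)).mul_left c₁⁻¹)⟩
  left_inv g := Ell.ext_apply fun k => by
    change (Real.sqrt (δ k) : ℂ)⁻¹ * oddExt (fun k => Real.sqrt (δ k) * g k) k = g k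
    rw [oddExt_coe, inv_mul_cancel_left₀ (h.sqrt_ne_zero k)]
  right_inv u := Subtype.ext <| by
    change (oddExt fun k => Real.sqrt (δ k) * ((Real.sqrt (δ k) : ℂ)⁻¹ * u.1 k)) = u.1
    simp only [mul_inv_cancel_left₀ (h.sqrt_ne_zero _)]
    exact (eq_oddExt u).symm
  map_add' f g := Subtype.ext <| funext fun k => by
    change oddExt (fun k => Real.sqrt (δ k) * (f k + g k)) k = oddExt _ k + oddExt _ k
    unfold oddExt
    split_ifs <;> ring
  map_smul' a f := Subtype.ext <| funext fun k => by
    change oddExt (fun k => Real.sqrt (δ k) * (a * f k)) k = a * oddExt _ k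
    unfold oddExt
    split_ifs <;> ring

lemma coe_equiv (h : Comparable m δ c₁ c₂) (g : Ell OddInt) :
    (h.equiv g).1 = oddExt fun k => Real.sqrt (δ k) * g k := rfl

lemma equiv_apply (h : Comparable m δ c₁ c₂) (g : Ell OddInt) (k : OddInt) :
    (h.equiv g).1 k = Real.sqrt (δ k) * g k := by rw [coe_equiv, oddExt_coe]

lemma sobolevNorm_equiv_sq_le (h : Comparable m δ c₁ c₂) (g : Ell OddInt) :
    sobolevNorm (-(m : ℝ)) (h.equiv g).1 ^ 2 ≤ c₂ * ‖g‖ ^ 2 := by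
  rw [coe_equiv, sobolevNorm_oddExt_sq, Ell.norm_sq_eq, ← tsum_mul_left]
  exact (oddExt_mem_iff.1 (h.equiv g).2).tsum_le_tsum (fun k => h.weighted_le k (g k))
    ((Ell.summable_sq g).mul_left c₂)

lemma norm_sq_le_sobolevNorm_equiv (h : Comparable m δ c₁ c₂) (g : Ell OddInt) :
    ‖g‖ ^ 2 ≤ c₁⁻¹ * sobolevNorm (-(m : ℝ)) (h.equiv g).1 ^ 2 := by
  rw [coe_equiv, sobolevNorm_oddExt_sq, Ell.norm_sq_eq, ← tsum_mul_left]
  refine (Ell.summable_sq g).tsum_le_tsum (fun k => ?_)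
    ((oddExt_mem_iff.1 (h.equiv g).2).mul_left _)
  have := h.le_weighted k (Real.sqrt (δ k) * g k)
  rwa [inv_mul_cancel_left₀ (h.sqrt_ne_zero k)] at this

/-- Division by the weights. -/
noncomputable def invOp (h : Comparable m δ c₁ c₂) : Ell OddInt →L[ℂ] Ell OddInt :=
  Ell.diag (fun k => (δ k : ℂ)⁻¹) c₁⁻¹ h.norm_inv_le

lemma invOp_apply (h : Comparable m δ c₁ c₂) (w : Ell OddInt) (k : OddInt) :
    h.invOp w k = (δ k : ℂ)⁻¹ * w k := rfl

lemma equiv_invOp (h : Comparable m δ c₁ c₂) (w : Ell OddInt) :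
    (h.equiv (h.invOp w)).1 = oddExt fun k => (Real.sqrt (δ k) : ℂ)⁻¹ * w k := by
  rw [coe_equiv]
  congr 1
  funext k
  rw [h.invOp_apply, ← h.sqrt_mul_self, mul_inv, mul_assoc, mul_inv_cancel_left₀ (h.sqrt_ne_zero k)]

lemma equiv_invOp_mem (h : Comparable m δ c₁ c₂) (w : Ell OddInt) :
    (h.equiv (h.invOp w)).1 ∈ HMinus (m : ℝ) := by
  rw [equiv_invOp, oddExt_mem_iff]
  refine Summable.of_nonneg_of_le (fun k => mul_nonneg (Real.rpow_nonneg (bracket_pos k).le _)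
    (sq_nonneg _)) (fun k => ?_) ((Ell.summable_sq w).mul_left c₁⁻¹)
  rw [h.norm_sqrt_inv_mul_sq, bracket_rpow_nat, ← mul_assoc]
  gcongr
  have := h.inv_le k
  have hb := bracket_pow_pos m k
  calc _ ≤ bracket k ^ (2 * m) * (c₁⁻¹ * (bracket k ^ (2 * m))⁻¹) := by gcongr
    _ = c₁⁻¹ := by field_simp

lemma exists_equiv_invOp (h : Comparable m δ c₁ c₂) {u : ℤ → ℂ} (hu : u ∈ HMinus (m : ℝ)) :
    ∃ w, (h.equiv (h.invOp w)).1 = u := by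
  have hu' := eq_oddExt (⟨u, hu⟩ : HMinus (m : ℝ))
  have hs : Summable fun k : OddInt => bracket k ^ (2 * (m : ℝ)) * ‖u k‖ ^ 2 :=
    oddExt_mem_iff.1 (hu' ▸ hu)
  refine ⟨⟨fun k => Real.sqrt (δ k) * u k, Ell.memℓp_iff.2 <| Summable.of_nonneg_of_le
    (fun _ => sq_nonneg _) (fun k => ?_) (hs.mul_left c₂)⟩, ?_⟩
  · rw [h.norm_sqrt_mul_sq, bracket_rpow_nat, ← mul_assoc]
    gcongr
    exact h.upper k
  · rw [equiv_invOp]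
    simp only [inv_mul_cancel_left₀ (h.sqrt_ne_zero _)]
    exact hu'.symm

/-- The matrix of the multiplication by `v` between the weighted spaces. -/
noncomputable def _root_.mulMatrix (v : ℤ → ℂ) (δ : OddInt → ℝ) (k j : OddInt) : ℂ :=
  v (k - j) * ((Real.sqrt (δ k) : ℂ)⁻¹ * (Real.sqrt (δ j) : ℂ)⁻¹)

/-- This is the factorization L_m(V) - c = δ^{1/2}(J+K)δ^{1/2} with K = δ^{-1/2}Vδ^{-1/2}. Here Ψ is
multiplication by δ^{1/2} and ΨG multiplication by δ^{-1/2}, which maps ℓ² onto the domain H_-^m. -/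
lemma isPencil (h : Comparable m δ c₁ c₂) (hm : 1 ≤ m) (V : HPlus (-(m : ℝ))) {c : ℝ}
    {L : Finset OddInt}
    (hlow : ∀ k ∈ L, (((k : ℤ) : ℝ) * Real.pi) ^ (2 * m) = c - δ k)
    (hhigh : ∀ k ∉ L, (((k : ℤ) : ℝ) * Real.pi) ^ (2 * m) = c + δ k)
    (hs : Summable fun p : OddInt × OddInt => ‖mulMatrix V.1 δ p.1 p.2‖ ^ 2) :
    IsPencil (opL m hm V)
      ((Ell.signOp L + Ell.hsOp hs : Ell OddInt →L[ℂ] Ell OddInt) : Ell OddInt →ₗ[ℂ] Ell OddInt)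
      (h.invOp : Ell OddInt →ₗ[ℂ] Ell OddInt) h.equiv c where
  injective := by
    intro w w' hw
    refine Ell.ext_apply fun k => ?_
    have h1 : h.invOp w k = h.invOp w' k := congrArg (fun f : Ell OddInt => f k) hw
    rw [h.invOp_apply, h.invOp_apply] at h1
    exact mul_left_cancel₀ (inv_ne_zero (Complex.ofReal_ne_zero.2 (h.weight_pos k).ne')) h1
  mem_domain w := h.equiv_invOp_mem w
  exists_of_mem_domain u hu := by
    obtain ⟨w, hw⟩ := h.exists_equiv_invOp hu
    exact ⟨w, Subtype.ext hw⟩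
  apply_eq w := by
    set A : Ell OddInt →L[ℂ] Ell OddInt := Ell.signOp L + Ell.hsOp hs with hA
    set u := h.equiv (h.invOp w) with hu
    refine Subtype.ext ?_
    change (opL m hm V ⟨u, h.equiv_invOp_mem w⟩).1 = (h.equiv (A w) + (c : ℂ) • u).1
    refine (eq_oddExt _).trans (Eq.trans ?_ (eq_oddExt _).symm)
    congr 1
    funext k
    have e1 : (opL m hm V ⟨u, h.equiv_invOp_mem w⟩).1 k
        = ((((k : ℤ) : ℝ) * Real.pi : ℝ) : ℂ) ^ (2 * m) * u.1 k + fourierMul V.1 u.1 k := rfl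
    have e2 : (h.equiv (A w) + (c : ℂ) • u).1 k
        = (h.equiv (A w)).1 k + c * u.1 k := rfl
    have eu : u.1 = oddExt fun k => (Real.sqrt (δ k) : ℂ)⁻¹ * w k := h.equiv_invOp w
    have e3 : fourierMul V.1 u.1 k = Real.sqrt (δ k) * Ell.hsOp hs w k := by
      rw [Ell.hsOp_apply, ← tsum_mul_left, fourierMul]
      rw [← Function.Injective.tsum_eq (f := fun j : ℤ => V.1 (k - j) * u.1 j)
        (g := ((↑) : OddInt → ℤ)) Subtype.val_injective]
      · refine tsum_congr fun j => ?_
        rw [eu, oddExt_coe, mulMatrix]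
        have := h.sqrt_ne_zero k
        field_simp
      · intro j hj
        by_contra hne
        rw [Function.mem_support, u.2.2 j (notMem_range_coe_oddInt hne), mul_zero] at hj
        exact hj rfl
    have e4 : (h.equiv (A w)).1 k = Real.sqrt (δ k) * (Ell.signOp L w k + Ell.hsOp hs w k) :=
      h.equiv_apply (A w) k
    rw [e1, e2, e3, e4, eu, oddExt_coe, ← Complex.ofReal_pow]
    have hne := h.sqrt_ne_zero k
    have hmul := h.sqrt_mul_self k
    by_cases hk : k ∈ L
    · rw [hlow k hk, Ell.signOp_apply_of_mem hk]
      push_cast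
      field_simp
      linear_combination w k * hmul
    · rw [hhigh k hk, Ell.signOp_apply_of_notMem hk]
      push_cast
      field_simp
      linear_combination (-w k) * hmul

end Comparable

/-- Spectral cuts of `L_m(V)` from a Hilbert–Schmidt bound. -/
theorem exists_spectralCut {m : ℕ} (hm : 1 ≤ m) (V : HPlus (-(m : ℝ))) {δ : OddInt → ℝ}
    {c₁ c₂ c : ℝ} (h : Comparable m δ c₁ c₂) {L : Finset OddInt}
    (hlow : ∀ k ∈ L, (((k : ℤ) : ℝ) * Real.pi) ^ (2 * m) = c - δ k)
    (hhigh : ∀ k ∉ L, (((k : ℤ) : ℝ) * Real.pi) ^ (2 * m) = c + δ k)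
    (hs : Summable fun p : OddInt × OddInt => ‖mulMatrix V.1 δ p.1 p.2‖ ^ 2)
    (hle : ∑' p : OddInt × OddInt, ‖mulMatrix V.1 δ p.1 p.2‖ ^ 2 ≤ (1 / 8) ^ 2) :
    (∃ S : Submodule ℂ (HMinus (-(m : ℝ))), FiniteDimensional ℂ S ∧
      Module.finrank ℂ S = L.card ∧ SpectralCut (opL m hm V) S c) ∧
    ∀ z, Function.Bijective (shifted (opL m hm V) z) →
      ∃ K : ℝ, ∀ u : (opL m hm V).domain,
        sobolevNorm (-(m : ℝ)) (u : HMinus (-(m : ℝ)))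
          ≤ K * sobolevNorm (-(m : ℝ)) (shifted (opL m hm V) z u) := by
  have hp := h.isPencil hm V hlow hhigh hs
  have hKn : ‖Ell.hsOp hs‖ ≤ 1 / 8 :=
    (Ell.norm_hsOp_le hs).trans (Real.sqrt_le_iff.2 ⟨by norm_num, hle⟩)
  obtain ⟨W, hWf, hWr, hW⟩ := Ell.exists_pencilCut L h.weight_pos h.norm_inv_le hKn
    ((Ell.sum_norm_hsOp_basisVec_sq_le hs L).trans hle)
  refine ⟨⟨_, inferInstance, hp.finrank_map.trans hWr, hp.spectralCut hW⟩, fun z hz => ?_⟩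
  obtain ⟨C, hC0, hC⟩ := exists_norm_le_of_bijective (hp.bijective hz)
  have hc₂ : 0 ≤ c₂ := by
    have h1 := (h.weight_pos ⟨1, odd_one⟩).le.trans (h.upper ⟨1, odd_one⟩)
    exact nonneg_of_mul_nonneg_left h1 (Comparable.bracket_pow_pos m _)
  refine ⟨Real.sqrt c₂ * (‖h.invOp‖ * (C * Real.sqrt c₁⁻¹)), fun u => ?_⟩
  obtain ⟨w, rfl⟩ := hp.exists_eq u
  rw [hp.shifted_eq]
  set g := (Ell.signOp L + Ell.hsOp hs) w - (z - c) • h.invOp w with hg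
  have h1 : sobolevNorm (-(m : ℝ)) (h.equiv (h.invOp w)).1 ≤ Real.sqrt c₂ * ‖h.invOp w‖ := by
    refine (sq_le_sq₀ (sobolevNorm_nonneg _ _) (by positivity)).1 ?_
    rw [mul_pow, Real.sq_sqrt hc₂]
    exact h.sobolevNorm_equiv_sq_le _
  have h2 : ‖g‖ ≤ Real.sqrt c₁⁻¹ * sobolevNorm (-(m : ℝ)) (h.equiv g).1 := by
    have hpos := h.pos
    have hn := sobolevNorm_nonneg (-(m : ℝ)) (h.equiv g).1
    refine (sq_le_sq₀ (norm_nonneg _) (by positivity)).1 ?_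
    rw [mul_pow, Real.sq_sqrt (by positivity)]
    exact h.norm_sq_le_sobolevNorm_equiv _
  calc sobolevNorm (-(m : ℝ)) (h.equiv (h.invOp w)).1
      ≤ Real.sqrt c₂ * ‖h.invOp w‖ := h1
    _ ≤ Real.sqrt c₂ * (‖h.invOp‖ * (C * (Real.sqrt c₁⁻¹ *
        sobolevNorm (-(m : ℝ)) (h.equiv g).1))) := by
      gcongr
      exact (h.invOp.le_opNorm w).trans (mul_le_mul_of_nonneg_left
        ((hC w).trans (mul_le_mul_of_nonneg_left h2 hC0)) (norm_nonneg _))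
    _ = _ := by
      change _ = _ * sobolevNorm (-(m : ℝ)) (h.equiv g).1
      ring

/-! ### Eigenvectors and Hilbert–Schmidt sums -/

/-- The eigenvalue `(kπ)^{2m}` of `D^{2m}`. -/
noncomputable def freq (m : ℕ) (k : ℤ) : ℝ := ((k : ℝ) * Real.pi) ^ (2 * m)

lemma norm_mulMatrix_sq {v : ℤ → ℂ} {g : OddInt → ℝ} (hg : ∀ k, 0 < g k) (k j : OddInt) :
    ‖mulMatrix v g k j‖ ^ 2 = ‖v (k - j)‖ ^ 2 * (1 / (g k * g j)) := by
  rw [mulMatrix, norm_mul, norm_mul, norm_inv, norm_inv, Complex.norm_real, Complex.norm_real,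
    Real.norm_of_nonneg (Real.sqrt_nonneg _), Real.norm_of_nonneg (Real.sqrt_nonneg _), mul_pow,
    mul_pow, inv_pow, inv_pow, Real.sq_sqrt (hg k).le, Real.sq_sqrt (hg j).le, one_div, mul_inv]

lemma norm_sub_freq_le (m : ℕ) (z : ℂ) (k : ℤ) :
    ‖z - (freq m k : ℂ)‖ ≤ (‖z‖ + Real.pi ^ (2 * m)) * bracket k ^ (2 * m) := by
  have h1 : 1 ≤ bracket k ^ (2 * m) := one_le_pow₀ (one_le_bracket k)
  have h2 : ‖(freq m k : ℂ)‖ ≤ Real.pi ^ (2 * m) * bracket k ^ (2 * m) := by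
    rw [Complex.norm_real, freq, norm_pow, Real.norm_eq_abs, abs_mul, abs_of_pos Real.pi_pos,
      mul_pow, mul_comm]
    gcongr
    unfold bracket
    linarith
  have h3 := norm_sub_le z (freq m k : ℂ)
  nlinarith [norm_nonneg z]

/-- With g_k = |z-(kπ)^{2m}| and w = g^{1/2}u, the eigenvalue equation says |w_k| = |(Kw)_k| for the
matrix K of V in these weights. Comparing moduli avoids a square root of the complex number
z-(kπ)^{2m}. As ‖K‖ < 1, w vanishes. -/
lemma eq_zero_of_shifted_eq_zero {m : ℕ} (hm : 1 ≤ m) (V : HPlus (-(m : ℝ))) {z : ℂ}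
    (hz : ∀ k : OddInt, 0 < ‖z - (freq m k : ℂ)‖)
    (hs : Summable fun p : OddInt × OddInt =>
      ‖mulMatrix V.1 (fun k => ‖z - (freq m k : ℂ)‖) p.1 p.2‖ ^ 2)
    (hlt : ∑' p : OddInt × OddInt,
      ‖mulMatrix V.1 (fun k => ‖z - (freq m k : ℂ)‖) p.1 p.2‖ ^ 2 < 1)
    {u : (opL m hm V).domain} (hu : shifted (opL m hm V) z u = 0) : u = 0 := by
  set g : OddInt → ℝ := fun k => ‖z - (freq m k : ℂ)‖ with hg
  set x : ℤ → ℂ := (u : HMinus (-(m : ℝ))).1 with hx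
  have hxm : x ∈ HMinus (m : ℝ) := u.2
  have hx' : x = oddExt fun k => x k := eq_oddExt (u : HMinus (-(m : ℝ)))
  have hsq : ∀ k a, ‖(Real.sqrt (g k) : ℂ) * a‖ ^ 2 = g k * ‖a‖ ^ 2 := fun k a => by
    rw [norm_mul, mul_pow, Complex.norm_real, Real.norm_of_nonneg (Real.sqrt_nonneg _),
      Real.sq_sqrt (hz k).le]
  have hxs : Summable fun k : OddInt => bracket k ^ (2 * (m : ℝ)) * ‖x k‖ ^ 2 :=
    oddExt_mem_iff.1 (hx' ▸ hxm)
  let w : Ell OddInt := ⟨fun k => Real.sqrt (g k) * x k, Ell.memℓp_iff.2 <|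
    Summable.of_nonneg_of_le (fun _ => sq_nonneg _) (fun k => by
      rw [hsq, bracket_rpow_nat, ← mul_assoc]
      exact mul_le_mul_of_nonneg_right (norm_sub_freq_le m z k) (sq_nonneg _))
      (hxs.mul_left (‖z‖ + Real.pi ^ (2 * m)))⟩
  have hw : ∀ k, w k = Real.sqrt (g k) * x k := fun k => rfl
  have hne : ∀ k, (Real.sqrt (g k) : ℂ) ≠ 0 := fun k => by
    exact_mod_cast (Real.sqrt_pos.2 (hz k)).ne'
  have hmul : ∀ k : OddInt, fourierMul V.1 x k = Real.sqrt (g k) * Ell.hsOp hs w k := by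
    intro k
    rw [Ell.hsOp_apply, ← tsum_mul_left, fourierMul,
      ← Function.Injective.tsum_eq (f := fun j : ℤ => V.1 (k - j) * x j)
        (g := ((↑) : OddInt → ℤ)) Subtype.val_injective]
    · refine tsum_congr fun j => ?_
      rw [mulMatrix, hw]
      have h1 := hne k
      have h2 := hne j
      field_simp
    · intro j hj
      by_contra h
      rw [Function.mem_support, hx', oddExt_of_even _ (notMem_range_coe_oddInt h), mul_zero] at hj
      exact hj rfl
  have heq : ∀ k : OddInt, ‖w k‖ = ‖Ell.hsOp hs w k‖ := by
    intro k
    have h1 : (freq m k : ℂ) * x k + fourierMul V.1 x k - z * x k = 0 := by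
      have h0 : (shifted (opL m hm V) z u).1 k = 0 := by rw [hu]; rfl
      rw [← h0]
      change _ = (((k : ℤ) : ℝ) * Real.pi : ℝ) ^ (2 * m) * x k + fourierMul V.1 x k - z * x k
      rw [freq]
      push_cast
      ring
    have h2 : (z - (freq m k : ℂ)) * x k = Real.sqrt (g k) * Ell.hsOp hs w k := by
      rw [← hmul]; linear_combination -h1
    have h3 := congrArg norm h2
    rw [norm_mul, norm_mul, Complex.norm_real, Real.norm_of_nonneg (Real.sqrt_nonneg _)] at h3
    have h4 : ‖w k‖ = Real.sqrt (g k) * ‖x k‖ := by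
      rw [hw, norm_mul, Complex.norm_real, Real.norm_of_nonneg (Real.sqrt_nonneg _)]
    have h5 : Real.sqrt (g k) * Real.sqrt (g k) = ‖z - (freq m k : ℂ)‖ :=
      Real.mul_self_sqrt (hz k).le
    rw [← h5, mul_assoc] at h3
    rw [h4]
    exact mul_left_cancel₀ (Real.sqrt_pos.2 (hz k)).ne' h3
  have hle : ‖w‖ ≤ ‖Ell.hsOp hs‖ * ‖w‖ :=
    (Ell.norm_le_of_forall_le fun k => (heq k).le).trans ((Ell.hsOp hs).le_opNorm w)
  have hK : ‖Ell.hsOp hs‖ < 1 := by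
    refine (Ell.norm_hsOp_le hs).trans_lt ?_
    rw [Real.sqrt_lt' one_pos]
    simpa using hlt
  have hw0 : w = 0 := by
    have := norm_nonneg w
    refine norm_eq_zero.1 (le_antisymm ?_ this)
    by_contra! h
    nlinarith
  refine Subtype.ext (Subtype.ext ?_)
  change x = 0
  rw [hx']
  funext k
  have : ∀ k : OddInt, x k = 0 := fun k => by
    have h1 : w k = 0 := by rw [hw0]; rfl
    rw [hw] at h1
    exact (mul_eq_zero.1 h1).resolve_left (hne k)
  unfold oddExt
  split_ifs with h
  · exact this ⟨k, h⟩
  · rfl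

/-! ### Hilbert–Schmidt sums in [0,∞] and the test along diagonals. -/

open scoped ENNReal

/-- The squared Hilbert–Schmidt norm of the multiplication by `v` in the weighted spaces. -/
noncomputable def hsSum (v : ℤ → ℂ) (g : ℤ → ℝ) : ℝ≥0∞ :=
  ∑' p : OddInt × OddInt, ENNReal.ofReal (‖mulMatrix v (fun k => g k) p.1 p.2‖ ^ 2)

lemma summable_of_hsSum_le {v : ℤ → ℂ} {g : ℤ → ℝ} {x : ℝ} (hx : 0 ≤ x)
    (h : hsSum v g ≤ ENNReal.ofReal x) :
    Summable (fun p : OddInt × OddInt => ‖mulMatrix v (fun k => g k) p.1 p.2‖ ^ 2) ∧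
      ∑' p : OddInt × OddInt, ‖mulMatrix v (fun k => g k) p.1 p.2‖ ^ 2 ≤ x := by
  have hs : Summable (fun p : OddInt × OddInt => ‖mulMatrix v (fun k => g k) p.1 p.2‖ ^ 2) := by
    have h1 : hsSum v g ≠ ⊤ := (h.trans_lt ENNReal.ofReal_lt_top).ne
    have h2 := ENNReal.summable_toReal h1
    exact h2.congr fun p => ENNReal.toReal_ofReal (sq_nonneg _)
  refine ⟨hs, ?_⟩
  rw [hsSum, ← ENNReal.ofReal_tsum_of_nonneg (fun _ => sq_nonneg _) hs] at h
  exact (ENNReal.ofReal_le_ofReal_iff hx).1 h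

lemma hsSum_add_le (v w : ℤ → ℂ) (g : ℤ → ℝ) :
    hsSum (v + w) g ≤ 2 * hsSum v g + 2 * hsSum w g := by
  rw [hsSum, hsSum, hsSum, ← ENNReal.tsum_mul_left, ← ENNReal.tsum_mul_left, ← ENNReal.tsum_add]
  refine ENNReal.tsum_le_tsum fun p => ?_
  have e2 : (2 : ℝ≥0∞) = ENNReal.ofReal 2 := by simp
  rw [e2, ← ENNReal.ofReal_mul (by norm_num), ← ENNReal.ofReal_mul (by norm_num),
    ← ENNReal.ofReal_add (by positivity) (by positivity)]
  refine ENNReal.ofReal_le_ofReal ?_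
  have h1 : mulMatrix (v + w) (fun k => g k) p.1 p.2
      = mulMatrix v (fun k => g k) p.1 p.2 + mulMatrix w (fun k => g k) p.1 p.2 := by
    simp only [mulMatrix, Pi.add_apply, add_mul]
  rw [h1]
  have h2 := norm_add_le (mulMatrix v (fun k => g k) p.1 p.2)
    (mulMatrix w (fun k => g k) p.1 p.2)
  have h3 := norm_nonneg (mulMatrix v (fun k => g k) p.1 p.2
    + mulMatrix w (fun k => g k) p.1 p.2)
  nlinarith [sq_nonneg (‖mulMatrix v (fun k => g k) p.1 p.2‖
    - ‖mulMatrix w (fun k => g k) p.1 p.2‖)]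

open scoped Classical in
/-- Schur-type test: it suffices to bound the sums along the diagonals. -/
lemma hsSum_le {v : ℤ → ℂ} {g : ℤ → ℝ} (hg : ∀ k, Odd k → 0 < g k) {s B : ℝ}
    (hv : v ∈ sobolevSeq s) (hB0 : 0 ≤ B)
    (hB : ∀ l : ℤ, ∑' k : ℤ, (if Odd k ∧ Odd (k - l) then
      ENNReal.ofReal (1 / (g k * g (k - l))) else 0) ≤ ENNReal.ofReal (B * bracket l ^ (2 * s))) :
    hsSum v g ≤ ENNReal.ofReal (B * sobolevNorm s v ^ 2) := by
  let F : ℤ → ℤ → ℝ≥0∞ := fun l k => if Odd k ∧ Odd (k - l) then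
    ENNReal.ofReal (1 / (g k * g (k - l))) else 0
  have h1 : hsSum v g ≤ ∑' k : ℤ, ∑' l : ℤ, ENNReal.ofReal (‖v l‖ ^ 2) * F l k := by
    rw [hsSum, ENNReal.tsum_prod (f := fun k j : OddInt =>
      ENNReal.ofReal (‖mulMatrix v (fun k => g k) k j‖ ^ 2))]
    calc ∑' k : OddInt, ∑' j : OddInt,
          ENNReal.ofReal (‖mulMatrix v (fun k => g k) k j‖ ^ 2)
        ≤ ∑' k : OddInt, ∑' l : ℤ, ENNReal.ofReal (‖v l‖ ^ 2) * F l k := by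
          refine ENNReal.tsum_le_tsum fun k => ?_
          have hinj : Function.Injective fun j : OddInt => (k : ℤ) - j := fun i j hij =>
            Subtype.ext (by simpa using hij)
          refine le_trans (le_of_eq (tsum_congr fun j => ?_)) (ENNReal.tsum_comp_le_tsum_of_injective
            hinj fun l => ENNReal.ofReal (‖v l‖ ^ 2) * F l k)
          rw [norm_mulMatrix_sq (fun k => hg k k.2), ENNReal.ofReal_mul (sq_nonneg _)]
          simp only [F, sub_sub_cancel, k.2, j.2, and_self, if_true]
      _ ≤ _ := ENNReal.tsum_comp_le_tsum_of_injective Subtype.val_injective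
          fun k => ∑' l : ℤ, ENNReal.ofReal (‖v l‖ ^ 2) * F l k
  have hs : Summable fun l : ℤ => B * (bracket l ^ (2 * s) * ‖v l‖ ^ 2) :=
    Summable.mul_left B hv
  have h0 : ∀ l : ℤ, 0 ≤ bracket l ^ (2 * s) := fun l => Real.rpow_nonneg (bracket_pos l).le _
  refine h1.trans ?_
  -- Interchanging the sums over k and l needs no summability in [0,∞]; for fixed l the factor
  -- |v_l|² then comes out.
  rw [ENNReal.tsum_comm, sobolevNorm_sq, ← tsum_mul_left, ENNReal.ofReal_tsum_of_nonneg
    (fun l => mul_nonneg hB0 (mul_nonneg (h0 l) (sq_nonneg _))) hs]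
  refine ENNReal.tsum_le_tsum fun l => ?_
  rw [ENNReal.tsum_mul_left]
  calc _ ≤ ENNReal.ofReal (‖v l‖ ^ 2) * ENNReal.ofReal (B * bracket l ^ (2 * s)) := by
        gcongr; exact hB l
    _ = _ := by
      rw [← ENNReal.ofReal_mul (sq_nonneg _)]
      congr 1
      ring

open scoped Classical in
/-- The diagonal sums are bounded by a summable majorant. -/
lemma tsum_diagonal_le {g : ℤ → ℝ} {s B : ℝ} {l : ℤ} {P : ℤ → ℝ} {x : ℝ} (hP0 : ∀ k, 0 ≤ P k)
    (hP : HasSum P x) (hx : x ≤ B)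
    (h : ∀ k, Odd k → Odd (k - l) → bracket l ^ (-(2 * s)) * (1 / (g k * g (k - l))) ≤ P k) :
    ∑' k : ℤ, (if Odd k ∧ Odd (k - l) then
      ENNReal.ofReal (1 / (g k * g (k - l))) else 0) ≤ ENNReal.ofReal (B * bracket l ^ (2 * s)) := by
  have hb : 0 < bracket l ^ (2 * s) := Real.rpow_pos_of_pos (bracket_pos l) _
  have hP' := hP.mul_right (bracket l ^ (2 * s))
  calc _ ≤ ∑' k : ℤ, ENNReal.ofReal (P k * bracket l ^ (2 * s)) := by
        refine ENNReal.tsum_le_tsum fun k => ?_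
        split_ifs with hk
        · refine ENNReal.ofReal_le_ofReal ?_
          have h1 := h k hk.1 hk.2
          rw [Real.rpow_neg (bracket_pos l).le, inv_mul_le_iff₀ hb] at h1
          linarith
        · exact zero_le
    _ = ENNReal.ofReal (x * bracket l ^ (2 * s)) := by
        rw [← ENNReal.ofReal_tsum_of_nonneg (fun k => mul_nonneg (hP0 k) hb.le) hP'.summable,
          hP'.tsum_eq]
    _ ≤ _ := ENNReal.ofReal_le_ofReal (by gcongr)

/-! ### Diagonal sums near a double eigenvalue -/

lemma hasSum_int_one_div_sq : HasSum (fun i : ℤ => 1 / (i : ℝ) ^ 2) (Real.pi ^ 2 / 3) := by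
  have h := HasSum.of_nat_of_neg (f := fun i : ℤ => 1 / (i : ℝ) ^ 2) (by simpa using hasSum_zeta_two)
    (by simpa using hasSum_zeta_two)
  have e : Real.pi ^ 2 / 6 + Real.pi ^ 2 / 6 - 1 / ((0 : ℤ) : ℝ) ^ 2 = Real.pi ^ 2 / 3 := by
    norm_num
    ring
  exact e ▸ h

lemma pi_sq_div_three_le : Real.pi ^ 2 / 3 ≤ 4 := by
  nlinarith [Real.pi_lt_d2, Real.pi_pos]

/-- Here X^{-2s} = X^{2m}X^{-2s-2m}, and the last exponent is nonpositive, so X may be replaced by N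
there. The gain N^{-2s-2m} over the critical order comes from this. -/
lemma rpow_bracket_le {m : ℕ} {s N X : ℝ} {l : ℤ} (hs : s ≤ 0) (hsm : -(m : ℝ) ≤ s) (hN : 1 ≤ N)
    (hX : N ≤ X) (hl : bracket l ≤ 3 * X) :
    bracket l ^ (-(2 * s)) ≤ 9 ^ m * X ^ (2 * m) * N ^ (-(2 * s) - 2 * m) := by
  have hX0 : 0 < X := by linarith
  have h1 : bracket l ^ (-(2 * s)) ≤ (3 * X) ^ (-(2 * s)) :=
    Real.rpow_le_rpow (bracket_pos l).le hl (by linarith)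
  have h2 : (3 : ℝ) ^ (-(2 * s)) ≤ 9 ^ m := by
    calc (3 : ℝ) ^ (-(2 * s)) ≤ 3 ^ ((2 * m : ℕ) : ℝ) :=
          Real.rpow_le_rpow_of_exponent_le (by norm_num) (by push_cast; linarith)
      _ = 9 ^ m := by rw [Real.rpow_natCast, pow_mul]; norm_num
  have h3 : X ^ (-(2 * s)) = X ^ (2 * m) * X ^ (-(2 * s) - 2 * m) := by
    rw [← Real.rpow_natCast, ← Real.rpow_add hX0]
    congr 1
    push_cast
    ring
  have h4 : X ^ (-(2 * s) - 2 * m) ≤ N ^ (-(2 * s) - 2 * m) :=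
    Real.rpow_le_rpow_of_nonpos (by linarith) hX (by linarith)
  rw [Real.mul_rpow (by norm_num) hX0.le, h3] at h1
  calc _ ≤ _ := h1
    _ ≤ 9 ^ m * (X ^ (2 * m) * N ^ (-(2 * s) - 2 * m)) := by gcongr
    _ = _ := by ring

/-- One power of X survives, and X/d ≤ (N+d)/d ≤ 2N. -/
lemma one_resonant_le {m : ℕ} (hm : 1 ≤ m) {b T N X d ρ gk gj : ℝ} (hT : 0 ≤ T) (hN : 1 ≤ N)
    (hX : N ≤ X) (hXd : X ≤ N + d) (hd : 1 ≤ d) (hρ : 0 < ρ) (hgk : ρ ≤ gk)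
    (hgj : d * X ^ (2 * m - 1) ≤ gj) (hb : b ≤ 9 ^ m * X ^ (2 * m) * T) :
    b * (1 / (gk * gj)) ≤ 9 ^ m * T * (2 * N / ρ) := by
  have hX0 : 0 < X := by linarith
  have hY : 0 < X ^ (2 * m - 1) := by positivity
  have e : X ^ (2 * m) = X ^ (2 * m - 1) * X := by rw [← pow_succ]; congr 1; omega
  have h1 : ρ * (d * X ^ (2 * m - 1)) ≤ gk * gj :=
    mul_le_mul hgk hgj (by positivity) (by linarith)
  calc b * (1 / (gk * gj)) ≤ (9 ^ m * X ^ (2 * m) * T) * (1 / (ρ * (d * X ^ (2 * m - 1)))) := by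
        refine mul_le_mul hb (one_div_le_one_div_of_le (by positivity) h1) ?_ (by positivity)
        exact one_div_nonneg.2 (le_trans (by positivity) h1)
    _ = 9 ^ m * T * ((X / d) / ρ) := by rw [e]; field_simp
    _ ≤ _ := by
        gcongr
        rw [div_le_iff₀ (by linarith)]
        nlinarith

/-- The quotient is at most X/(deY) ≤ (Y+d)/(deY) = 1/(de) + 1/(eY) ≤ 1/(de) + 1/e², and the mixed
term is split by the arithmetic-geometric inequality. -/
lemma non_resonant_le {m : ℕ} (hm : 1 ≤ m) {b T N X Y d e gk gj : ℝ} (hT : 0 ≤ T) (hN : 1 ≤ N)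
    (hY : N ≤ Y) (hYX : Y ≤ X) (hXd : X ≤ N + d) (hd : 1 ≤ d) (he : 1 ≤ e) (heY : e ≤ Y)
    (hgk : d * X ^ (2 * m - 1) ≤ gk) (hgj : e * Y ^ (2 * m - 1) ≤ gj)
    (hb : b ≤ 9 ^ m * X ^ (2 * m) * T) :
    b * (1 / (gk * gj)) ≤ 9 ^ m * T * (3 / 2 * (1 / d ^ 2 + 1 / e ^ 2)) := by
  have hY1 : 1 ≤ Y := by linarith
  have hX0 : 0 < X := by linarith
  have hXp : 0 < X ^ (2 * m - 1) := by positivity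
  have e1 : X ^ (2 * m) = X ^ (2 * m - 1) * X := by rw [← pow_succ]; congr 1; omega
  have hYp : Y ≤ Y ^ (2 * m - 1) := le_self_pow₀ hY1 (by omega)
  have hgj' : e * Y ≤ gj := le_trans (by gcongr) hgj
  have h1 : d * X ^ (2 * m - 1) * (e * Y) ≤ gk * gj :=
    mul_le_mul hgk hgj' (by positivity) (le_trans (by positivity) hgk)
  calc b * (1 / (gk * gj))
      ≤ (9 ^ m * X ^ (2 * m) * T) * (1 / (d * X ^ (2 * m - 1) * (e * Y))) := by
        refine mul_le_mul hb (one_div_le_one_div_of_le (by positivity) h1) ?_ (by positivity)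
        exact one_div_nonneg.2 (le_trans (by positivity) h1)
    _ = 9 ^ m * T * (X / (d * (e * Y))) := by rw [e1]; field_simp
    _ ≤ _ := by
        gcongr
        have h2 : X / (d * (e * Y)) ≤ (Y + d) / (d * (e * Y)) := by gcongr; linarith
        have h3 : (Y + d) / (d * (e * Y)) = 1 / d * (1 / e) + 1 / e * (1 / Y) := by
          field_simp
        have h4 : 1 / Y ≤ 1 / e := one_div_le_one_div_of_le (by linarith) heY
        have h5 : 1 / e * (1 / Y) ≤ 1 / e * (1 / e) := by gcongr
        have h6 : 1 / d ^ 2 = (1 / d) ^ 2 := by rw [div_pow, one_pow]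
        have h7 : 1 / e ^ 2 = (1 / e) ^ 2 := by rw [div_pow, one_pow]
        rw [h6, h7]
        nlinarith [sq_nonneg (1 / d - 1 / e)]

/-- The distances `g` to the frequencies have a gap around `±N`. -/
structure GapBound (m N : ℕ) (ρ : ℝ) (g : ℤ → ℝ) : Prop where
  pos : 0 < ρ
  resonant : ∀ k : ℤ, |k| = N → ρ ≤ g k
  gap : ∀ k : ℤ, Odd k → |k| ≠ N →
    |(|(k : ℝ)| - N)| * max |(k : ℝ)| N ^ (2 * m - 1) ≤ g k

lemma one_le_abs_sub {k : ℤ} {N : ℕ} (h : |k| ≠ N) : 1 ≤ |(|(k : ℝ)| - N)| := by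
  have : (1 : ℤ) ≤ |(|k| - N)| := Int.one_le_abs (sub_ne_zero.2 h)
  exact_mod_cast this

lemma GapBound.g_pos {m N : ℕ} {ρ : ℝ} {g : ℤ → ℝ} (h : GapBound m N ρ g) (hN : 1 ≤ N) {k : ℤ}
    (hk : Odd k) : 0 < g k := by
  by_cases hkN : |k| = N
  · exact h.pos.trans_le (h.resonant k hkN)
  · refine lt_of_lt_of_le ?_ (h.gap k hk hkN)
    have h1 := one_le_abs_sub hkN
    have h2 : (0 : ℝ) < max |(k : ℝ)| N := lt_max_of_lt_right (by exact_mod_cast hN)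
    positivity

lemma one_div_abs_sub_sq_le (k : ℤ) (N : ℕ) :
    1 / |(|(k : ℝ)| - N)| ^ 2 ≤ 1 / ((k - N : ℤ) : ℝ) ^ 2 + 1 / ((k + N : ℤ) : ℝ) ^ 2 := by
  rw [sq_abs]
  push_cast
  rcases le_total 0 (k : ℝ) with hk | hk
  · rw [abs_of_nonneg hk]
    have : (0 : ℝ) ≤ 1 / ((k : ℝ) + N) ^ 2 := by positivity
    linarith
  · rw [abs_of_nonpos hk]
    have h1 : (0 : ℝ) ≤ 1 / ((k : ℝ) - N) ^ 2 := by positivity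
    have h2 : (-(k : ℝ) - N) ^ 2 = ((k : ℝ) + N) ^ 2 := by ring
    rw [h2]
    linarith

lemma bracket_sub_le {k j : ℤ} {X : ℝ} (hX : 1 ≤ X) (hk : |(k : ℝ)| ≤ X) (hj : |(j : ℝ)| ≤ X) :
    bracket (k - j) ≤ 3 * X := by
  unfold bracket
  push_cast
  have := abs_sub (k : ℝ) (j : ℝ)
  linarith

/-! ### A summable majorant for each diagonal. -/

open scoped Classical in
/-- The share of the diagonal `l` of the two resonant frequencies. -/
noncomputable def resonantShare (N : ℕ) (l k : ℤ) : ℝ :=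
  if l = 0 then (if k = N then 1 / 2 else 0) + (if k = -N then 1 / 2 else 0)
  else if 0 < l then (if k = N then 1 else 0) else (if k = -N then 1 else 0)

lemma resonantShare_nonneg (N : ℕ) (l k : ℤ) : 0 ≤ resonantShare N l k := by
  unfold resonantShare
  split_ifs <;> norm_num

lemma hasSum_resonantShare (N : ℕ) (l : ℤ) : HasSum (resonantShare N l) 1 := by
  unfold resonantShare
  split_ifs
  · have h := (hasSum_ite_eq (N : ℤ) (1 / 2 : ℝ)).add (hasSum_ite_eq (-(N : ℤ)) (1 / 2 : ℝ))
    norm_num at h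
    convert h using 4
  · exact hasSum_ite_eq (N : ℤ) (1 : ℝ)
  · exact hasSum_ite_eq (-(N : ℤ)) (1 : ℝ)

open scoped Classical in
/-- The indicator of `{N, -N}`. -/
noncomputable def resonantInd (N : ℕ) (k : ℤ) : ℝ :=
  (if k = N then 1 else 0) + (if k = -N then 1 else 0)

lemma resonantInd_nonneg (N : ℕ) (k : ℤ) : 0 ≤ resonantInd N k := by
  unfold resonantInd
  split_ifs <;> norm_num

lemma hasSum_resonantInd (N : ℕ) : HasSum (resonantInd N) (1 + 1) :=
  (hasSum_ite_eq (N : ℤ) (1 : ℝ)).add (hasSum_ite_eq (-(N : ℤ)) (1 : ℝ))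

lemma one_le_resonantInd {N : ℕ} {k : ℤ} (h : |k| = N) : 1 ≤ resonantInd N k := by
  unfold resonantInd
  rcases eq_or_eq_neg_of_abs_eq h with h | h
  · rw [if_pos h]; split_ifs <;> norm_num
  · rw [if_pos h]; split_ifs <;> norm_num

/-- Inverse squared distance to `±N`. -/
noncomputable def distTerm (N : ℕ) (k : ℤ) : ℝ :=
  1 / ((k - N : ℤ) : ℝ) ^ 2 + 1 / ((k + N : ℤ) : ℝ) ^ 2

lemma distTerm_nonneg (N : ℕ) (k : ℤ) : 0 ≤ distTerm N k := by unfold distTerm; positivity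

lemma hasSum_distTerm (N : ℕ) : HasSum (distTerm N) (Real.pi ^ 2 / 3 + Real.pi ^ 2 / 3) :=
  HasSum.add (f := fun k : ℤ => 1 / ((k - N : ℤ) : ℝ) ^ 2)
    (g := fun k : ℤ => 1 / ((k + N : ℤ) : ℝ) ^ 2)
    (((Equiv.subRight (N : ℤ)).hasSum_iff (f := fun i : ℤ => 1 / (i : ℝ) ^ 2)).2
      hasSum_int_one_div_sq)
    (((Equiv.addRight (N : ℤ)).hasSum_iff (f := fun i : ℤ => 1 / (i : ℝ) ^ 2)).2
      hasSum_int_one_div_sq)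

/-- The majorant of the diagonal `l`. -/
noncomputable def diagonalMajorant (m N : ℕ) (ρ T : ℝ) (l k : ℤ) : ℝ :=
  9 ^ m * T * (N ^ (2 * m) / ρ ^ 2) * resonantShare N l k
    + 9 ^ m * T * (2 * N / ρ) * (resonantInd N k + resonantInd N (k - l))
    + 9 ^ m * T * (3 / 2) * (distTerm N k + distTerm N (k - l))

lemma hasSum_diagonalMajorant (m N : ℕ) (ρ T : ℝ) (l : ℤ) :
    HasSum (diagonalMajorant m N ρ T l) (9 ^ m * T * (N ^ (2 * m) / ρ ^ 2) * 1
      + 9 ^ m * T * (2 * N / ρ) * (1 + 1 + (1 + 1))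
      + 9 ^ m * T * (3 / 2) * (Real.pi ^ 2 / 3 + Real.pi ^ 2 / 3
        + (Real.pi ^ 2 / 3 + Real.pi ^ 2 / 3))) :=
  (((hasSum_resonantShare N l).mul_left _).add (((hasSum_resonantInd N).add
    ((Equiv.subRight l).hasSum_iff.2 (hasSum_resonantInd N))).mul_left _)).add
    (((hasSum_distTerm N).add
      ((Equiv.subRight l).hasSum_iff.2 (hasSum_distTerm N))).mul_left _)

/-- The three summands of the majorant answer the cases in which two, one or none of k and k-l equal
±N. For two, `resonantShare` has total mass 1 on every diagonal; mass 2 would double the leading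
term N^{2m}/ρ² and so enlarge the admissible radius by √2. -/
lemma GapBound.le_diagonalMajorant {m N : ℕ} (hm : 1 ≤ m) (hN : 1 ≤ N) {ρ : ℝ} {g : ℤ → ℝ}
    (h : GapBound m N ρ g) {s : ℝ} (hs : s ≤ 0) (hsm : -(m : ℝ) ≤ s) {l k : ℤ} (hk : Odd k)
    (hj : Odd (k - l)) :
    bracket l ^ (-(2 * s)) * (1 / (g k * g (k - l)))
      ≤ diagonalMajorant m N ρ ((N : ℝ) ^ (-(2 * s) - 2 * m)) l k := by
  have hN' : (1 : ℝ) ≤ N := by exact_mod_cast hN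
  set T : ℝ := (N : ℝ) ^ (-(2 * s) - 2 * m) with hT
  have hT0 : 0 ≤ T := Real.rpow_nonneg (by linarith) _
  have hρ := h.pos
  have hgk := h.g_pos hN hk
  have hgj := h.g_pos hN hj
  set j := k - l with hjdef
  have hl : l = k - j := by rw [hjdef]; ring
  have n1 : 0 ≤ 9 ^ m * T * (N ^ (2 * m) / ρ ^ 2) * resonantShare N l k :=
    mul_nonneg (by positivity) (resonantShare_nonneg _ _ _)
  have n2 : 0 ≤ 9 ^ m * T * (2 * N / ρ) := by positivity
  have n3 : 0 ≤ 9 ^ m * T * (3 / 2) * (distTerm N k + distTerm N j) :=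
    mul_nonneg (by positivity) (add_nonneg (distTerm_nonneg _ _) (distTerm_nonneg _ _))
  have i1 := resonantInd_nonneg N k
  have i2 := resonantInd_nonneg N j
  have hXd : ∀ k : ℤ, max |(k : ℝ)| N ≤ N + |(|(k : ℝ)| - N)| := by
    intro k
    refine max_le ?_ (by linarith [abs_nonneg (|(k : ℝ)| - N)])
    linarith [le_abs_self (|(k : ℝ)| - N)]
  have hdX : ∀ k : ℤ, |(|(k : ℝ)| - N)| ≤ max |(k : ℝ)| N := by
    intro k
    refine abs_le.2 ⟨?_, ?_⟩
    · have := le_max_right |(k : ℝ)| (N : ℝ)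
      have := abs_nonneg (k : ℝ)
      linarith
    · have := le_max_left |(k : ℝ)| (N : ℝ)
      linarith
  unfold diagonalMajorant
  rw [← hjdef]
  by_cases hkN : |k| = N <;> by_cases hjN : |j| = N
  · -- both resonant
    have hρg : ρ ^ 2 ≤ g k * g j := by
      rw [sq]; exact mul_le_mul (h.resonant k hkN) (h.resonant j hjN) hρ.le hgk.le
    have hNT : (N : ℝ) ^ (2 * m) * T = (N : ℝ) ^ (-(2 * s)) := by
      rw [hT, ← Real.rpow_natCast, ← Real.rpow_add (by linarith)]
      congr 1
      push_cast
      ring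
    have hmain : bracket l ^ (-(2 * s)) ≤ 9 ^ m * T * N ^ (2 * m) * resonantShare N l k := by
      -- On the main diagonal both k = N and k = -N occur, but ⟨0⟩ = 1, so half of 9^m is enough for
      -- each.
      by_cases hl0 : l = 0
      · have h1 : resonantShare N l k = 1 / 2 * resonantInd N k := by
          unfold resonantShare resonantInd
          rw [if_pos hl0, mul_add]
          simp only [mul_ite, mul_one, mul_zero]
        have h2 := one_le_resonantInd hkN
        have h3 : (1 : ℝ) ≤ (N : ℝ) ^ (-(2 * s)) := Real.one_le_rpow hN' (by linarith)
        have h4 : (9 : ℝ) ≤ 9 ^ m := le_self_pow₀ (by norm_num) (by omega)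
        have h5 : bracket l = 1 := by rw [hl0]; simp [bracket]
        rw [h5, Real.one_rpow, h1]
        have h6 : 9 ^ m * T * (N : ℝ) ^ (2 * m) = 9 ^ m * (N : ℝ) ^ (-(2 * s)) := by
          rw [← hNT]; ring
        rw [h6]
        have h7 : (9 : ℝ) * 1 ≤ 9 ^ m * (N : ℝ) ^ (-(2 * s)) :=
          mul_le_mul h4 h3 (by norm_num) (by positivity)
        nlinarith
      -- Off the main diagonal l = 2N with k = N, or l = -2N with k = -N: a single k for each l,
      -- determined by the sign of l.
      · have h1 : resonantShare N l k = 1 := by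
          unfold resonantShare
          rw [if_neg hl0]
          rcases eq_or_eq_neg_of_abs_eq hkN with hk' | hk' <;>
            rcases eq_or_eq_neg_of_abs_eq hjN with hj' | hj'
          · exact absurd (by rw [hl, hk', hj', sub_self]) hl0
          · rw [if_pos (by omega), if_pos hk']
          · rw [if_neg (by omega), if_pos hk']
          · exact absurd (by rw [hl, hk', hj', sub_self]) hl0
        rw [h1, mul_one]
        have hkR : |(k : ℝ)| ≤ N := by exact_mod_cast hkN.le
        have hjR : |(j : ℝ)| ≤ N := by exact_mod_cast hjN.le
        have := rpow_bracket_le (l := l) hs hsm hN' le_rfl (hl ▸ bracket_sub_le hN' hkR hjR)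
        linarith
    have h2 : bracket l ^ (-(2 * s)) * (1 / (g k * g j))
        ≤ 9 ^ m * T * (N ^ (2 * m) / ρ ^ 2) * resonantShare N l k := by
      calc _ ≤ (9 ^ m * T * N ^ (2 * m) * resonantShare N l k) * (1 / ρ ^ 2) := by
            refine mul_le_mul hmain (one_div_le_one_div_of_le (by positivity) hρg) (by positivity) ?_
            exact mul_nonneg (by positivity) (resonantShare_nonneg _ _ _)
        _ = _ := by ring
    nlinarith
  · -- only `k` resonant
    have hkR : |(k : ℝ)| ≤ max |(j : ℝ)| N := le_max_of_le_right (by exact_mod_cast hkN.le)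
    have hX1 : (1 : ℝ) ≤ max |(j : ℝ)| N := le_max_of_le_right hN'
    have hb := rpow_bracket_le (l := l) hs hsm hN' (le_max_right |(j : ℝ)| (N : ℝ))
      (hl ▸ bracket_sub_le hX1 hkR (le_max_left _ _))
    have h1 := one_resonant_le hm hT0 hN' (le_max_right |(j : ℝ)| (N : ℝ)) (hXd j)
      (one_le_abs_sub hjN) hρ (h.resonant k hkN) (h.gap j hj hjN) hb
    have h2 := one_le_resonantInd hkN
    nlinarith
  · -- only `j` resonant
    have hjR : |(j : ℝ)| ≤ max |(k : ℝ)| N := le_max_of_le_right (by exact_mod_cast hjN.le)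
    have hX1 : (1 : ℝ) ≤ max |(k : ℝ)| N := le_max_of_le_right hN'
    have hb := rpow_bracket_le (l := l) hs hsm hN' (le_max_right |(k : ℝ)| (N : ℝ))
      (hl ▸ bracket_sub_le hX1 (le_max_left _ _) hjR)
    have h1 := one_resonant_le hm hT0 hN' (le_max_right |(k : ℝ)| (N : ℝ)) (hXd k)
      (one_le_abs_sub hkN) hρ (h.resonant j hjN) (h.gap k hk hkN) hb
    have h2 := one_le_resonantInd hjN
    rw [mul_comm (g j)] at h1
    nlinarith
  · -- none resonant
    have hd : 1 / |(|(k : ℝ)| - N)| ^ 2 + 1 / |(|(j : ℝ)| - N)| ^ 2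
        ≤ distTerm N k + distTerm N j :=
      add_le_add (one_div_abs_sub_sq_le k N) (one_div_abs_sub_sq_le j N)
    have h0 : 0 ≤ 9 ^ m * T * (3 / 2) := by positivity
    have h3 := mul_le_mul_of_nonneg_left hd h0
    have h4 := mul_nonneg n2 (add_nonneg i1 i2)
    rcases le_total (max |(j : ℝ)| (N : ℝ)) (max |(k : ℝ)| N) with hjk | hkj
    · have hX1 : (1 : ℝ) ≤ max |(k : ℝ)| N := le_max_of_le_right hN'
      have hb := rpow_bracket_le (l := l) hs hsm hN' (le_max_right |(k : ℝ)| (N : ℝ))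
        (hl ▸ bracket_sub_le hX1 (le_max_left _ _) ((le_max_left _ _).trans hjk))
      have h1 := non_resonant_le hm hT0 hN' (le_max_right |(j : ℝ)| (N : ℝ)) hjk (hXd k)
        (one_le_abs_sub hkN) (one_le_abs_sub hjN) (hdX j) (h.gap k hk hkN) (h.gap j hj hjN) hb
      linarith
    · have hX1 : (1 : ℝ) ≤ max |(j : ℝ)| N := le_max_of_le_right hN'
      have hb := rpow_bracket_le (l := l) hs hsm hN' (le_max_right |(j : ℝ)| (N : ℝ))
        (hl ▸ bracket_sub_le hX1 ((le_max_left _ _).trans hkj) (le_max_left _ _))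
      have h1 := non_resonant_le hm hT0 hN' (le_max_right |(k : ℝ)| (N : ℝ)) hkj (hXd j)
        (one_le_abs_sub hjN) (one_le_abs_sub hkN) (hdX k) (h.gap j hj hjN) (h.gap k hk hkN) hb
      rw [mul_comm (g j)] at h1
      linarith

/-- The Hilbert–Schmidt bound near a double eigenvalue. -/
theorem GapBound.hsSum_le {m N : ℕ} (hm : 1 ≤ m) (hN : 1 ≤ N) {ρ : ℝ} {g : ℤ → ℝ}
    (h : GapBound m N ρ g) {s : ℝ} (hs : s ≤ 0) (hsm : -(m : ℝ) ≤ s) {v : ℤ → ℂ}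
    (hv : v ∈ sobolevSeq s) :
    hsSum v g ≤ ENNReal.ofReal (9 ^ m * (N : ℝ) ^ (-(2 * s) - 2 * m) *
      (N ^ (2 * m) / ρ ^ 2 + 8 * N / ρ + 24) * sobolevNorm s v ^ 2) := by
  have hρ := h.pos
  have hT0 : 0 ≤ (N : ℝ) ^ (-(2 * s) - 2 * m) := Real.rpow_nonneg N.cast_nonneg _
  refine _root_.hsSum_le (fun k hk => h.g_pos hN hk) hv (by positivity) fun l => ?_
  refine tsum_diagonal_le (fun k => ?_) (hasSum_diagonalMajorant m N ρ _ l) ?_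
    (fun k hk hj => h.le_diagonalMajorant hm hN hs hsm hk hj)
  · unfold diagonalMajorant
    have := resonantShare_nonneg N l k
    have := resonantInd_nonneg N k
    have := resonantInd_nonneg N (k - l)
    have := distTerm_nonneg N k
    have := distTerm_nonneg N (k - l)
    positivity
  · have h1 := pi_sq_div_three_le
    have h2 : 0 ≤ 9 ^ m * (N : ℝ) ^ (-(2 * s) - 2 * m) := by positivity
    have h3 : 3 / 2 * (Real.pi ^ 2 / 3 + Real.pi ^ 2 / 3
        + (Real.pi ^ 2 / 3 + Real.pi ^ 2 / 3)) ≤ 24 := by linarith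
    have h4 := mul_le_mul_of_nonneg_left h3 h2
    calc _ = 9 ^ m * (N : ℝ) ^ (-(2 * s) - 2 * m) * (N ^ (2 * m) / ρ ^ 2 + 8 * N / ρ)
          + 9 ^ m * (N : ℝ) ^ (-(2 * s) - 2 * m) * (3 / 2 * (Real.pi ^ 2 / 3 + Real.pi ^ 2 / 3
        + (Real.pi ^ 2 / 3 + Real.pi ^ 2 / 3))) := by ring
      _ ≤ _ := by linarith

/-! ### Outside the cone -/

lemma mul_rpow_three_halves_le {a t : ℝ} (ha : 0 ≤ a) (ht : 0 ≤ t) :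
    t * a ^ (3 / 2 : ℝ) ≤ a ^ 2 + t ^ 4 := by
  have h1 : a ^ (3 / 2 : ℝ) = Real.sqrt a ^ 3 := by
    rw [Real.sqrt_eq_rpow, ← Real.rpow_natCast, ← Real.rpow_mul ha]
    norm_num
  have h2 : a ^ 2 = Real.sqrt a ^ 4 := by
    have := Real.sq_sqrt ha
    calc a ^ 2 = (Real.sqrt a ^ 2) ^ 2 := by rw [this]
      _ = _ := by ring
  rw [h1, h2]
  set q := Real.sqrt a with hq
  have hq0 : 0 ≤ q := Real.sqrt_nonneg a
  rcases le_total q t with h | h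
  · have h3 : q ^ 3 ≤ t ^ 3 := by gcongr
    nlinarith [mul_le_mul_of_nonneg_left h3 ht, pow_nonneg hq0 4]
  · nlinarith [mul_le_mul_of_nonneg_right h (pow_nonneg hq0 3), pow_nonneg ht 4]

lemma freq_eq (m : ℕ) (k : ℤ) : freq m k = |(k : ℝ)| ^ (2 * m) * Real.pi ^ (2 * m) := by
  rw [freq, mul_pow, pow_mul (k : ℝ), pow_mul |(k : ℝ)|, sq_abs]

lemma one_le_abs_of_odd {k : ℤ} (hk : Odd k) : (1 : ℝ) ≤ |(k : ℝ)| := by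
  have h : (1 : ℤ) ≤ |k| := Int.one_le_abs (by rintro rfl; simp at hk)
  exact_mod_cast h

lemma abs_pow_le_freq (m : ℕ) (k : ℤ) : |(k : ℝ)| ^ (2 * m) ≤ freq m k := by
  rw [freq_eq]
  exact le_mul_of_one_le_right (by positivity) (one_le_pow₀ (by linarith [Real.pi_gt_three]))

/-- For a = x - Re z and b = |Im z| one has a + b > x + M, while a² + b² ≥ (a+b)²/2. -/
lemma half_add_le_norm_sub {z : ℂ} {M x : ℝ} (hM : 0 ≤ M) (hx : 0 ≤ x) (hz : z.re < |z.im| - M) :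
    (x + M) / 2 ≤ ‖z - (x : ℂ)‖ := by
  refine (sq_le_sq₀ (by positivity) (norm_nonneg _)).1 ?_
  have h1 : ‖z - (x : ℂ)‖ ^ 2 = (z.re - x) ^ 2 + |z.im| ^ 2 := by
    rw [Complex.sq_norm, Complex.normSq_apply, sq_abs]
    simp
    ring
  rw [h1]
  nlinarith [sq_nonneg (z.re - x + |z.im|), sq_nonneg (x + M)]

/-- The weight ⟨l⟩^{2m} is absorbed by the larger frequency, as |k|^{2m} ≤ 2|z-(kπ)^{2m}|. The other
factor keeps half of k² + t⁴ ≥ t|k|^{3/2}: the power -3/2 is summable and 1/t makes it small. -/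
lemma cone_term_le {m : ℕ} (hm : 1 ≤ m) {t : ℝ} (ht : 1 ≤ t) {z : ℂ}
    (hz : z.re < |z.im| - t ^ 4) {l k : ℤ} (hk : Odd k) (hj : Odd (k - l)) :
    bracket l ^ (-(2 * (-(m : ℝ)))) *
        (1 / (‖z - (freq m k : ℂ)‖ * ‖z - (freq m (k - l) : ℂ)‖))
      ≤ 4 * 9 ^ m / t * (|(k : ℝ)| ^ (-(3 / 2) : ℝ) + |((k - l : ℤ) : ℝ)| ^ (-(3 / 2) : ℝ)) := by
  set j := k - l with hjdef
  have hl : l = k - j := by rw [hjdef]; ring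
  have key : ∀ k : ℤ, Odd k → 0 < ‖z - (freq m k : ℂ)‖ ∧
      |(k : ℝ)| ^ (2 * m) / ‖z - (freq m k : ℂ)‖ ≤ 2 ∧
      1 / ‖z - (freq m k : ℂ)‖ ≤ 2 / t * |(k : ℝ)| ^ (-(3 / 2) : ℝ) := by
    intro k hk
    have h1 := one_le_abs_of_odd hk
    have h2 := abs_pow_le_freq m k
    have h3 : |(k : ℝ)| ^ 2 ≤ |(k : ℝ)| ^ (2 * m) := pow_le_pow_right₀ h1 (by omega)
    have h4 := half_add_le_norm_sub (x := freq m k) (by positivity : (0 : ℝ) ≤ t ^ 4)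
      (le_trans (by positivity) h2) hz
    have h5 := mul_rpow_three_halves_le (abs_nonneg (k : ℝ)) (by linarith : (0 : ℝ) ≤ t)
    have h6 : 0 < |(k : ℝ)| ^ (3 / 2 : ℝ) := Real.rpow_pos_of_pos (by linarith) _
    have h7 : 0 < t := by linarith
    have h8 : t * |(k : ℝ)| ^ (3 / 2 : ℝ) / 2 ≤ ‖z - (freq m k : ℂ)‖ := by linarith
    have h9 : 0 < ‖z - (freq m k : ℂ)‖ := lt_of_lt_of_le (by positivity) h8
    have h10 : (0 : ℝ) < t ^ 4 := by positivity
    refine ⟨h9, ?_, ?_⟩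
    · rw [div_le_iff₀ h9]
      linarith
    · rw [Real.rpow_neg (by linarith)]
      calc _ ≤ 1 / (t * |(k : ℝ)| ^ (3 / 2 : ℝ) / 2) := one_div_le_one_div_of_le (by positivity) h8
        _ = _ := by field_simp
  obtain ⟨pk, ak, bk⟩ := key k hk
  obtain ⟨pj, aj, bj⟩ := key j hj
  set gk := ‖z - (freq m k : ℂ)‖
  set gj := ‖z - (freq m j : ℂ)‖
  have hmax : (1 : ℝ) ≤ max |(k : ℝ)| |(j : ℝ)| := le_max_of_le_left (one_le_abs_of_odd hk)
  have hb := rpow_bracket_le (m := m) (s := -(m : ℝ)) (l := l) (by simp) le_rfl le_rfl hmax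
    (hl ▸ bracket_sub_le hmax (le_max_left _ _) (le_max_right _ _))
  rw [Real.one_rpow, mul_one] at hb
  have hmax2 : max |(k : ℝ)| |(j : ℝ)| ^ (2 * m) ≤ |(k : ℝ)| ^ (2 * m) + |(j : ℝ)| ^ (2 * m) := by
    have h1 : 0 ≤ |(k : ℝ)| ^ (2 * m) := by positivity
    have h2 : 0 ≤ |(j : ℝ)| ^ (2 * m) := by positivity
    rcases max_choice |(k : ℝ)| |(j : ℝ)| with h | h <;> rw [h] <;> linarith
  have h9 : (0 : ℝ) < 9 ^ m := by positivity
  calc _ ≤ (9 ^ m * (|(k : ℝ)| ^ (2 * m) + |(j : ℝ)| ^ (2 * m))) * (1 / (gk * gj)) := by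
        gcongr
        exact hb.trans (by gcongr)
    _ = 9 ^ m * (|(k : ℝ)| ^ (2 * m) / gk * (1 / gj) + |(j : ℝ)| ^ (2 * m) / gj * (1 / gk)) := by
        field_simp
    _ ≤ 9 ^ m * (2 * (2 / t * |(j : ℝ)| ^ (-(3 / 2) : ℝ))
        + 2 * (2 / t * |(k : ℝ)| ^ (-(3 / 2) : ℝ))) := by gcongr
    _ = _ := by ring

/-- Outside a sufficiently large cone the Hilbert–Schmidt sums are small, uniformly on bounded
sets of potentials of order `-m`. -/
theorem exists_cone {m : ℕ} (hm : 1 ≤ m) (R : ℝ) :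
    ∃ M : ℝ, 1 ≤ M ∧ ∀ v ∈ sobolevSeq (-(m : ℝ)), sobolevNorm (-(m : ℝ)) v ≤ R →
      ∀ z : ℂ, z.re < |z.im| - M →
        (∀ k : ℤ, 0 < ‖z - (freq m k : ℂ)‖) ∧
        hsSum v (fun k => ‖z - (freq m k : ℂ)‖) ≤ ENNReal.ofReal (1 / 2) := by
  have hS : Summable fun k : ℤ => |(k : ℝ)| ^ (-(3 / 2) : ℝ) :=
    Real.summable_abs_int_rpow (by norm_num)
  set S := ∑' k : ℤ, |(k : ℝ)| ^ (-(3 / 2) : ℝ) with hSdef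
  have hS0 : 0 ≤ S := tsum_nonneg fun k => Real.rpow_nonneg (abs_nonneg _) _
  -- Chosen so that the total 8·9^m S R²/t is at most 1/2; the cone parameter is M = t⁴.
  set t : ℝ := 1 + 16 * 9 ^ m * S * R ^ 2 with ht
  have ht1 : 1 ≤ t := by
    have : 0 ≤ 16 * 9 ^ m * S * R ^ 2 := by positivity
    linarith
  have ht0 : 0 < t := by linarith
  have hpos : ∀ z : ℂ, z.re < |z.im| - t ^ 4 → ∀ k : ℤ, 0 < ‖z - (freq m k : ℂ)‖ := by
    intro z hz k
    have h1 : 0 ≤ freq m k := le_trans (by positivity) (abs_pow_le_freq m k)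
    have h2 : 0 < t ^ 4 := by positivity
    exact lt_of_lt_of_le (by linarith) (half_add_le_norm_sub h2.le h1 hz)
  refine ⟨t ^ 4, one_le_pow₀ ht1, fun v hv hvR z hz => ⟨hpos z hz, ?_⟩⟩
  refine (hsSum_le (B := 4 * 9 ^ m / t * (S + S)) (fun k _ => hpos z hz k) hv (by positivity)
    fun l => ?_).trans ?_
  · refine tsum_diagonal_le (fun k => ?_) ((hS.hasSum.add
      ((Equiv.subRight l).hasSum_iff (f := fun k : ℤ => |(k : ℝ)| ^ (-(3 / 2) : ℝ)) |>.2
        hS.hasSum)).mul_left (4 * 9 ^ m / t)) le_rfl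
      fun k hk hj => cone_term_le hm ht1 hz hk hj
    have h1 : 0 ≤ |(k : ℝ)| ^ (-(3 / 2) : ℝ) := Real.rpow_nonneg (abs_nonneg _) _
    have h2 : 0 ≤ |((k - l : ℤ) : ℝ)| ^ (-(3 / 2) : ℝ) := Real.rpow_nonneg (abs_nonneg _) _
    exact mul_nonneg (by positivity) (add_nonneg h1 h2)
  · refine ENNReal.ofReal_le_ofReal ?_
    have h1 : sobolevNorm (-(m : ℝ)) v ^ 2 ≤ R ^ 2 := by
      have := sobolevNorm_nonneg (-(m : ℝ)) v
      gcongr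
    calc _ ≤ 4 * 9 ^ m / t * (S + S) * R ^ 2 := by gcongr
      _ = (8 * 9 ^ m * S * R ^ 2) / t := by ring
      _ ≤ 1 / 2 := by
        rw [div_le_iff₀ ht0, ht]
        linarith

/-! ### Vertical strips -/

/-- For m = 1 this is the quadratic inequality `h4`; the general case follows on multiplying by
y^{2m-2}. With y = 2n it says how far a cut point stays above the lower frequencies despite the
subtracted y^m. -/
lemma pow_sub_pow_sub_pow_ge {m : ℕ} (hm : 1 ≤ m) {y a : ℝ} (hy : 2 ≤ y) (ha0 : 0 ≤ a)
    (ha : a ≤ y - 1) :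
    1 / 2 * (y - a) * y ^ (2 * m - 1) ≤ y ^ (2 * m) - y ^ m - a ^ (2 * m) := by
  obtain ⟨p, rfl⟩ : ∃ p, m = p + 1 := ⟨m - 1, by omega⟩
  have e1 : 2 * (p + 1) - 1 = 2 * p + 1 := by omega
  have e2 : 2 * (p + 1) = 2 * p + 2 := by omega
  rw [e1, e2]
  have h1 : a ^ (2 * p + 2) ≤ y ^ (2 * p) * a ^ 2 := by
    rw [pow_add]
    gcongr
    linarith
  have h2 : y ^ (p + 1) ≤ y ^ (2 * p) * y := by
    rw [← pow_succ]
    exact pow_le_pow_right₀ (by linarith) (by omega)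
  have h3 : 0 ≤ y ^ (2 * p) := by positivity
  have h4 : 0 ≤ y ^ 2 - y - a ^ 2 - 1 / 2 * (y - a) * y := by
    nlinarith [mul_nonneg (by linarith : 0 ≤ y - a - 1) ha0,
      mul_nonneg (by linarith : 0 ≤ y - a) (by linarith : 0 ≤ y - 2)]
  have h5 := mul_nonneg h3 h4
  rw [pow_add y (2 * p) 2, pow_add y (2 * p) 1]
  nlinarith

lemma sub_mul_pow_le_pow_sub_pow {m : ℕ} (hm : 1 ≤ m) {x a : ℝ} (hx : 0 ≤ x) (hxa : x ≤ a) :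
    (a - x) * a ^ (2 * m - 1) ≤ a ^ (2 * m) - x ^ (2 * m) := by
  have e : 2 * m = (2 * m - 1) + 1 := by omega
  have h1 : x ^ (2 * m) ≤ a ^ (2 * m - 1) * x := by
    conv_lhs => rw [e, pow_succ]
    gcongr
  have h2 : a ^ (2 * m) = a ^ (2 * m - 1) * a := by
    conv_lhs => rw [e, pow_succ]
  rw [h2]
  linarith

lemma two_le_pi_pow {m : ℕ} (hm : 1 ≤ m) : 2 ≤ Real.pi ^ (2 * m) := by
  have h := le_self_pow₀ (by linarith [Real.pi_gt_three] : 1 ≤ Real.pi) (by omega : 2 * m ≠ 0)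
  linarith [Real.pi_gt_three]

/-- Since π^{2m} ≥ 3^{2m}, the factor π^{2m} pays both for passing from y to N and for the constants
1/2 lost elsewhere. -/
lemma pi_pow_mul_ge {m : ℕ} (hm : 1 ≤ m) {y N : ℝ} (hN : 0 ≤ N) (hNy : N ≤ 3 / 2 * y) :
    4 * N ^ (2 * m - 1) ≤ y ^ (2 * m - 1) * Real.pi ^ (2 * m) := by
  have hy : 0 ≤ y := by linarith
  have e : 2 * m = (2 * m - 1) + 1 := by omega
  have h1 : N ^ (2 * m - 1) ≤ (3 / 2) ^ (2 * m - 1) * y ^ (2 * m - 1) := by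
    rw [← mul_pow]; gcongr
  have h2 : (3 : ℝ) ^ (2 * m - 1) * 3 ≤ Real.pi ^ (2 * m) := by
    conv_rhs => rw [e, pow_succ]
    have := Real.pi_gt_three
    gcongr
  have h3 : (3 : ℝ) ^ (2 * m - 1) = 2 ^ (2 * m - 1) * (3 / 2) ^ (2 * m - 1) := by
    rw [← mul_pow]; norm_num
  have h4 : (2 : ℝ) ≤ 2 ^ (2 * m - 1) := le_self_pow₀ (by norm_num) (by omega)
  have h5 : 0 ≤ y ^ (2 * m - 1) := by positivity
  have h6 : (0 : ℝ) ≤ (3 / 2) ^ (2 * m - 1) := by positivity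
  calc 4 * N ^ (2 * m - 1) ≤ (6 * (3 / 2) ^ (2 * m - 1)) * y ^ (2 * m - 1) := by
        nlinarith [mul_nonneg h6 h5]
    _ ≤ (3 ^ (2 * m - 1) * 3) * y ^ (2 * m - 1) := by
        refine mul_le_mul_of_nonneg_right ?_ h5
        rw [h3]
        nlinarith
    _ ≤ _ := by rw [mul_comm]; gcongr

lemma abs_re_sub_le_norm (z : ℂ) (x : ℝ) : |z.re - x| ≤ ‖z - (x : ℂ)‖ := by
  have := Complex.abs_re_le_norm (z - (x : ℂ))
  simpa using this

lemma odd_cases {k : ℤ} (hk : Odd k) {n : ℕ} (hn : 1 ≤ n) (h : |k| ≠ ((2 * n - 1 : ℕ) : ℤ)) :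
    |(k : ℝ)| ≤ 2 * n - 3 ∨ 2 * (n : ℝ) + 1 ≤ |(k : ℝ)| := by
  have h1 : |k| ≤ 2 * n - 3 ∨ 2 * (n : ℤ) + 1 ≤ |k| := by
    obtain ⟨i, rfl⟩ := hk
    rcases abs_cases (2 * i + 1) with ⟨h1, -⟩ | ⟨h1, -⟩ <;> omega
  exact h1.imp (fun h => by exact_mod_cast h) (fun h => by exact_mod_cast h)

lemma cast_two_mul_sub_one {n : ℕ} (hn : 1 ≤ n) : ((2 * n - 1 : ℕ) : ℝ) = 2 * n - 1 := by
  rw [Nat.cast_sub (by omega)]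
  push_cast
  ring

/-- Real parts suffice for the nonresonant frequencies: those with |k| ≤ 2n-3 are compared with the
left edge of the strip, those with |k| ≥ 2n+1 with the right edge. Comparing 2n-1 with 3/2 of 2n-2
requires n ≥ 2. -/
lemma gapBound_strip {m n : ℕ} (hm : 1 ≤ m) (hn : 2 ≤ n) {z : ℂ}
    (h1 : cutPoint m (n - 1) ≤ z.re) (h2 : z.re ≤ cutPoint m n) {ρ : ℝ} (hρ : 0 < ρ)
    (hρz : ρ ≤ ‖z - (freq m ((2 * n - 1 : ℕ) : ℤ) : ℂ)‖) :
    GapBound m (2 * n - 1) ρ fun k => ‖z - (freq m k : ℂ)‖ := by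
  have hn' : (2 : ℝ) ≤ n := by exact_mod_cast hn
  have hpi : 0 < Real.pi ^ (2 * m) := by positivity
  have hpi2 := two_le_pi_pow hm
  refine ⟨hρ, fun k hk => ?_, fun k hk hkN => ?_⟩
  · have : freq m k = freq m ((2 * n - 1 : ℕ) : ℤ) := by
      rw [freq_eq, freq_eq, ← Int.cast_abs, hk, ← Int.cast_abs, abs_of_nonneg (by positivity)]
    simp only [this]
    exact hρz
  · rw [cast_two_mul_sub_one (by omega)]
    set a := |(k : ℝ)| with ha
    have ha0 : 0 ≤ a := abs_nonneg _
    rcases odd_cases hk (by omega) hkN with h | h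
    · -- low frequencies
      rw [max_eq_right (by linarith), abs_of_nonpos (by linarith)]
      refine le_trans ?_ ((le_abs_self _).trans (abs_re_sub_le_norm z (freq m k)))
      rw [freq_eq, ← ha]
      have h3 := pow_sub_pow_sub_pow_ge hm (y := 2 * n - 2) (a := a) (by linarith) ha0 (by linarith)
      have h4 := pi_pow_mul_ge hm (y := 2 * n - 2) (N := 2 * n - 1) (by linarith) (by linarith)
      have h5 : cutPoint m (n - 1) = ((2 * n - 2) ^ (2 * m) - (2 * n - 2) ^ m) * Real.pi ^ (2 * m) := by
        rw [cutPoint, Nat.cast_sub (by omega)]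
        push_cast
        ring
      have h6 := mul_le_mul_of_nonneg_right h3 hpi.le
      have h7 : 0 ≤ (2 * (n : ℝ) - 1) ^ (2 * m - 1) := pow_nonneg (by linarith) _
      -- Here 2n-1-a ≤ 2(2n-2-a), because a ≤ 2n-3.
      calc -(a - (2 * n - 1)) * (2 * (n : ℝ) - 1) ^ (2 * m - 1)
          ≤ (1 / 2 * (2 * n - 2 - a)) * (4 * (2 * (n : ℝ) - 1) ^ (2 * m - 1)) := by
            nlinarith
        _ ≤ (1 / 2 * (2 * n - 2 - a)) * ((2 * (n : ℝ) - 2) ^ (2 * m - 1) * Real.pi ^ (2 * m)) := by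
            gcongr
            linarith
        _ ≤ _ := by linarith
    · -- high frequencies
      rw [max_eq_left (by linarith), abs_of_nonneg (by linarith)]
      refine le_trans ?_ ((neg_le_abs _).trans (abs_re_sub_le_norm z (freq m k)))
      rw [freq_eq, ← ha]
      have h3 := sub_mul_pow_le_pow_sub_pow hm (x := 2 * n) (a := a) (by linarith) (by linarith)
      have h6 := mul_le_mul_of_nonneg_right h3 hpi.le
      have h5 : cutPoint m n ≤ (2 * n) ^ (2 * m) * Real.pi ^ (2 * m) := by
        rw [cutPoint]
        gcongr
        have : (0 : ℝ) ≤ (2 * n) ^ m := by positivity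
        linarith
      have h7 : 0 ≤ a ^ (2 * m - 1) := pow_nonneg ha0 _
      calc (a - (2 * n - 1)) * a ^ (2 * m - 1) ≤ (a - 2 * n) * a ^ (2 * m - 1) * 2 := by nlinarith
        _ ≤ (a - 2 * n) * a ^ (2 * m - 1) * Real.pi ^ (2 * m) := by
            refine mul_le_mul_of_nonneg_left hpi2 (mul_nonneg (by linarith) h7)
        _ ≤ _ := by linarith

lemma pow_le_cutPoint_sub_freq {m n : ℕ} (hm : 1 ≤ m) (hn : 1 ≤ n) {k : ℤ}
    (hk : |(k : ℝ)| ≤ 2 * n - 1) :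
    ((2 * n - 1 : ℕ) : ℝ) ^ m ≤ cutPoint m n - freq m k := by
  have hn' : (1 : ℝ) ≤ n := by exact_mod_cast hn
  rw [cast_two_mul_sub_one hn, freq_eq, cutPoint]
  have h3 := pow_sub_pow_sub_pow_ge hm (y := 2 * n) (a := |(k : ℝ)|) (by linarith) (abs_nonneg _) hk
  have h4 := pi_pow_mul_ge hm (y := 2 * n) (N := 2 * n - 1) (by linarith) (by linarith)
  have hpi : 0 < Real.pi ^ (2 * m) := by positivity
  have h6 := mul_le_mul_of_nonneg_right h3 hpi.le
  have h7 : (2 * (n : ℝ) - 1) ^ m ≤ (2 * (n : ℝ) - 1) ^ (2 * m - 1) :=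
    pow_le_pow_right₀ (by linarith) (by omega)
  have h8 : 0 ≤ (2 * (n : ℝ)) ^ (2 * m - 1) * Real.pi ^ (2 * m) := by positivity
  have h9 : 0 ≤ (2 * (n : ℝ) - 1) ^ (2 * m - 1) := pow_nonneg (by linarith) _
  have h10 : 1 / 2 * ((2 * (n : ℝ)) ^ (2 * m - 1) * Real.pi ^ (2 * m))
      ≤ 1 / 2 * (2 * n - |(k : ℝ)|) * ((2 * (n : ℝ)) ^ (2 * m - 1) * Real.pi ^ (2 * m)) := by
    refine mul_le_mul_of_nonneg_right ?_ h8
    linarith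
  linarith

lemma cutPoint_lt_freq {m n : ℕ} (hn : 1 ≤ n) {k : ℤ}
    (hk : 2 * (n : ℝ) + 1 ≤ |(k : ℝ)|) : cutPoint m n < freq m k := by
  rw [freq_eq, cutPoint]
  have hn' : (1 : ℝ) ≤ n := by exact_mod_cast hn
  refine mul_lt_mul_of_pos_right ?_ (by positivity)
  have h1 : (0 : ℝ) < (2 * n) ^ m := by positivity
  have h2 : (2 * (n : ℝ)) ^ (2 * m) ≤ |(k : ℝ)| ^ (2 * m) := by gcongr; linarith
  linarith

/-! ### Spectral cuts of `L_m(V)` -/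

/-- The odd integers of modulus at most `2n - 1`. -/
def lowFreq (n : ℕ) : Finset OddInt :=
  (Finset.range (2 * n)).map ⟨fun i : ℕ => ⟨2 * (i : ℤ) - (2 * n - 1), ⟨(i : ℤ) - n, by ring⟩⟩,
    fun i j h => by simpa using congrArg Subtype.val h⟩

lemma card_lowFreq (n : ℕ) : (lowFreq n).card = 2 * n := by
  simp [lowFreq]

lemma mem_lowFreq {n : ℕ} {k : OddInt} : k ∈ lowFreq n ↔ |(k : ℤ)| ≤ 2 * n - 1 := by
  obtain ⟨k, i, rfl⟩ := k
  simp only [lowFreq, Finset.mem_map, Finset.mem_range, abs_le]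
  constructor
  · rintro ⟨j, hj, h⟩
    have h' : 2 * (j : ℤ) - (2 * n - 1) = 2 * i + 1 := congrArg Subtype.val h
    omega
  · rintro ⟨h1, h2⟩
    refine ⟨(i + n).toNat, by omega, Subtype.ext ?_⟩
    change 2 * ((i + n).toNat : ℤ) - (2 * n - 1) = 2 * i + 1
    omega

/-- Needed only qualitatively, to identify ℓ² with H_-^{-m}: the constants depend on n and z and
enter no smallness condition. -/
lemma comparable_cut {m n : ℕ} (hm : 1 ≤ m) (hn : 1 ≤ n) {ρ : ℝ} (hρ1 : 1 ≤ ρ) {z : ℂ}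
    (h : GapBound m (2 * n - 1) ρ fun k => ‖z - (freq m k : ℂ)‖) :
    ∃ c₁ c₂ : ℝ, Comparable m (fun k => ‖z - (freq m k : ℂ)‖) c₁ c₂ := by
  set N : ℕ := 2 * n - 1 with hN
  have hN1 : (1 : ℝ) ≤ N := by exact_mod_cast (by omega : 1 ≤ N)
  refine ⟨1 / (4 ^ m * (2 * N ^ (2 * m))), _, by positivity, fun k => ?_,
    fun k => norm_sub_freq_le m z k⟩
  have hNpow : (N : ℝ) ≤ N ^ (2 * m) := le_self_pow₀ hN1 (by omega)
  have h4 : (4 : ℝ) ^ m = 2 ^ (2 * m) := by rw [pow_mul]; norm_num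
  have hk1 := one_le_abs_of_odd k.2
  rw [one_div, inv_mul_le_iff₀ (by positivity)]
  by_cases hkN : |(k : ℤ)| = N
  · refine le_trans ?_ (mul_le_mul_of_nonneg_left (hρ1.trans (h.resonant k hkN)) (by positivity))
    have hkR : |((k : ℤ) : ℝ)| = N := by exact_mod_cast hkN
    have hb : bracket k ≤ 2 * N := by unfold bracket; linarith
    calc bracket k ^ (2 * m) ≤ (2 * (N : ℝ)) ^ (2 * m) :=
          pow_le_pow_left₀ (bracket_pos k).le hb _
      _ = 4 ^ m * N ^ (2 * m) := by rw [mul_pow, h4]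
      _ ≤ 4 ^ m * (2 * N ^ (2 * m)) * 1 := by
          have : (0 : ℝ) ≤ 4 ^ m * N ^ (2 * m) := by positivity
          linarith
  · refine le_trans ?_ (mul_le_mul_of_nonneg_left (h.gap k k.2 hkN) (by positivity))
    set X := max |((k : ℤ) : ℝ)| N with hX
    set d := |(|((k : ℤ) : ℝ)| - N)| with hd
    have hd1 : 1 ≤ d := one_le_abs_sub hkN
    have hX0 : 0 < X := lt_max_of_lt_right (by linarith)
    have hXd : X ≤ 2 * N * d := by
      refine max_le ?_ (by nlinarith)
      have := le_abs_self (|((k : ℤ) : ℝ)| - N)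
      nlinarith
    have hb : bracket k ≤ 2 * X := by
      unfold bracket
      have := le_max_left |((k : ℤ) : ℝ)| (N : ℝ)
      linarith
    have e : X ^ (2 * m) = X * X ^ (2 * m - 1) := by rw [← pow_succ']; congr 1; omega
    calc bracket k ^ (2 * m) ≤ (2 * X) ^ (2 * m) :=
          pow_le_pow_left₀ (bracket_pos k).le hb _
      _ = 4 ^ m * (X * X ^ (2 * m - 1)) := by rw [mul_pow, h4, e]
      _ ≤ 4 ^ m * ((2 * N ^ (2 * m) * d) * X ^ (2 * m - 1)) := by
          gcongr
          exact hXd.trans (by gcongr)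
      _ = _ := by ring

/-- The cut point lies on the right edge of its strip, at distance at least N^m from the double
eigenvalue, so one estimate serves for the cuts and for the strips. -/
lemma gapBound_cutPoint {m n : ℕ} (hm : 1 ≤ m) (hn : 2 ≤ n) :
    GapBound m (2 * n - 1) (((2 * n - 1 : ℕ) : ℝ) ^ m)
      fun k => ‖(cutPoint m n : ℂ) - (freq m k : ℂ)‖ := by
  have hN1 : (1 : ℝ) ≤ ((2 * n - 1 : ℕ) : ℝ) := by exact_mod_cast (by omega : 1 ≤ 2 * n - 1)
  refine gapBound_strip hm hn ?_ (by simp) (by positivity) ?_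
  · simpa using cutPoint_monotone hm (Nat.sub_le n 1)
  · rw [← Complex.ofReal_sub, Complex.norm_real, Real.norm_eq_abs]
    refine (pow_le_cutPoint_sub_freq hm (by omega) ?_).trans (le_abs_self _)
    rw [Int.cast_natCast, Nat.abs_cast, cast_two_mul_sub_one (by omega)]

theorem exists_spectralCut_of_hsSum {m n : ℕ} (hm : 1 ≤ m) (hn : 2 ≤ n) (V : HPlus (-(m : ℝ)))
    (h : hsSum V.1 (fun k => ‖(cutPoint m n : ℂ) - (freq m k : ℂ)‖)
      ≤ ENNReal.ofReal ((1 / 8) ^ 2)) :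
    (∃ S : Submodule ℂ (HMinus (-(m : ℝ))), FiniteDimensional ℂ S ∧
      Module.finrank ℂ S = 2 * n ∧ SpectralCut (opL m hm V) S (cutPoint m n)) ∧
    ∀ z, Function.Bijective (shifted (opL m hm V) z) →
      ∃ K : ℝ, ∀ u : (opL m hm V).domain,
        sobolevNorm (-(m : ℝ)) (u : HMinus (-(m : ℝ)))
          ≤ K * sobolevNorm (-(m : ℝ)) (shifted (opL m hm V) z u) := by
  have hnorm : ∀ k : ℤ, ‖(cutPoint m n : ℂ) - (freq m k : ℂ)‖ = |cutPoint m n - freq m k| := by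
    intro k
    rw [← Complex.ofReal_sub, Complex.norm_real, Real.norm_eq_abs]
  have hN1 : (1 : ℝ) ≤ ((2 * n - 1 : ℕ) : ℝ) := by exact_mod_cast (by omega : 1 ≤ 2 * n - 1)
  obtain ⟨c₁, c₂, hc⟩ := comparable_cut hm (by omega) (one_le_pow₀ hN1) (gapBound_cutPoint hm hn)
  obtain ⟨hs, hle⟩ := summable_of_hsSum_le (by norm_num) h
  have := exists_spectralCut (c := cutPoint m n) (L := lowFreq n) hm V hc (fun k hk => ?_)
    (fun k hk => ?_) hs hle
  · rwa [card_lowFreq] at this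
  · rw [mem_lowFreq] at hk
    have hkR : |((k : ℤ) : ℝ)| ≤ 2 * n - 1 := by exact_mod_cast hk
    have h1 := pow_le_cutPoint_sub_freq hm (by omega) hkR
    have h2 : (0 : ℝ) ≤ ((2 * n - 1 : ℕ) : ℝ) ^ m := by positivity
    rw [hnorm, abs_of_nonneg (by linarith)]
    change freq m k = _
    ring
  · rw [mem_lowFreq] at hk
    rcases odd_cases k.2 (n := n) (by omega) (by omega) with h1 | h1
    · exact absurd (by
        have h2 : |((k : ℤ) : ℝ)| ≤ 2 * n - 1 := by linarith
        exact_mod_cast h2) hk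
    · have h2 := cutPoint_lt_freq (m := m) (by omega) h1
      rw [hnorm, abs_of_nonpos (by linarith)]
      change freq m k = _
      ring

/-! ### Localization from Hilbert–Schmidt bounds -/

lemma eq_zero_of_hsSum_le {m : ℕ} (hm : 1 ≤ m) (V : HPlus (-(m : ℝ))) {z : ℂ}
    (hz : ∀ k : ℤ, Odd k → 0 < ‖z - (freq m k : ℂ)‖) {x : ℝ} (hx0 : 0 ≤ x) (hx1 : x < 1)
    (h : hsSum V.1 (fun k => ‖z - (freq m k : ℂ)‖) ≤ ENNReal.ofReal x)
    {u : (opL m hm V).domain} (hu : shifted (opL m hm V) z u = 0) : u = 0 := by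
  obtain ⟨hs, hle⟩ := summable_of_hsSum_le hx0 h
  exact eq_zero_of_shifted_eq_zero hm V (fun k => hz k k.2) hs (hle.trans_lt hx1) hu

/-- Cuts need the norm 1/8 required by the Riccati contraction; for the absence of eigenvectors any
constant below 1 works. The choice 3/4 leaves room above the 1/2 that the resonant pair contributes
in the uniform case. -/
theorem localized_of_hsSum {m : ℕ} (hm : 1 ≤ m) (V : HPlus (-(m : ℝ))) {M : ℝ} {n₀ : ℕ}
    {r : ℕ → ℝ} (hn₀ : 2 ≤ n₀)
    (hcut : ∀ n, n₀ ≤ n → hsSum V.1 (fun k => ‖(cutPoint m n : ℂ) - (freq m k : ℂ)‖)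
      ≤ ENNReal.ofReal ((1 / 8) ^ 2))
    (hcone : ∀ z : ℂ, z.re < |z.im| - M → (∀ k : ℤ, 0 < ‖z - (freq m k : ℂ)‖) ∧
      hsSum V.1 (fun k => ‖z - (freq m k : ℂ)‖) ≤ ENNReal.ofReal (1 / 2))
    (hr : ∀ n, n₀ < n → 0 < r n)
    (hdisc : ∀ n, n₀ < n → ∀ z : ℂ,
      GapBound m (2 * n - 1) (r n) (fun k => ‖z - (freq m k : ℂ)‖) →
      hsSum V.1 (fun k => ‖z - (freq m k : ℂ)‖) ≤ ENNReal.ofReal (3 / 4)) :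
    Localized m hm V M n₀ r := by
  refine localized_of_spectralCut
    (fun n hn => (exists_spectralCut_of_hsSum hm (hn₀.trans hn) V (hcut n hn)).1)
    (exists_spectralCut_of_hsSum hm hn₀ V (hcut n₀ le_rfl)).2 (fun z u hu0 hu => ?_)
    (fun n hn z u hu0 hu h1 h2 => ?_)
  · by_contra! hz
    obtain ⟨hpos, hle⟩ := hcone z hz
    exact hu0 (eq_zero_of_hsSum_le hm V (fun k _ => hpos k) (by norm_num) (by norm_num) hle hu)
  · by_contra! hz
    have hfreq : freq m ((2 * n - 1 : ℕ) : ℤ)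
        = (2 * (n : ℝ) - 1) ^ (2 * m) * Real.pi ^ (2 * m) := by
      rw [freq, mul_pow, Int.cast_natCast, cast_two_mul_sub_one (by omega)]
    rw [← hfreq] at hz
    have hgap := gapBound_strip hm (by omega) h1 h2 (hr n hn) hz
    exact hu0 (eq_zero_of_hsSum_le hm V (fun k hk => hgap.g_pos (by omega) hk) (by norm_num)
      (by norm_num) (hdisc n hn z hgap) hu)

/-- The bound at distance `N^m` from the double eigenvalue. -/
lemma GapBound.hsSum_le_of_pow {m N : ℕ} (hm : 1 ≤ m) (hN : 1 ≤ N) {g : ℤ → ℝ}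
    (h : GapBound m N ((N : ℝ) ^ m) g) {s : ℝ} (hs : s ≤ 0) (hsm : -(m : ℝ) ≤ s) {v : ℤ → ℂ}
    (hv : v ∈ sobolevSeq s) :
    hsSum v g ≤ ENNReal.ofReal
      (33 * 9 ^ m * (N : ℝ) ^ (-(2 * s) - 2 * m) * sobolevNorm s v ^ 2) := by
  refine (h.hsSum_le hm hN hs hsm hv).trans (ENNReal.ofReal_le_ofReal ?_)
  have hN1 : (1 : ℝ) ≤ N := by exact_mod_cast hN
  have h1 : (N : ℝ) ^ (2 * m) / ((N : ℝ) ^ m) ^ 2 = 1 := by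
    rw [← pow_mul, mul_comm m 2]
    exact div_self (by positivity)
  have h2 : 8 * (N : ℝ) / (N : ℝ) ^ m ≤ 8 := by
    rw [div_le_iff₀ (by positivity)]
    have : (N : ℝ) ≤ (N : ℝ) ^ m := le_self_pow₀ hN1 (by omega)
    linarith
  have h3 : 0 ≤ 9 ^ m * (N : ℝ) ^ (-(2 * s) - 2 * m) * sobolevNorm s v ^ 2 := by positivity
  rw [h1]
  nlinarith

/-! ### Perturbations of a fixed potential -/

lemma sobolevNorm_add_sq_le {s : ℝ} {a b : ℤ → ℂ} (ha : a ∈ sobolevSeq s) (hb : b ∈ sobolevSeq s) :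
    sobolevNorm s (a + b) ^ 2 ≤ 2 * sobolevNorm s a ^ 2 + 2 * sobolevNorm s b ^ 2 := by
  rw [sobolevNorm_sq, sobolevNorm_sq, sobolevNorm_sq, ← tsum_mul_left, ← tsum_mul_left]
  have h1 := Summable.mul_left 2 ha
  have h2 := Summable.mul_left 2 hb
  rw [← h1.tsum_add h2]
  refine Summable.tsum_le_tsum (fun k => ?_) (add_mem ha hb) (h1.add h2)
  have h3 : 0 ≤ bracket k ^ (2 * s) := Real.rpow_nonneg (bracket_pos k).le _
  have h4 : ‖(a + b) k‖ ^ 2 ≤ 2 * ‖a k‖ ^ 2 + 2 * ‖b k‖ ^ 2 := by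
    have h5 : ‖(a + b) k‖ ≤ ‖a k‖ + ‖b k‖ := norm_add_le _ _
    nlinarith [norm_nonneg ((a + b) k), sq_nonneg (‖a k‖ - ‖b k‖)]
  nlinarith

/-- Finite Fourier series are dense. -/
lemma exists_truncation {s ε : ℝ} (hε : 0 < ε) (v : ℤ → ℂ) :
    ∃ v₀ : ℤ → ℂ, v₀ ∈ sobolevSeq 0 ∧ v₀ ∈ sobolevSeq s ∧ sobolevNorm s (v - v₀) ≤ ε := by
  classical
  have h := (tendsto_tsum_compl_atTop_zero fun k : ℤ => bracket k ^ (2 * s) * ‖v k‖ ^ 2).eventually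
    (gt_mem_nhds (by positivity : (0 : ℝ) < ε ^ 2))
  obtain ⟨F, hF⟩ := h.exists
  have hfin : ∀ t : ℝ, (fun k => if k ∈ F then v k else 0) ∈ sobolevSeq t := by
    intro t
    refine summable_of_ne_finset_zero (s := F) fun k hk => ?_
    simp [hk]
  refine ⟨_, hfin 0, hfin s, ?_⟩
  refine (sq_le_sq₀ (sobolevNorm_nonneg _ _) hε.le).1 (le_trans (le_of_eq ?_) hF.le)
  rw [sobolevNorm_sq]
  refine Eq.trans ?_
    (tsum_subtype {k | k ∉ F} fun k : ℤ => bracket k ^ (2 * s) * ‖v k‖ ^ 2).symm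
  refine tsum_congr fun k => ?_
  by_cases hk : k ∈ F <;> simp [hk]

/-- At order -m the estimate does not improve as n grows. Smallness comes from W = v₀ + (W-V) +
(V-v₀), where v₀ is a finite Fourier series: the differences are small in norm, and v₀ has order 0,
where N^{-2m} decays. -/
theorem exists_localized_nhds (m : ℕ) (hm : 1 ≤ m) (V : HPlus (-(m : ℝ))) :
    ∃ ε : ℝ, 0 < ε ∧ ∃ M : ℝ, 1 ≤ M ∧ ∃ n₀ : ℕ, 1 ≤ n₀ ∧
      ∀ W : HPlus (-(m : ℝ)), sobolevNorm (-(m : ℝ)) (W - V : HPlus (-(m : ℝ))) ≤ ε →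
        Localized m hm W M n₀ (fun n => (2 * (n : ℝ) - 1) ^ m) := by
  set B : ℝ := 33 * 9 ^ m with hB
  have hB1 : 1 ≤ B := by
    have : (1 : ℝ) ≤ 9 ^ m := one_le_pow₀ (by norm_num)
    linarith
  set ε : ℝ := 1 / (32 * B) with hε
  have hε0 : 0 < ε := by positivity
  have hBε : B * ε ^ 2 ≤ 1 / 1024 := by
    rw [hε, div_pow, one_pow, mul_pow, mul_one_div, div_le_div_iff₀ (by positivity) (by norm_num)]
    nlinarith
  obtain ⟨v₀, hv₀, hv₀m, hVv₀⟩ := exists_truncation hε0 V.1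
  obtain ⟨M, hM1, hM⟩ := exists_cone hm
    (Real.sqrt (2 * ε ^ 2 + 2 * sobolevNorm (-(m : ℝ)) V.1 ^ 2))
  -- Large enough to push the contribution of v₀ below 1/256.
  set n₀ : ℕ := max 2 ⌈256 * B * sobolevNorm 0 v₀ ^ 2⌉₊ with hn₀
  have hn₀2 : 2 ≤ n₀ := le_max_left _ _
  refine ⟨ε, hε0, M, hM1, n₀, by omega, fun W hW => ?_⟩
  have hWV : (W - V : HPlus (-(m : ℝ))).1 = W.1 - V.1 := rfl
  rw [hWV] at hW
  have hWVm : W.1 - V.1 ∈ sobolevSeq (-(m : ℝ)) := sub_mem W.2.1 V.2.1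
  have hm0 : -(m : ℝ) ≤ 0 := by simp
  have key : ∀ n, n₀ ≤ n → ∀ g : ℤ → ℝ,
      GapBound m (2 * n - 1) (((2 * n - 1 : ℕ) : ℝ) ^ m) g →
      hsSum W.1 g ≤ ENNReal.ofReal ((1 / 8) ^ 2) := by
    intro n hn g hg
    have hN1 : 1 ≤ 2 * n - 1 := by omega
    have hT : ((2 * n - 1 : ℕ) : ℝ) ^ (-(2 * (-(m : ℝ))) - 2 * m) = 1 := by
      rw [show -(2 * (-(m : ℝ))) - 2 * m = 0 by ring, Real.rpow_zero]
    have hsmall : ∀ w ∈ sobolevSeq (-(m : ℝ)), sobolevNorm (-(m : ℝ)) w ≤ ε →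
        hsSum w g ≤ ENNReal.ofReal (1 / 1024) := by
      intro w hw hwε
      refine (hg.hsSum_le_of_pow hm hN1 hm0 le_rfl hw).trans (ENNReal.ofReal_le_ofReal ?_)
      rw [hT, mul_one]
      refine le_trans ?_ hBε
      have := sobolevNorm_nonneg (-(m : ℝ)) w
      gcongr
    have hsmooth : hsSum v₀ g ≤ ENNReal.ofReal (1 / 256) := by
      refine (hg.hsSum_le_of_pow hm hN1 le_rfl hm0 hv₀).trans (ENNReal.ofReal_le_ofReal ?_)
      have hnN : (n₀ : ℝ) ≤ ((2 * n - 1 : ℕ) : ℝ) := by exact_mod_cast (by omega : n₀ ≤ 2 * n - 1)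
      have hN1' : (1 : ℝ) ≤ ((2 * n - 1 : ℕ) : ℝ) := by exact_mod_cast hN1
      set N : ℝ := ((2 * n - 1 : ℕ) : ℝ)
      have h1 : 256 * B * sobolevNorm 0 v₀ ^ 2 ≤ N :=
        (Nat.le_ceil _).trans (le_trans (by exact_mod_cast le_max_right _ _) hnN)
      have h2 : N ^ (-(2 * (0 : ℝ)) - 2 * m) ≤ N⁻¹ := by
        rw [← Real.rpow_neg_one]
        refine Real.rpow_le_rpow_of_exponent_le hN1' ?_
        have : (1 : ℝ) ≤ m := by exact_mod_cast hm
        linarith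
      calc B * N ^ (-(2 * (0 : ℝ)) - 2 * m) * sobolevNorm 0 v₀ ^ 2
          ≤ B * N⁻¹ * sobolevNorm 0 v₀ ^ 2 := by gcongr
        _ = (B * sobolevNorm 0 v₀ ^ 2) / N := by ring
        _ ≤ 1 / 256 := by
          rw [div_le_iff₀ (by linarith)]
          linarith
    have e : W.1 = v₀ + ((W.1 - V.1) + (V.1 - v₀)) := by abel
    have two : (2 : ENNReal) = ENNReal.ofReal 2 := by simp
    -- The budget is 2/256 + 4/1024 + 4/1024 = 1/64.
    calc hsSum W.1 g ≤ 2 * hsSum v₀ g + 2 * (2 * hsSum (W.1 - V.1) g + 2 * hsSum (V.1 - v₀) g) := by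
          conv_lhs => rw [e]
          refine (hsSum_add_le _ _ _).trans ?_
          gcongr
          exact hsSum_add_le _ _ _
      _ ≤ 2 * ENNReal.ofReal (1 / 256) + 2 * (2 * ENNReal.ofReal (1 / 1024)
          + 2 * ENNReal.ofReal (1 / 1024)) := by
          gcongr
          · exact hsmall _ hWVm hW
          · exact hsmall _ (sub_mem V.2.1 hv₀m) hVv₀
      _ = ENNReal.ofReal ((1 / 8) ^ 2) := by
          rw [two, ← ENNReal.ofReal_mul (by norm_num), ← ENNReal.ofReal_mul (by norm_num),
            ← ENNReal.ofReal_add (by norm_num) (by norm_num), ← ENNReal.ofReal_mul (by norm_num),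
            ← ENNReal.ofReal_add (by norm_num) (by norm_num)]
          norm_num
  have hcast : ∀ n, n₀ ≤ n → (2 * (n : ℝ) - 1) ^ m = ((2 * n - 1 : ℕ) : ℝ) ^ m := fun n hn => by
    rw [cast_two_mul_sub_one (by omega)]
  refine localized_of_hsSum hm W hn₀2 (fun n hn => key n hn _ (gapBound_cutPoint hm (by omega)))
    (fun z hz => hM W.1 W.2.1 (Real.le_sqrt_of_sq_le ?_) z hz) (fun n hn => ?_)
    (fun n hn z hg => ?_)
  · have h1 := sobolevNorm_add_sq_le hWVm V.2.1
    rw [sub_add_cancel] at h1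
    have h2 : sobolevNorm (-(m : ℝ)) (W.1 - V.1) ^ 2 ≤ ε ^ 2 := by
      have := sobolevNorm_nonneg (-(m : ℝ)) (W.1 - V.1)
      gcongr
    linarith
  · rw [hcast n hn.le]
    have : (0 : ℝ) < ((2 * n - 1 : ℕ) : ℝ) := by exact_mod_cast (by omega : 0 < 2 * n - 1)
    positivity
  · simp only [hcast n hn.le] at hg
    exact (key n hn.le _ hg).trans (ENNReal.ofReal_le_ofReal (by norm_num))

/-! ### Uniform localization -/

/-- The effective constant. -/
def effectiveConst (x : ℕ × ℕ × ℕ × ℕ) : ℕ :=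
  (10000 * 9 ^ x.1 * (x.2.2.1 + 1) ^ 2) ^ (x.2.1 + 1)

lemma primrec_pow : Primrec₂ fun a n : ℕ => a ^ n := by
  have h : Primrec₂ fun a n : ℕ => (Nat.rec 1 (fun _ y => y * a) n : ℕ) :=
    Primrec.nat_rec (f := fun _ : ℕ => 1) (g := fun (a : ℕ) (p : ℕ × ℕ) => p.2 * a)
      (Primrec.const 1)
      (Primrec.nat_mul.comp (Primrec.snd.comp Primrec.snd) Primrec.fst).to₂
  refine h.of_eq fun a n => ?_
  induction n with
  | zero => rfl
  | succ n ih => rw [pow_succ, ← ih]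

lemma computable_effectiveConst : Computable effectiveConst := by
  have h1 : Primrec fun x : ℕ × ℕ × ℕ × ℕ => 9 ^ x.1 :=
    primrec_pow.comp (Primrec.const 9) Primrec.fst
  have h2 : Primrec fun x : ℕ × ℕ × ℕ × ℕ => (x.2.2.1 + 1) ^ 2 :=
    primrec_pow.comp (Primrec.succ.comp
      (Primrec.fst.comp (Primrec.snd.comp Primrec.snd))) (Primrec.const 2)
  have h3 : Primrec fun x : ℕ × ℕ × ℕ × ℕ => x.2.1 + 1 :=
    Primrec.succ.comp (Primrec.fst.comp Primrec.snd)
  exact (primrec_pow.comp (Primrec.nat_mul.comp (Primrec.nat_mul.comp (Primrec.const 10000) h1) h2)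
    h3).to_comp

lemma sobolevNorm_mono {s t : ℝ} (hst : s ≤ t) {v : ℤ → ℂ} (hv : v ∈ sobolevSeq t) :
    sobolevNorm s v ≤ sobolevNorm t v := by
  refine Real.sqrt_le_sqrt (Summable.tsum_le_tsum (fun k => ?_) (sobolevSeq_anti hst hv) hv)
  exact mul_le_mul_of_nonneg_right
    (Real.rpow_le_rpow_of_exponent_le (one_le_bracket k) (by linarith)) (sq_nonneg _)

/-- The power of `N` which measures the distance to the critical order. -/
lemma rpow_neg_mul_one_sub_le {m p Q N : ℕ} (hm : 1 ≤ m) {α : ℝ}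
    (hα : α ≤ 1 - 1 / ((p : ℝ) + 1)) (hQ : 1 ≤ Q) (hN : Q ^ (p + 1) ≤ N) :
    (N : ℝ) ^ (-(m * (1 - α))) ≤ (Q : ℝ)⁻¹ := by
  have hm' : (1 : ℝ) ≤ m := by exact_mod_cast hm
  have hQ' : (1 : ℝ) ≤ Q := by exact_mod_cast hQ
  have hN' : (Q : ℝ) ^ (p + 1) ≤ N := by exact_mod_cast hN
  have hN1 : (1 : ℝ) ≤ N := (one_le_pow₀ hQ').trans hN'
  have hp : (0 : ℝ) < 1 / ((p : ℝ) + 1) := by positivity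
  calc (N : ℝ) ^ (-(m * (1 - α))) ≤ (N : ℝ) ^ (-(1 / ((p : ℝ) + 1))) := by
        refine Real.rpow_le_rpow_of_exponent_le hN1 ?_
        nlinarith
    _ ≤ ((Q : ℝ) ^ (p + 1)) ^ (-(1 / ((p : ℝ) + 1))) :=
        Real.rpow_le_rpow_of_nonpos (by positivity) hN' (by linarith)
    _ = (Q : ℝ)⁻¹ := by
        rw [← Real.rpow_natCast, ← Real.rpow_mul (by linarith), ← Real.rpow_neg_one]
        congr 1
        push_cast
        field_simp

lemma HPlus.coe_incl (m : ℕ) {α : ℝ} (hα : α ≤ 1) (V : HPlus (-(m * α))) :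
    (HPlus.incl m hα V : ℤ → ℂ) = V.1 := by
  unfold HPlus.incl
  exact Subtype.coe_mk _ _

/-- With t = N^{-m(1-α)} the prefactor is 9^m t² and N^{mα} = tN^m. The stated radius makes the
resonant term 1/(2C²) ≤ 1/2; everything else is made tiny by t ≤ 1/Q. The cone depends on R alone,
so M is fixed before C. -/
theorem exists_localized_ball (m : ℕ) (hm : 1 ≤ m) (α : ℝ) (hα0 : 0 ≤ α) (hα : α < 1) (R : ℝ)
    (hR : 0 < R) :
    ∃ M : ℝ, 1 ≤ M ∧ ∀ (C : ℝ) (_ : 1 < C) (p q l : ℕ),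
      α ≤ 1 - 1 / ((p : ℝ) + 1) → R ≤ q → 1 + 1 / ((l : ℝ) + 1) ≤ C →
      ∀ V : HPlus (-(m * α)), sobolevNorm (-(m * α)) V ≤ R →
        Localized m hm (HPlus.incl m hα.le V) M (effectiveConst (m, p, q, l))
          (fun n => 3 ^ m * Real.sqrt 2 * C * R * (2 * (n : ℝ) - 1) ^ (m * α)) := by
  obtain ⟨M, hM1, hM⟩ := exists_cone hm R
  refine ⟨M, hM1, fun C hC p q l hp hq _ V hV => ?_⟩
  have hm' : (1 : ℝ) ≤ m := by exact_mod_cast hm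
  have hs0 : -(m * α) ≤ 0 := by
    have := mul_nonneg (by linarith : (0 : ℝ) ≤ m) hα0
    linarith
  have hsm : -(m : ℝ) ≤ -(m * α) := by nlinarith
  -- Q makes 9^m R²/Q ≤ 1/10000. Since m(1-α) ≥ 1/(p+1), N ≥ Q^{p+1} gives N^{-m(1-α)} ≤ 1/Q.
  obtain ⟨Q, hQ⟩ : ∃ Q : ℕ, Q = 10000 * 9 ^ m * (q + 1) ^ 2 := ⟨_, rfl⟩
  have hn₀Q : effectiveConst (m, p, q, l) = Q ^ (p + 1) := by rw [hQ]; rfl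
  generalize effectiveConst (m, p, q, l) = n₀ at hn₀Q ⊢
  have h9m : 1 ≤ 9 ^ m := Nat.one_le_pow _ _ (by norm_num)
  have hq1 : 1 ≤ (q + 1) ^ 2 := Nat.one_le_pow _ _ (by omega)
  have hQ1 : 10000 ≤ Q := by
    rw [hQ, mul_assoc]
    exact Nat.le_mul_of_pos_right _ (Nat.mul_pos h9m hq1)
  have hn₀2 : 2 ≤ n₀ := by
    rw [hn₀Q]
    calc 2 ≤ Q := by omega
      _ ≤ Q ^ (p + 1) := Nat.le_self_pow (by omega) Q
  have hQR : (Q : ℝ) = 10000 * 9 ^ m * ((q : ℝ) + 1) ^ 2 := by rw [hQ]; push_cast; ring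
  have hQ0 : (0 : ℝ) < Q := by exact_mod_cast (by omega : 0 < Q)
  have hRq : R ^ 2 ≤ ((q : ℝ) + 1) ^ 2 := by gcongr; linarith
  have hvR : sobolevNorm (-(m * α)) V.1 ^ 2 ≤ R ^ 2 := by
    have := sobolevNorm_nonneg (-(m * α)) V.1
    gcongr
  have hsmall : 9 ^ m * R ^ 2 * (Q : ℝ)⁻¹ ≤ 1 / 10000 := by
    rw [← div_eq_mul_inv, div_le_iff₀ hQ0, hQR]
    have : (9 : ℝ) ^ m * R ^ 2 ≤ 9 ^ m * ((q : ℝ) + 1) ^ 2 := by gcongr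
    linarith
  have hsmall' : 3 ^ m * R * (Q : ℝ)⁻¹ ≤ 1 / 10000 := by
    refine le_trans ?_ (by
      rw [← div_eq_mul_inv, div_le_iff₀ hQ0, hQR]; linarith :
        (9 : ℝ) ^ m * ((q : ℝ) + 1) ^ 2 * (Q : ℝ)⁻¹ ≤ 1 / 10000)
    have h1 : (3 : ℝ) ^ m ≤ 9 ^ m := by gcongr; norm_num
    have h2 : R ≤ ((q : ℝ) + 1) ^ 2 := by nlinarith
    gcongr
  have hN : ∀ n, n₀ ≤ n → (1 : ℝ) ≤ ((2 * n - 1 : ℕ) : ℝ) ∧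
      ((2 * n - 1 : ℕ) : ℝ) ^ (-(m * (1 - α))) ≤ (Q : ℝ)⁻¹ := by
    intro n hn
    refine ⟨by exact_mod_cast (by omega : 1 ≤ 2 * n - 1), ?_⟩
    exact rpow_neg_mul_one_sub_le hm hp (by omega) (by omega)
  have hT : ∀ N : ℝ, 1 ≤ N → N ^ (-(2 * (-(m * α))) - 2 * m) = (N ^ (-(m * (1 - α)))) ^ 2 := by
    intro N hN
    rw [← Real.rpow_natCast, ← Real.rpow_mul (by linarith)]
    congr 1
    push_cast
    ring
  have hQinv : (Q : ℝ)⁻¹ ≤ 1 := inv_le_one_of_one_le₀ (by exact_mod_cast (by omega : 1 ≤ Q))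
  have hsq : ∀ t : ℝ, 0 ≤ t → t ≤ (Q : ℝ)⁻¹ → 9 ^ m * t ^ 2 * R ^ 2 ≤ 1 / 10000 := by
    intro t ht htQ
    refine le_trans ?_ hsmall
    have : t ^ 2 ≤ (Q : ℝ)⁻¹ := by nlinarith
    calc _ = 9 ^ m * R ^ 2 * t ^ 2 := by ring
      _ ≤ _ := by gcongr
  have hrpos : ∀ n, n₀ < n →
      0 < 3 ^ m * Real.sqrt 2 * C * R * (2 * (n : ℝ) - 1) ^ (m * α) := by
    intro n hn
    have h1 := (hN n hn.le).1
    rw [cast_two_mul_sub_one (by omega)] at h1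
    have : 0 < (2 * (n : ℝ) - 1) ^ (m * α) := Real.rpow_pos_of_pos (by linarith) _
    positivity
  have hW := HPlus.coe_incl m hα.le V
  generalize HPlus.incl m hα.le V = W at hW ⊢
  refine localized_of_hsSum hm W hn₀2 (fun n hn => ?_) (fun z hz => ?_) hrpos (fun n hn z hg => ?_) <;> rw [hW]
  · obtain ⟨hN1, ht⟩ := hN n hn
    refine ((gapBound_cutPoint hm (hn₀2.trans hn)).hsSum_le_of_pow hm (by omega) hs0 hsm
      V.2.1).trans (ENNReal.ofReal_le_ofReal ?_)
    rw [hT _ hN1]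
    set t := ((2 * n - 1 : ℕ) : ℝ) ^ (-(m * (1 - α)))
    have ht0 : 0 ≤ t := Real.rpow_nonneg (by linarith) _
    have h1 := hsq t ht0 ht
    have h2 : 9 ^ m * t ^ 2 * sobolevNorm (-(m * α)) V.1 ^ 2 ≤ 9 ^ m * t ^ 2 * R ^ 2 := by gcongr
    linarith
  · exact hM V.1 (sobolevSeq_anti hsm V.2.1) ((sobolevNorm_mono hsm V.2.1).trans hV) z hz
  · obtain ⟨hN1, ht⟩ := hN n hn.le
    refine (hg.hsSum_le hm (by omega) hs0 hsm V.2.1).trans (ENNReal.ofReal_le_ofReal ?_)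
    rw [hT _ hN1, ← cast_two_mul_sub_one (by omega)]
    set N : ℝ := ((2 * n - 1 : ℕ) : ℝ)
    set t := N ^ (-(m * (1 - α))) with htdef
    have hN0 : 0 < N := by linarith
    have ht0 : 0 < t := Real.rpow_pos_of_pos hN0 _
    set y := N ^ (m * α) with hy
    have hy0 : 0 < y := Real.rpow_pos_of_pos hN0 _
    have hty : t * N ^ m = y := by
      rw [htdef, hy, ← Real.rpow_natCast, ← Real.rpow_add hN0]
      congr 1
      ring
    have h2 : Real.sqrt 2 ^ 2 = 2 := Real.sq_sqrt (by norm_num)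
    have h3 : 1 ≤ Real.sqrt 2 := Real.one_le_sqrt.2 (by norm_num)
    have h9 : (9 : ℝ) ^ m = (3 ^ m) ^ 2 := by rw [← pow_mul, mul_comm, pow_mul]; norm_num
    set ρ := 3 ^ m * Real.sqrt 2 * C * R * y with hρ
    have hρ0 : 0 < ρ := by positivity
    have hρ1 : 3 ^ m * R * y ≤ ρ := by
      have h4 : 1 ≤ Real.sqrt 2 * C := by nlinarith
      calc 3 ^ m * R * y ≤ 3 ^ m * R * y * (Real.sqrt 2 * C) := le_mul_of_one_le_right (by positivity) h4
        _ = ρ := by rw [hρ]; ring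
    have hρ2 : 2 * (9 ^ m * R ^ 2 * y ^ 2) ≤ ρ ^ 2 := by
      have h5 : 1 ≤ C ^ 2 := one_le_pow₀ hC.le
      calc 2 * (9 ^ m * R ^ 2 * y ^ 2) ≤ 2 * (9 ^ m * R ^ 2 * y ^ 2) * C ^ 2 :=
            le_mul_of_one_le_right (by positivity) h5
        _ = ρ ^ 2 := by rw [hρ, h9]; linear_combination (-(3 ^ m) ^ 2 * C ^ 2 * R ^ 2 * y ^ 2) * h2
    -- The three terms `t1`, `t2`, 24·`t3` add up to at most 1/2 + 8/10000 + 24/10000 < 3/4.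
    have t1 : 9 ^ m * t ^ 2 * (N ^ (2 * m) / ρ ^ 2) * R ^ 2 ≤ 1 / 2 := by
      have e : 9 ^ m * t ^ 2 * (N ^ (2 * m) / ρ ^ 2) * R ^ 2 = (9 ^ m * R ^ 2 * y ^ 2) / ρ ^ 2 := by
        rw [← hty, mul_comm 2 m, pow_mul]; ring
      rw [e, div_le_iff₀ (by positivity)]
      linarith
    have t2 : 9 ^ m * t ^ 2 * (8 * N / ρ) * R ^ 2 ≤ 8 / 10000 := by
      have hNm : N ≤ N ^ m := le_self_pow₀ hN1 (by omega)
      have h6 : 9 ^ m * t ^ 2 * (8 * N) * R ^ 2 ≤ (8 * (3 ^ m * R * t)) * (3 ^ m * R * y) := by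
        rw [← hty, h9]
        have : 8 * (3 ^ m) ^ 2 * R ^ 2 * t ^ 2 * N ≤ 8 * (3 ^ m) ^ 2 * R ^ 2 * t ^ 2 * N ^ m := by
          gcongr
        linarith
      have h7 : 3 ^ m * R * t ≤ 1 / 10000 := le_trans (by gcongr) hsmall'
      calc _ = (9 ^ m * t ^ 2 * (8 * N) * R ^ 2) / ρ := by ring
        _ ≤ (8 * (3 ^ m * R * t)) * ρ / ρ := by
            have h10 : 0 ≤ 8 * (3 ^ m * R * t) := by positivity
            exact div_le_div_of_nonneg_right
              (h6.trans (mul_le_mul_of_nonneg_left hρ1 h10)) hρ0.le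
        _ = 8 * (3 ^ m * R * t) := mul_div_cancel_right₀ _ hρ0.ne'
        _ ≤ _ := by linarith
    have t3 := hsq t ht0.le ht
    have hX : 0 ≤ 9 ^ m * t ^ 2 * (N ^ (2 * m) / ρ ^ 2 + 8 * N / ρ + 24) := by positivity
    have h8 := mul_le_mul_of_nonneg_left hvR hX
    linarith

theorem theorem2 :
    (∀ (m : ℕ) (hm : 1 ≤ m) (V : HPlus (-(m : ℝ))),
      ∃ ε : ℝ, 0 < ε ∧ ∃ M : ℝ, 1 ≤ M ∧ ∃ n₀ : ℕ, 1 ≤ n₀ ∧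
        ∀ W : HPlus (-(m : ℝ)), sobolevNorm (-(m : ℝ)) (W - V : HPlus (-(m : ℝ))) ≤ ε →
          Localized m hm W M n₀ (fun n => (2 * (n : ℝ) - 1) ^ m)) ∧
    -- `N` is the effective constant: `n₀ = N (m, p, q, l)` for any natural numbers `p, q, l`
    -- such that `α ≤ 1 - 1 / (p + 1)`, `R ≤ q` and `C ≥ 1 + 1 / (l + 1)`
    (∃ N : ℕ × ℕ × ℕ × ℕ → ℕ, Computable N ∧ (∀ x, 1 ≤ N x) ∧
      ∀ (m : ℕ) (hm : 1 ≤ m) (α : ℝ) (_ : 0 ≤ α) (hα : α < 1) (R : ℝ) (_ : 0 < R),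
        ∃ M : ℝ, 1 ≤ M ∧
          ∀ (C : ℝ) (_ : 1 < C) (p q l : ℕ),
            α ≤ 1 - 1 / ((p : ℝ) + 1) → R ≤ q → 1 + 1 / ((l : ℝ) + 1) ≤ C →
            ∀ V : HPlus (-(m * α)), sobolevNorm (-(m * α)) V ≤ R →
              Localized m hm (HPlus.incl m hα.le V) M (N (m, p, q, l))
                (fun n => 3 ^ m * Real.sqrt 2 * C * R * (2 * (n : ℝ) - 1) ^ (m * α))) := by

  refine ⟨exists_localized_nhds, effectiveConst, computable_effectiveConst, fun x => ?_,
    exists_localized_ball⟩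
  exact Nat.pos_of_ne_zero (by unfold effectiveConst; positivity)
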